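/- **Theorem (Gottesman–Knill, weak simulation with mixed Pauli-basis inputs).** *Quantum side.* Let $n\ge 0$ and let $C=(g_1,\dots,g_m)$ be a Clifford circuit on $n$ qubits, that is, a finite sequence of Clifford operations (unitaries $V$ such that $VPV^\dagger$ is a Pauli product, i.e. an element of $\{\pm1,\pm i\}\times\{I,X,Y,Z\}^{\otimes n}$, for every Pauli product $P$). Each operation is described either as one of the gates $H_i$, $S_i$, $\mathrm{CNOT}_{c,t}$ ($c\neq t$), or by the table of the Pauli products $VX_jV^\dagger$ and $VZ_jV^\dagger$, $0\le j<n$. Let $U=V_m\cdots V_1$ be the resulting unitary. Let the input be $\rho=\bigotimes_i\rho_i$ with $$\rho_i=\sum_{a} p^{(i)}_a|a\rangle\langle a|,\qquad a\in\{|+\rangle,|-\rangle,|{+i}\rangle,|{-i}\rangle,|0\rangle,|1\rangle\},$$ where $p^{(i)}_a\ge 0$ are arbitrary real numbers with $\sum_a p^{(i)}_a=1$ for every $i$. Measuring all qubits in the $Z$ basis after $U$ gives $x\in\{0,1\}^n$ with probability $P_C(x)=\mathrm{Tr}\left[|x\rangle\langle x|\,U\rho U^\dagger\right]$. *Classical side.*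 A randomized program works on finitely many stacks of bits (push, pop, test of the top bit, loops, each of cost one), may toss fair coins, and receives the description $\langle C\rangle$ of the circuit as a word of bits, with numbers in unary. For each $i$ and $a$ it may query the digits, one by one, of a binary expansion $b_0b_1b_2\dots$, finite or infinite, of the real number $p^{(i)}_a=\sum_j b_j2^{-j}$, where it is told when a finite expansion has ended. *Claim.* There are one such program $M$ and one polynomial $q$ such that for all $C$, all $p^{(i)}_a$ and all expansions of them, with $s=|\langle C\rangle|$ the length of the description: 1. for every $x\in\{0,1\}^n$, the probability that $M$ halts with output $x$ is exactly $P_C(x)$; 2. for every $k\in\mathbb N$, the probability that $M$ has not halted after $q(s+k)$ steps is at most $2^{-k}$; 3. if, for some $L$, all the given expansions have at most $L$ digits, then $M$ halts after at most $q(s+L)$ steps, whatever the results of the coin tosses. -/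

import Mathlib

open scoped Matrix

namespace GK

noncomputable section

/-! ### Qubits, Pauli products, Clifford operations -/

/-- Operators on `n` qubits, as matrices in the computational basis `|x⟩`, `x ∈ {0,1}ⁿ`. -/
abbrev Op (n : ℕ) : Type := Matrix (Fin n → Fin 2) (Fin n → Fin 2) ℂ

/-- The tensor product `A₀ ⊗ ⋯ ⊗ Aₙ₋₁` of single-qubit operators. -/
def tensor {n : ℕ} (A : Fin n → Matrix (Fin 2) (Fin 2) ℂ) : Op n :=
  Matrix.of fun x y => ∏ i, A i (x i) (y i)

/-- The operator that acts as `A` on qubit `i` and as the identity on the others. -/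
def onQubit {n : ℕ} (i : Fin n) (A : Matrix (Fin 2) (Fin 2) ℂ) : Op n :=
  tensor (Function.update (fun _ => 1) i A)

def matX : Matrix (Fin 2) (Fin 2) ℂ := !![0, 1; 1, 0]
def matY : Matrix (Fin 2) (Fin 2) ℂ := !![0, -Complex.I; Complex.I, 0]
def matZ : Matrix (Fin 2) (Fin 2) ℂ := !![1, 0; 0, -1]
def matH : Matrix (Fin 2) (Fin 2) ℂ := ((1 / √2 : ℝ) : ℂ) • !![1, 1; 1, -1]
def matS : Matrix (Fin 2) (Fin 2) ℂ := !![1, 0; 0, Complex.I]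

/-- The controlled-NOT gate `|0⟩⟨0|_c ⊗ I_t + |1⟩⟨1|_c ⊗ X_t`. -/
def cnotOp {n : ℕ} (c t : Fin n) : Op n :=
  onQubit c !![1, 0; 0, 0] + onQubit c !![0, 0; 0, 1] * onQubit t matX

inductive Letter
  | I | X | Y | Z

def Letter.toMatrix : Letter → Matrix (Fin 2) (Fin 2) ℂ
  | .I => 1
  | .X => matX
  | .Y => matY
  | .Z => matZ

/-- A Pauli product: an element of `{±1, ±i} × {I, X, Y, Z}^{⊗n}`.
The field `phase` is the exponent of `i`. -/
structure Pauli (n : ℕ) where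
  phase : Fin 4
  letter : Fin n → Letter

def Pauli.toOp {n : ℕ} (P : Pauli n) : Op n :=
  Complex.I ^ (P.phase : ℕ) • tensor fun i => (P.letter i).toMatrix

/-- A Clifford operation: a unitary that maps every Pauli product to a Pauli product
under conjugation. -/
def IsClifford {n : ℕ} (U : Op n) : Prop :=
  U ∈ Matrix.unitaryGroup (Fin n → Fin 2) ℂ ∧
    ∀ P : Pauli n, ∃ Q : Pauli n, U * P.toOp * Uᴴ = Q.toOp

/-- Finite descriptions of Clifford operations on `n` qubits: one of the elementary gates,
or a table that lists the images of all `X_j` and all `Z_j` under conjugation, which is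
available for every Clifford operation. -/
inductive Gate (n : ℕ)
  | had (i : Fin n)
  | phase (i : Fin n)
  | cnot (c t : Fin n) (h : c ≠ t)
  | table (imX imZ : Fin n → Pauli n)

/-- `g.Denotes U`: the Clifford operation `U` is described by `g`
(for a table, `U` is determined up to a global phase). -/
def Gate.Denotes {n : ℕ} : Gate n → Op n → Prop
  | .had i, U => U = onQubit i matH
  | .phase i, U => U = onQubit i matS
  | .cnot c t _, U => U = cnotOp c t
  | .table imX imZ, U => IsClifford U ∧ ∀ j,
      U * onQubit j matX * Uᴴ = (imX j).toOp ∧ U * onQubit j matZ * Uᴴ = (imZ j).toOp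

/-- A Clifford circuit is a list of descriptions of Clifford operations; the head of the list is
applied first. `CircuitDenotes C U` says that `U` is the resulting operation. -/
def CircuitDenotes {n : ℕ} : List (Gate n) → Op n → Prop
  | [], U => U = 1
  | g :: C, U => ∃ V W, g.Denotes V ∧ CircuitDenotes C W ∧ U = W * V

/-! ### Input states and measurement -/

/-- The Pauli-basis states `|+⟩, |-⟩, |+i⟩, |-i⟩, |0⟩, |1⟩`. -/
inductive BasisState
  | plus | minus | plusI | minusI | zero | one
  deriving DecidableEq

instance : Fintype BasisState where
  elems := {BasisState.plus, BasisState.minus, BasisState.plusI, BasisState.minusI,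
    BasisState.zero, BasisState.one}
  complete a := by cases a <;> simp

def BasisState.ket : BasisState → Fin 2 → ℂ
  | .plus => ((1 / √2 : ℝ) : ℂ) • ![1, 1]
  | .minus => ((1 / √2 : ℝ) : ℂ) • ![1, -1]
  | .plusI => ((1 / √2 : ℝ) : ℂ) • ![1, Complex.I]
  | .minusI => ((1 / √2 : ℝ) : ℂ) • ![1, -Complex.I]
  | .zero => ![1, 0]
  | .one => ![0, 1]

/-- The projector `|ψ⟩⟨ψ|`. -/
def BasisState.density (a : BasisState) : Matrix (Fin 2) (Fin 2) ℂ :=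
  Matrix.vecMulVec a.ket (star a.ket)

/-- The product state `ρ₀ ⊗ ⋯ ⊗ ρₙ₋₁`, where `ρᵢ = ∑ₐ p i a |a⟩⟨a|`. -/
def productState {n : ℕ} (p : Fin n → BasisState → ℝ) : Op n :=
  tensor fun i => ∑ a, (p i a : ℂ) • a.density

/-- The Born probability `Tr(|x⟩⟨x| U ρ U†)` of the outcome `x` when all qubits of `U ρ U†`
are measured in the `Z` basis. -/
def outcomeProb {n : ℕ} (U ρ : Op n) (x : Fin n → Fin 2) : ℂ :=
  (Matrix.single x x 1 * (U * ρ * Uᴴ)).trace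

/-! ### Randomized computation

Programs for a machine with finitely many stacks of bits (the registers that occur in the
program), a fair coin, and read access to the real input data through an oracle. Each step changes
at most one stack and, apart from an answer of the oracle overwriting a register, by at most one
bit, so that the number of steps is, up to a polynomial, the running time of a probabilistic
multitape Turing machine with the same access to the real data. -/

end

/-- Commands. The tests in `cases` and `loop` only look at the top of the register `r`. -/
inductive Prog
  /-- do nothing -/
  | skip
  /-- push the bit `b` on register `r` -/
  | push (r : ℕ) (b : Bool)
  /-- remove the top bit of register `r`, if there is one -/
  | pop (r : ℕ)
  /-- toss a fair coin and push the result on register `r` -/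
  | flip (r : ℕ)
  /-- replace the content of `r` by the answer of the oracle to the word in `a` -/
  | query (a r : ℕ)
  /-- first `P`, then `Q` -/
  | seq (P Q : Prog)
  /-- branch: `r` is empty, its top bit is `0`, its top bit is `1` -/
  | cases (r : ℕ) (ifEmpty ifFalse ifTrue : Prog)
  /-- while `r` is not empty, do `P` -/
  | loop (r : ℕ) (P : Prog)

/-- A configuration: the commands that remain to be executed, the registers, and the results of
the coin tosses that have not been used yet. -/
structure Config where
  todo : List Prog
  reg : ℕ → List Bool
  coins : ℕ → Bool

/-- One step of the machine with oracle `O`. A configuration with nothing left to do is final. -/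
def step (O : List Bool → Option Bool) : Config → Config
  | ⟨[], s, ω⟩ => ⟨[], s, ω⟩
  | ⟨.skip :: K, s, ω⟩ => ⟨K, s, ω⟩
  | ⟨.push r b :: K, s, ω⟩ => ⟨K, Function.update s r (b :: s r), ω⟩
  | ⟨.pop r :: K, s, ω⟩ => ⟨K, Function.update s r (s r).tail, ω⟩
  | ⟨.flip r :: K, s, ω⟩ => ⟨K, Function.update s r (ω 0 :: s r), fun j => ω (j + 1)⟩
  | ⟨.query a r :: K, s, ω⟩ => ⟨K, Function.update s r (O (s a)).toList, ω⟩
  | ⟨.seq P Q :: K, s, ω⟩ => ⟨P :: Q :: K, s, ω⟩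
  | ⟨.cases r P Q R :: K, s, ω⟩ =>
      match s r with
      | [] => ⟨P :: K, s, ω⟩
      | false :: _ => ⟨Q :: K, s, ω⟩
      | true :: _ => ⟨R :: K, s, ω⟩
  | ⟨.loop r P :: K, s, ω⟩ =>
      match s r with
      | [] => ⟨K, s, ω⟩
      | _ :: _ => ⟨P :: .loop r P :: K, s, ω⟩

/-- The configuration after `t` steps of `M`, started with the word `w` in register `0` and all
other registers empty, when `ω` is the sequence of coin tosses. -/
def run (M : Prog) (O : List Bool → Option Bool) (w : List Bool) (ω : ℕ → Bool) (t : ℕ) : Config :=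
  (step O)^[t] ⟨[M], Function.update (fun _ => []) 0 w, ω⟩

/-- `M` halts after at most `t` steps. -/
def HaltsWithin (M : Prog) (O : List Bool → Option Bool) (w : List Bool) (ω : ℕ → Bool)
    (t : ℕ) : Prop :=
  (run M O w ω t).todo = []

/-- `M` halts with the word `y` in the output register `1`. -/
def Outputs (M : Prog) (O : List Bool → Option Bool) (w : List Bool) (ω : ℕ → Bool)
    (y : List Bool) : Prop :=
  ∃ t, (run M O w ω t).todo = [] ∧ (run M O w ω t).reg 1 = y

/-- The law of an infinite sequence of independent fair coin tosses. -/
noncomputable def fairCoins : MeasureTheory.Measure (ℕ → Bool) :=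
  MeasureTheory.Measure.infinitePi fun _ => (PMF.uniformOfFintype Bool).toMeasure

/-! ### How circuits and probabilities are given to the machine -/

def encodeNat (m : ℕ) : List Bool := List.replicate m true ++ [false]

def Letter.encode : Letter → List Bool
  | .I => [false, false]
  | .X => [true, false]
  | .Y => [true, true]
  | .Z => [false, true]

def encodePhase : Fin 4 → List Bool
  | 0 => [false, false]
  | 1 => [false, true]
  | 2 => [true, false]
  | 3 => [true, true]

def Pauli.encode {n : ℕ} (P : Pauli n) : List Bool :=
  encodePhase P.phase ++ (List.ofFn fun i => (P.letter i).encode).flatten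

def Gate.encode {n : ℕ} : Gate n → List Bool
  | .had i => [false, false] ++ encodeNat i
  | .phase i => [false, true] ++ encodeNat i
  | .cnot c t _ => [true, false] ++ encodeNat c ++ encodeNat t
  | .table imX imZ =>
      [true, true] ++ (List.ofFn fun j => (imX j).encode ++ (imZ j).encode).flatten

/-- The number of qubits in unary, followed by the gates, each announced by the bit `1`,
and the end marker `0`. -/
def encodeCircuit {n : ℕ} (C : List (Gate n)) : List Bool :=
  encodeNat n ++ (C.map fun g => true :: g.encode).flatten ++ [false]

def BasisState.index : BasisState → ℕ
  | .plus => 0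
  | .minus => 1
  | .plusI => 2
  | .minusI => 3
  | .zero => 4
  | .one => 5

/-- The query for the binary digit number `j` of the probability of the state `a` on qubit `i`. -/
def address {n : ℕ} (i : Fin n) (a : BasisState) (j : ℕ) : List Bool :=
  encodeNat i ++ encodeNat a.index ++ encodeNat j

/-- The oracle `O` gives access to binary expansions of the reals `p i a`: the answers to the
queries for `j = 0, 1, 2, …` form a finite or infinite word of bits `b₀ b₁ b₂ …` (the answer `none`
says that the word has ended) with `p i a = ∑ⱼ bⱼ 2⁻ʲ`. -/
def Represents {n : ℕ} (O : List Bool → Option Bool) (p : Fin n → BasisState → ℝ) : Prop :=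
  ∀ i a,
    (∀ j, O (address i a j) = none → O (address i a (j + 1)) = none) ∧
    HasSum (fun j : ℕ => if O (address i a j) = some true then (1 / 2 : ℝ) ^ j else 0) (p i a)

/-- The output word of measurement outcomes. -/
def outcomeWord {n : ℕ} (x : Fin n → Fin 2) : List Bool :=
  List.ofFn fun i => decide (x i = 1)

end GK

open scoped Matrix

namespace GK

/-! ### Execution of programs -/

/-! The program draws a pure product of basis states and one random bit per qubit, carries the
stabilizer generators of that state through the circuit, and obtains an outcome by linear algebra
over the field with two elements.

Quantum part. Each of the six basis states is a projector `(1 ± P)/2` with a single-qubit Pauli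
operator `P`. A product of them is therefore the product of the projectors `(1 + A)/2` for `n`
commuting signed Pauli products `A`, and conjugation by `U` replaces each `A` by a Pauli product
that is computed from the tables of the gates. The Born probability of `x` is the diagonal entry at
`x` of the resulting product of projectors. Multiplying one generator by another does not change
this product (`half_mul_half`), so Gaussian elimination is allowed. A pivot with an `X`-part at
qubit `j`, where the other rows have none, merely halves the diagonal (`projList_pivot_apply`). The
rows left after all `X`-parts are eliminated are diagonal, and their projectors are indicators of
parity conditions on `x`. Elimination of the `Z`-parts makes this system triangular
(`foldl_elimStep_snd`), and back substitution from uniform bits reaches all solutions equally often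
(`exists_card_solve`). The Born distribution and the simulated one are thus multiples of the same
indicator with total mass one, hence equal (`simulate_correct`), and no normalization has to be
computed. Mixed inputs follow by linearity (`outcomeProb_productState`).

Sampling part. The state of a qubit is drawn by the method of Knuth and Yao. If `N j` of the six
expansions have the digit 1 at position `j`, then `∑ N j / 2^j = 1`, so there is a binary tree with
exactly `N j` leaves at depth `j`. A walk down this tree by coin tosses ends at a leaf labelled `a`
with probability exactly `p i a`, for arbitrary reals. At most 12 nodes lie at any depth
(`nodes_le`), so a walk is described by its depth and a bounded position. The exact law is
`hitProb_mkState`; the chance that walks are still going on decays geometrically (`delay_mkState`);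
with at most `L` digits every walk ends within `L` tosses (`evolve_finished`).

Machine part. Values are binary trees, stored by a prefix-free code on top of register `0`. The
functions computed in polynomial time are closed under composition, pairing, case distinction and
iteration over lists with polynomially bounded intermediate values. The tableau algorithm and a
single step of the walk are built from these. Coins occur only in the main loop, and the program
halts exactly when the random process finishes (`exists_program`). -/

abbrev Oracle := List Bool → Option Bool

abbrev Regs := ℕ → List Bool

/-- `P`, started with the registers `s`, ends after at most `T` steps with the registers `s'`,
without tossing coins. -/
def RunsIn (O : Oracle) (P : Prog) (s s' : Regs) (T : ℕ) : Prop :=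
  ∃ t ≤ T, ∀ K ω, (step O)^[t] ⟨P :: K, s, ω⟩ = ⟨K, s', ω⟩

namespace RunsIn

variable {O : Oracle} {P Q R : Prog} {s s' s'' : Regs} {T T' r : ℕ}

theorem mono (h : RunsIn O P s s' T) (hT : T ≤ T') : RunsIn O P s s' T' := by
  obtain ⟨t, ht, h⟩ := h
  exact ⟨t, ht.trans hT, h⟩

theorem skip : RunsIn O .skip s s 1 := ⟨1, le_rfl, fun _ _ => rfl⟩

theorem push {b : Bool} : RunsIn O (.push r b) s (Function.update s r (b :: s r)) 1 :=
  ⟨1, le_rfl, fun _ _ => rfl⟩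

theorem pop : RunsIn O (.pop r) s (Function.update s r (s r).tail) 1 :=
  ⟨1, le_rfl, fun _ _ => rfl⟩

theorem query {a : ℕ} :
    RunsIn O (.query a r) s (Function.update s r (O (s a)).toList) 1 :=
  ⟨1, le_rfl, fun _ _ => rfl⟩

theorem seq (h : RunsIn O P s s' T) (h' : RunsIn O Q s' s'' T') :
    RunsIn O (.seq P Q) s s'' (T + T' + 1) := by
  obtain ⟨t, ht, h⟩ := h
  obtain ⟨t', ht', h'⟩ := h'
  refine ⟨t' + (t + 1), by omega, fun K ω => ?_⟩
  rw [Function.iterate_add_apply, Function.iterate_succ_apply]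
  simp only [step]
  rw [h, h']

theorem cases_nil (hs : s r = []) (h : RunsIn O P s s' T) :
    RunsIn O (.cases r P Q R) s s' (T + 1) := by
  obtain ⟨t, ht, h⟩ := h
  refine ⟨t + 1, by omega, fun K ω => ?_⟩
  rw [Function.iterate_succ_apply]
  simp only [step, hs]
  rw [h]

theorem cases_false {l : List Bool} (hs : s r = false :: l) (h : RunsIn O Q s s' T) :
    RunsIn O (.cases r P Q R) s s' (T + 1) := by
  obtain ⟨t, ht, h⟩ := h
  refine ⟨t + 1, by omega, fun K ω => ?_⟩
  rw [Function.iterate_succ_apply]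
  simp only [step, hs]
  rw [h]

theorem cases_true {l : List Bool} (hs : s r = true :: l) (h : RunsIn O R s s' T) :
    RunsIn O (.cases r P Q R) s s' (T + 1) := by
  obtain ⟨t, ht, h⟩ := h
  refine ⟨t + 1, by omega, fun K ω => ?_⟩
  rw [Function.iterate_succ_apply]
  simp only [step, hs]
  rw [h]

theorem loop_nil (hs : s r = []) : RunsIn O (.loop r P) s s 1 := by
  refine ⟨1, le_rfl, fun K ω => ?_⟩
  simp [step, hs]

theorem loop_cons {b : Bool} {l : List Bool} (hs : s r = b :: l) (h : RunsIn O P s s' T)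
    (h' : RunsIn O (.loop r P) s' s'' T') : RunsIn O (.loop r P) s s'' (T + T' + 1) := by
  obtain ⟨t, ht, h⟩ := h
  obtain ⟨t', ht', h'⟩ := h'
  refine ⟨t' + (t + 1), by omega, fun K ω => ?_⟩
  rw [Function.iterate_add_apply, Function.iterate_succ_apply]
  simp only [step, hs]
  rw [h, h']

end RunsIn

/-- The registers with prescribed contents of the first four of them. -/
def regs (a b c d : List Bool) (s : Regs) : Regs
  | 0 => a
  | 1 => b
  | 2 => c
  | 3 => d
  | i + 4 => s i

section regs

variable {a b c d x : List Bool} {s : Regs}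

@[simp] theorem regs_zero : regs a b c d s 0 = a := rfl
@[simp] theorem regs_one : regs a b c d s 1 = b := rfl
@[simp] theorem regs_two : regs a b c d s 2 = c := rfl
@[simp] theorem regs_three : regs a b c d s 3 = d := rfl

@[simp] theorem update_regs_zero : Function.update (regs a b c d s) 0 x = regs x b c d s := by
  funext i
  rcases i with _ | _ | _ | _ | i <;> rfl

@[simp] theorem update_regs_one : Function.update (regs a b c d s) 1 x = regs a x c d s := by
  funext i
  rcases i with _ | _ | _ | _ | i <;> rfl

@[simp] theorem update_regs_two : Function.update (regs a b c d s) 2 x = regs a b x d s := by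
  funext i
  rcases i with _ | _ | _ | _ | i <;> rfl

@[simp] theorem update_regs_three : Function.update (regs a b c d s) 3 x = regs a b c x s := by
  funext i
  rcases i with _ | _ | _ | _ | i <;> rfl

theorem eq_regs (s : Regs) : s = regs (s 0) (s 1) (s 2) (s 3) fun i => s (i + 4) := by
  funext i
  rcases i with _ | _ | _ | _ | i <;> rfl

end regs

/-! ### Stack subroutines: moving, clearing and copying words and trees -/

/-- Move the content of register `x` to the register `y`, in reversed order. -/
def moveAll (x y : ℕ) : Prog :=
  .loop x (.cases x .skip (.seq (.pop x) (.push y false)) (.seq (.pop x) (.push y true)))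

theorem moveAll_runs {O : Oracle} {x y : ℕ} (hxy : x ≠ y) (l : List Bool) :
    ∀ s : Regs, s x = l → RunsIn O (moveAll x y) s
      (Function.update (Function.update s x []) y (l.reverse ++ s y)) (5 * l.length + 1) := by
  induction l with
  | nil =>
    intro s hs
    have h : Function.update (Function.update s x []) y (([] : List Bool).reverse ++ s y) = s := by
      rw [← hs, Function.update_eq_self]; simp [hs]
    rw [h]
    exact .loop_nil hs
  | cons b l ih =>
    intro s hs
    have hstep : RunsIn O (.cases x .skip (.seq (.pop x) (.push y false))
        (.seq (.pop x) (.push y true))) s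
        (Function.update (Function.update s x l) y (b :: s y)) 4 := by
      have h1 : RunsIn O (.seq (.pop x) (.push y b)) s
          (Function.update (Function.update s x l) y (b :: s y)) 3 := by
        have := RunsIn.seq (O := O) (RunsIn.pop (s := s) (r := x)) (RunsIn.push (r := y) (b := b))
        rwa [hs, Function.update_of_ne hxy.symm] at this
      cases b
      · exact .cases_false hs h1
      · exact .cases_true hs h1
    have h2 := ih (Function.update (Function.update s x l) y (b :: s y)) (by simp [hxy])
    have h3 := RunsIn.loop_cons hs hstep h2
    refine RunsIn.mono (T := 4 + (5 * l.length + 1) + 1) ?_ (by simp; omega)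
    refine (congrArg (RunsIn O (moveAll x y) s · _) ?_).mp h3
    funext i
    simp only [Function.update_apply]
    split_ifs <;> simp_all

/-- Empty the register `x`. -/
def clear (x : ℕ) : Prog := .loop x (.pop x)

theorem clear_runs {O : Oracle} {x : ℕ} (l : List Bool) :
    ∀ s : Regs, s x = l → RunsIn O (clear x) s (Function.update s x []) (2 * l.length + 1) := by
  induction l with
  | nil =>
    intro s hs
    rw [← hs, Function.update_eq_self, hs]
    exact .loop_nil hs
  | cons b l ih =>
    intro s hs
    have h3 := RunsIn.loop_cons hs (RunsIn.pop (O := O)) (ih (Function.update s x (s x).tail)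
      (by simp [hs]))
    refine RunsIn.mono ?_ (show 1 + (2 * l.length + 1) + 1 ≤ _ by simp; omega)
    simpa [clear] using h3

/-- Binary trees, the values that programs compute with. -/
inductive Tree
  | leaf
  | node (a b : Tree)

/-- The code of a tree in a register. -/
def Tree.code : Tree → List Bool
  | .leaf => [false]
  | .node a b => true :: (a.code ++ b.code)

/-- Move the tree at the top of register `0` to register `y`, in reversed order. Register `2` counts
the trees that are still to be moved. -/
def moveTreeLoop (y : ℕ) : Prog :=
  .loop 2 (.cases 0 .skip (.seq (.pop 0) (.seq (.push y false) (.pop 2)))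
    (.seq (.pop 0) (.seq (.push y true) (.push 2 true))))

def moveTree (y : ℕ) : Prog := .seq (.push 2 true) (moveTreeLoop y)

/-- The loop stops only when the counter in register `2` is empty, so after a subtree it is still
running. The statement is therefore in continuation form: whatever the loop does after the tree has
been moved, it also does from before, 7 steps later per bit of the code. A leaf lowers the counter
by one, a node raises it by one. -/
theorem moveTreeLoop_runs_one {O : Oracle} (t : Tree) :
    ∀ (a b c d : List Bool) (s s' : Regs) (T : ℕ),
      RunsIn O (moveTreeLoop 1) (regs a (t.code.reverse ++ b) c d s) s' T →
      RunsIn O (moveTreeLoop 1) (regs (t.code ++ a) b (true :: c) d s) s'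
        (T + 7 * t.code.length) := by
  induction t with
  | leaf =>
    intro a b c d s s' T h
    have h1 := RunsIn.seq (O := O) (RunsIn.pop (r := 0) (s := regs (false :: a) b (true :: c) d s))
      (RunsIn.seq (RunsIn.push (r := 1) (b := false)) (RunsIn.pop (r := 2)))
    simp only [update_regs_zero, update_regs_one, update_regs_two, regs_zero, regs_one, regs_two,
      List.tail_cons] at h1
    refine RunsIn.mono (RunsIn.loop_cons (r := 2) rfl (RunsIn.cases_false rfl h1) h) ?_
    simp [Tree.code]; omega
  | node t u iht ihu =>
    intro a b c d s s' T h
    have h1 := RunsIn.seq (O := O)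
      (RunsIn.pop (r := 0) (s := regs (true :: (t.code ++ (u.code ++ a))) b (true :: c) d s))
      (RunsIn.seq (RunsIn.push (r := 1) (b := true)) (RunsIn.push (r := 2) (b := true)))
    simp only [update_regs_zero, update_regs_one, update_regs_two, regs_zero, regs_one, regs_two,
      List.tail_cons] at h1
    have h2 := iht (u.code ++ a) (true :: b) (true :: c) d s s' _ (ihu a _ c d s s' T
      (by simpa [Tree.code] using h))
    refine RunsIn.mono (RunsIn.loop_cons (r := 2) rfl (RunsIn.cases_true
      (by simp [Tree.code]; rfl) (by simpa [Tree.code] using h1)) h2) ?_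
    simp [Tree.code]; omega

theorem moveTreeLoop_runs_three {O : Oracle} (t : Tree) :
    ∀ (a b c d : List Bool) (s s' : Regs) (T : ℕ),
      RunsIn O (moveTreeLoop 3) (regs a b c (t.code.reverse ++ d) s) s' T →
      RunsIn O (moveTreeLoop 3) (regs (t.code ++ a) b (true :: c) d s) s'
        (T + 7 * t.code.length) := by
  induction t with
  | leaf =>
    intro a b c d s s' T h
    have h1 := RunsIn.seq (O := O) (RunsIn.pop (r := 0) (s := regs (false :: a) b (true :: c) d s))
      (RunsIn.seq (RunsIn.push (r := 3) (b := false)) (RunsIn.pop (r := 2)))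
    simp only [update_regs_zero, update_regs_three, update_regs_two, regs_zero, regs_three,
      regs_two, List.tail_cons] at h1
    refine RunsIn.mono (RunsIn.loop_cons (r := 2) rfl (RunsIn.cases_false rfl h1) h) ?_
    simp [Tree.code]; omega
  | node t u iht ihu =>
    intro a b c d s s' T h
    have h1 := RunsIn.seq (O := O)
      (RunsIn.pop (r := 0) (s := regs (true :: (t.code ++ (u.code ++ a))) b (true :: c) d s))
      (RunsIn.seq (RunsIn.push (r := 3) (b := true)) (RunsIn.push (r := 2) (b := true)))
    simp only [update_regs_zero, update_regs_three, update_regs_two, regs_zero, regs_three,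
      regs_two, List.tail_cons] at h1
    have h2 := iht (u.code ++ a) b (true :: c) (true :: d) s s' _ (ihu a b c _ s s' T
      (by simpa [Tree.code] using h))
    refine RunsIn.mono (RunsIn.loop_cons (r := 2) rfl (RunsIn.cases_true
      (by simp [Tree.code]; rfl) (by simpa [Tree.code] using h1)) h2) ?_
    simp [Tree.code]; omega

theorem moveTree_runs_one {O : Oracle} (t : Tree) (a b d : List Bool) (s : Regs) :
    RunsIn O (moveTree 1) (regs (t.code ++ a) b [] d s) (regs a (t.code.reverse ++ b) [] d s)
      (7 * t.code.length + 3) := by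
  have h := RunsIn.seq (O := O) (RunsIn.push (r := 2) (b := true)
    (s := regs (t.code ++ a) b [] d s)) (by
      simpa using moveTreeLoop_runs_one t a b [] d s _ 1 (.loop_nil rfl))
  exact h.mono (by omega)

theorem moveTree_runs_three {O : Oracle} (t : Tree) (a b d : List Bool) (s : Regs) :
    RunsIn O (moveTree 3) (regs (t.code ++ a) b [] d s) (regs a b [] (t.code.reverse ++ d) s)
      (7 * t.code.length + 3) := by
  have h := RunsIn.seq (O := O) (RunsIn.push (r := 2) (b := true)
    (s := regs (t.code ++ a) b [] d s)) (by
      simpa using moveTreeLoop_runs_three t a b [] d s _ 1 (.loop_nil rfl))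
  exact h.mono (by omega)

/-- Remove the tree at the top of register `0`. -/
def dropTree : Prog := .seq (moveTree 1) (clear 1)

theorem dropTree_runs {O : Oracle} (t : Tree) (a : List Bool) (s : Regs) :
    RunsIn O dropTree (regs (t.code ++ a) [] [] [] s) (regs a [] [] [] s)
      (9 * t.code.length + 5) := by
  have h := RunsIn.seq (moveTree_runs_one (O := O) t a [] [] s) (clear_runs (x := 1) _ _ rfl)
  simp only [update_regs_one, regs_one, List.append_nil, List.length_reverse] at h
  exact h.mono (by omega)

/-- Exchange the two trees at the top of register `0`. -/
def swapTrees : Prog :=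
  .seq (moveTree 1) (.seq (moveTree 3) (.seq (moveAll 1 0) (moveAll 3 0)))

theorem swapTrees_runs {O : Oracle} (t u : Tree) (a : List Bool) (s : Regs) :
    RunsIn O swapTrees (regs (t.code ++ (u.code ++ a)) [] [] [] s)
      (regs (u.code ++ (t.code ++ a)) [] [] [] s) (12 * (t.code.length + u.code.length) + 12) := by
  have h := RunsIn.seq (moveTree_runs_one (O := O) t (u.code ++ a) [] [] s)
    (RunsIn.seq (moveTree_runs_three u _ _ _ _) (RunsIn.seq
      (moveAll_runs (by decide : (1 : ℕ) ≠ 0) _ _ rfl)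
      (moveAll_runs (by decide : (3 : ℕ) ≠ 0) _ _ rfl)))
  simp only [update_regs_one, update_regs_zero, update_regs_three, regs_one, regs_zero,
    regs_three, List.append_nil, List.length_reverse, List.reverse_reverse] at h
  exact h.mono (by omega)

/-- Move the content of register `1` to register `0` and to register `2`. -/
def copyBoth : Prog :=
  .loop 1 (.cases 1 .skip (.seq (.pop 1) (.seq (.push 0 false) (.push 2 false)))
    (.seq (.pop 1) (.seq (.push 0 true) (.push 2 true))))

theorem copyBoth_runs {O : Oracle} (l : List Bool) :
    ∀ (a c d : List Bool) (s : Regs), RunsIn O copyBoth (regs a l c d s)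
      (regs (l.reverse ++ a) [] (l.reverse ++ c) d s) (7 * l.length + 1) := by
  induction l with
  | nil => exact fun a c d s => .loop_nil rfl
  | cons b l ih =>
    intro a c d s
    have h1 := RunsIn.seq (O := O) (RunsIn.pop (r := 1) (s := regs a (b :: l) c d s))
      (RunsIn.seq (RunsIn.push (r := 0) (b := b)) (RunsIn.push (r := 2) (b := b)))
    simp only [update_regs_zero, update_regs_one, update_regs_two, regs_zero, regs_one, regs_two,
      List.tail_cons] at h1
    have h2 : RunsIn O (.cases 1 .skip (.seq (.pop 1) (.seq (.push 0 false) (.push 2 false)))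
        (.seq (.pop 1) (.seq (.push 0 true) (.push 2 true)))) (regs a (b :: l) c d s)
        (regs (b :: a) l (b :: c) d s) 6 := by
      cases b
      · exact .cases_false rfl h1
      · exact .cases_true rfl h1
    have h3 := RunsIn.loop_cons (r := 1) rfl h2 (ih _ _ _ _)
    refine RunsIn.mono (T := 6 + (7 * l.length + 1) + 1) ?_ (by simp; omega)
    simpa [copyBoth] using h3

/-- Duplicate the tree at the top of register `0`. -/
def dupTree : Prog :=
  .seq (moveTree 1) (.seq copyBoth (.seq (moveAll 2 3) (moveAll 3 0)))

theorem dupTree_runs {O : Oracle} (t : Tree) (a : List Bool) (s : Regs) :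
    RunsIn O dupTree (regs (t.code ++ a) [] [] [] s)
      (regs (t.code ++ (t.code ++ a)) [] [] [] s) (24 * t.code.length + 9) := by
  have h := RunsIn.seq (moveTree_runs_one (O := O) t a [] [] s)
    (RunsIn.seq (copyBoth_runs _ _ _ _ _) (RunsIn.seq
      (moveAll_runs (by decide : (2 : ℕ) ≠ 3) _ _ rfl)
      (moveAll_runs (by decide : (3 : ℕ) ≠ 0) _ _ rfl)))
  simp only [update_regs_two, update_regs_zero, update_regs_three, regs_two, regs_zero,
    regs_three, List.append_nil, List.length_reverse, List.reverse_reverse] at h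
  exact h.mono (by omega)

/-- Push a fixed word on register `0`. -/
def pushWord : List Bool → Prog
  | [] => .skip
  | b :: l => .seq (pushWord l) (.push 0 b)

theorem pushWord_runs {O : Oracle} (l : List Bool) (s : Regs) :
    RunsIn O (pushWord l) s (Function.update s 0 (l ++ s 0)) (2 * l.length + 1) := by
  induction l with
  | nil => simpa [pushWord] using RunsIn.skip (s := s)
  | cons b l ih =>
    have h := RunsIn.seq ih (RunsIn.push (r := 0) (b := b))
    simp only [Function.update_self, Function.update_idem] at h
    exact h.mono (by simp; omega)

end GK

namespace GK

/-! ### Polynomially bounded functions -/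

/-- Monotone functions that are bounded by a polynomial. -/
def PolyBounded (g : ℕ → ℕ) : Prop :=
  Monotone g ∧ ∃ q : Polynomial ℕ, ∀ n, g n ≤ q.eval n

namespace PolyBounded

variable {g h : ℕ → ℕ}

theorem const (c : ℕ) : PolyBounded fun _ => c :=
  ⟨monotone_const, .C c, fun n => by simp⟩

theorem id : PolyBounded fun n => n := ⟨monotone_id, .X, fun n => by simp⟩

theorem add (hg : PolyBounded g) (hh : PolyBounded h) : PolyBounded fun n => g n + h n := by
  obtain ⟨mg, p, hp⟩ := hg
  obtain ⟨mh, q, hq⟩ := hh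
  exact ⟨mg.add mh, p + q, fun n => by simpa using add_le_add (hp n) (hq n)⟩

theorem mul (hg : PolyBounded g) (hh : PolyBounded h) : PolyBounded fun n => g n * h n := by
  obtain ⟨mg, p, hp⟩ := hg
  obtain ⟨mh, q, hq⟩ := hh
  exact ⟨fun a b hab => Nat.mul_le_mul (mg hab) (mh hab), p * q,
    fun n => by simpa using Nat.mul_le_mul (hp n) (hq n)⟩

/-- This is where monotonicity is needed: the bound for `h n` is inserted into `g` before the bound
for `g` is used. -/
theorem comp (hg : PolyBounded g) (hh : PolyBounded h) : PolyBounded fun n => g (h n) := by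
  obtain ⟨mg, p, hp⟩ := hg
  obtain ⟨mh, q, hq⟩ := hh
  exact ⟨mg.comp mh, p.comp q, fun n => by
    rw [Polynomial.eval_comp]
    exact (mg (hq n)).trans (hp _)⟩

end PolyBounded

/-! ### Values and their codes -/

/-- Types whose elements are represented by trees. -/
class Enc (α : Type) where
  enc : α → Tree

/-- The code of a value in a register. -/
def code {α : Type} [Enc α] (a : α) : List Bool := (Enc.enc a).code

/-- The length of the code of a value. -/
def size {α : Type} [Enc α] (a : α) : ℕ := (code a).length

instance : Enc Unit := ⟨fun _ => .leaf⟩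

/-- In this code and in those of lists and options the trivial value (`false`, `[]`, `none`) is a
leaf, so a single case distinction on the root, `PolyTime.branch`, serves all three types. -/
instance : Enc Bool := ⟨fun b => bif b then .node .leaf .leaf else .leaf⟩

section

variable {α β : Type} [Enc α] [Enc β]

instance : Enc (α × β) := ⟨fun x => .node (Enc.enc x.1) (Enc.enc x.2)⟩

/-- A list `a :: l` has the same code as the pair `(a, l)`, so building a list or taking it apart
costs nothing beyond the operations on pairs. -/
def encList : List α → Tree
  | [] => .leaf
  | a :: l => .node (Enc.enc a) (encList l)

instance : Enc (List α) := ⟨encList⟩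

def encOption : Option α → Tree
  | none => .leaf
  | some a => .node (Enc.enc a) .leaf

instance : Enc (Option α) := ⟨encOption⟩

theorem code_pair (a : α) (b : β) : code (a, b) = true :: (code a ++ code b) := rfl

theorem code_nil : code ([] : List α) = [false] := rfl

theorem code_cons (a : α) (l : List α) : code (a :: l) = true :: (code a ++ code l) := rfl

theorem code_false : code false = [false] := rfl

theorem code_true : code true = [true, false, false] := rfl

theorem code_none : code (none : Option α) = [false] := rfl

theorem code_some (a : α) : code (some a) = true :: (code a ++ [false]) := rfl

theorem size_pair (a : α) (b : β) : size (a, b) = size a + size b + 1 := by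
  simp [size, code_pair]

theorem size_nil : size ([] : List α) = 1 := rfl

theorem size_cons (a : α) (l : List α) : size (a :: l) = size a + size l + 1 := by
  simp [size, code_cons]

theorem size_none : size (none : Option α) = 1 := rfl

theorem size_some (a : α) : size (some a) = size a + 2 := by
  simp [size, code_some]

theorem size_bool_le (b : Bool) : size b ≤ 3 := by cases b <;> simp [size, code_false, code_true]

theorem size_pos (a : α) : 0 < size a := by
  unfold size code
  cases Enc.enc a <;> simp [Tree.code]

theorem size_append (l l' : List α) : size (l ++ l') + 1 = size l + size l' := by
  induction l with
  | nil => simp [size_nil]; omega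
  | cons a l ih => simp only [List.cons_append, size_cons]; omega

theorem size_reverse (l : List α) : size l.reverse = size l := by
  induction l with
  | nil => rfl
  | cons a l ih =>
    have := size_append l.reverse [a]
    simp only [List.reverse_cons, size_cons, size_nil] at *
    omega

theorem length_lt_size (l : List α) : l.length < size l := by
  induction l with
  | nil => simp [size_nil]
  | cons a l ih =>
    simp only [List.length_cons, size_cons]; omega

theorem size_mem_le {a : α} {l : List α} (h : a ∈ l) : size a ≤ size l := by
  induction l with
  | nil => simp at h
  | cons b l ih =>
    rw [size_cons]
    rcases List.mem_cons.mp h with rfl | h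
    · omega
    · have := ih h; omega

theorem size_le_of_forall {B : ℕ} {l : List α} (h : ∀ a ∈ l, size a ≤ B) :
    size l ≤ l.length * (B + 1) + 1 := by
  induction l with
  | nil => simp [size_nil]
  | cons b l ih =>
    have h1 := h b (by simp)
    have h2 := ih fun a ha => h a (by simp [ha])
    rw [size_cons, List.length_cons, Nat.add_mul]
    omega

end

/-! ### Polynomial time -/

/-- The registers `1, …, k - 1` are empty. -/
def Clean (k : ℕ) (s : Regs) : Prop := ∀ i, 0 < i → i < k → s i = []

theorem Clean.mono {k k' : ℕ} {s : Regs} (h : Clean k' s) (hk : k ≤ k') : Clean k s :=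
  fun i hi hik => h i hi (hik.trans_le hk)

theorem Clean.update_eq {s : Regs} (h : Clean 4 s) (x : List Bool) :
    Function.update s 0 x = regs x [] [] [] fun i => s (i + 4) := by
  rw [eq_regs s, update_regs_zero]
  simp [h 1, h 2, h 3]
  rfl

theorem runs_push_zero {O : Oracle} {s : Regs} {x : List Bool} {b : Bool} :
    RunsIn O (.push 0 b) (Function.update s 0 x) (Function.update s 0 (b :: x)) 1 := by
  simpa using RunsIn.push (O := O) (r := 0) (b := b) (s := Function.update s 0 x)

theorem runs_pop_zero {O : Oracle} {s : Regs} {x : List Bool} {b : Bool} :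
    RunsIn O (.pop 0) (Function.update s 0 (b :: x)) (Function.update s 0 x) 1 := by
  simpa using RunsIn.pop (O := O) (r := 0) (s := Function.update s 0 (b :: x))

theorem runs_cases_zero_false {O : Oracle} {P Q R : Prog} {s s' : Regs} {x : List Bool} {T : ℕ}
    (h : RunsIn O Q (Function.update s 0 (false :: x)) s' T) :
    RunsIn O (.cases 0 P Q R) (Function.update s 0 (false :: x)) s' (T + 1) :=
  .cases_false (by rw [Function.update_self]) h

theorem runs_cases_zero_true {O : Oracle} {P Q R : Prog} {s s' : Regs} {x : List Bool} {T : ℕ}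
    (h : RunsIn O R (Function.update s 0 (true :: x)) s' T) :
    RunsIn O (.cases 0 P Q R) (Function.update s 0 (true :: x)) s' (T + 1) :=
  .cases_true (by rw [Function.update_self]) h

/-- The program `P` with scratch registers `1, …, k - 1` replaces a value `a` at the top of
register `0` by `f O a`, in time `g (size a)`. -/
def Computes {α β : Type} [Enc α] [Enc β] (P : Prog) (k : ℕ) (g : ℕ → ℕ)
    (f : Oracle → α → β) : Prop :=
  ∀ O a, size (f O a) ≤ g (size a) ∧ ∀ x s, Clean k s →
    RunsIn O P (Function.update s 0 (code a ++ x)) (Function.update s 0 (code (f O a) ++ x))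
      (g (size a))

/-- Functions that are computed in polynomial time with an oracle. -/
def OraclePolyTime {α β : Type} [Enc α] [Enc β] (f : Oracle → α → β) : Prop :=
  ∃ P k g, 4 ≤ k ∧ PolyBounded g ∧ Computes P k g f

/-- Functions that are computed in polynomial time. -/
def PolyTime {α β : Type} [Enc α] [Enc β] (f : α → β) : Prop :=
  OraclePolyTime fun _ => f

section

variable {α β γ δ σ : Type} [Enc α] [Enc β] [Enc γ] [Enc δ] [Enc σ]

theorem OraclePolyTime.comp {f : Oracle → β → γ} {f' : Oracle → α → β} (hf : OraclePolyTime f)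
    (hf' : OraclePolyTime f') : OraclePolyTime fun O a => f O (f' O a) := by
  obtain ⟨P, k, g, hk, hg, h⟩ := hf
  obtain ⟨P', k', g', hk', hg', h'⟩ := hf'
  refine ⟨.seq P' P, max k k', fun n => g' n + g (g' n) + 1, by omega,
    (hg'.add (hg.comp hg')).add (.const 1), fun O a => ?_⟩
  have h1 := (h O (f' O a)).1.trans (hg.1 (h' O a).1)
  beta_reduce
  refine ⟨by omega, fun x s hs => ?_⟩
  have h2 := RunsIn.seq ((h' O a).2 x s (hs.mono (by omega)))
    ((h O (f' O a)).2 x s (hs.mono (by omega)))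
  have h3 := hg.1 (h' O a).1
  exact h2.mono (by omega)

/-- The argument is duplicated, one copy is replaced by `f O a`, the two trees are exchanged, the
other copy is replaced by `f' O a`, and they are exchanged back. Pushing `true` turns two adjacent
codes into the code of the pair. -/
theorem OraclePolyTime.pair {f : Oracle → α → β} {f' : Oracle → α → γ} (hf : OraclePolyTime f)
    (hf' : OraclePolyTime f') : OraclePolyTime fun O a => (f O a, f' O a) := by
  obtain ⟨P, k, g, hk, hg, h⟩ := hf
  obtain ⟨P', k', g', hk', hg', h'⟩ := hf'
  refine ⟨.seq dupTree (.seq P (.seq swapTrees (.seq P' (.seq swapTrees (.push 0 true))))),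
    max k k', fun n => 36 * n + 30 * g n + 30 * g' n + 60, by omega,
    ((((PolyBounded.const 36).mul .id).add ((PolyBounded.const 30).mul hg)).add
      ((PolyBounded.const 30).mul hg')).add (.const 60), fun O a => ?_⟩
  have e1 := (h O a).1
  have e2 := (h' O a).1
  beta_reduce at e1 e2 ⊢
  refine ⟨by rw [size_pair]; omega, fun x s hs => ?_⟩
  have hs4 : Clean 4 s := hs.mono (by omega)
  have h1 := dupTree_runs (O := O) (Enc.enc a) x fun i => s (i + 4)
  have h3 := swapTrees_runs (O := O) (Enc.enc (f O a)) (Enc.enc a) x fun i => s (i + 4)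
  have h5 := swapTrees_runs (O := O) (Enc.enc (f' O a)) (Enc.enc (f O a)) x fun i => s (i + 4)
  rw [← hs4.update_eq, ← hs4.update_eq] at h1 h3 h5
  have h2 := (h O a).2 (code a ++ x) s (hs.mono (by omega))
  have h4 := (h' O a).2 (code (f O a) ++ x) s (hs.mono (by omega))
  have h6 := h1.seq (h2.seq (h3.seq (h4.seq (h5.seq (runs_push_zero (b := true))))))
  have e : code (f O a, f' O a) ++ x = true :: ((Enc.enc (f O a)).code ++ ((Enc.enc (f' O a)).code ++ x)) := by
    simp [code, Enc.enc, Tree.code]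
  rw [e]
  refine h6.mono ?_
  change 24 * size a + 9 + (_ + (12 * (size (f O a) + size a) + 12 +
    (_ + (12 * (size (f' O a) + size (f O a)) + 12 + 1 + 1) + 1) + 1) + 1) + 1 ≤ _
  omega

namespace PolyTime

theorem comp {f : β → γ} {f' : α → β} (hf : PolyTime f) (hf' : PolyTime f') :
    PolyTime fun a => f (f' a) :=
  OraclePolyTime.comp hf hf'

/-- A function may be replaced by one with the same code. -/
theorem of_code_eq {f : α → β} {f' : α → γ} (hf : PolyTime f) (h : ∀ a, code (f' a) = code (f a)) :
    PolyTime f' := by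
  obtain ⟨P, k, g, hk, hg, H⟩ := hf
  refine ⟨P, k, g, hk, hg, fun O a => ?_⟩
  have := H O a
  simpa only [size, h] using this

theorem id : PolyTime fun a : α => a :=
  ⟨.skip, 4, fun n => n + 1, le_rfl, PolyBounded.id.add (.const 1), fun _ _ =>
    ⟨Nat.le_succ _, fun _ _ _ => RunsIn.skip.mono (Nat.le_add_left _ _)⟩⟩

theorem const (b : β) : PolyTime fun _ : α => b := by
  refine ⟨.seq dropTree (pushWord (code b)), 4, fun n => 9 * n + (2 * size b + 7), le_rfl,
    ((PolyBounded.const 9).mul .id).add (.const _), fun O a => ⟨by beta_reduce; omega, fun x s hs => ?_⟩⟩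
  beta_reduce
  have h1 := dropTree_runs (O := O) (Enc.enc a) x fun i => s (i + 4)
  rw [← hs.update_eq, ← hs.update_eq] at h1
  have h2 := h1.seq (pushWord_runs (code b) _)
  simp only [Function.update_self, Function.update_idem] at h2
  refine h2.mono ?_
  change 9 * size a + 5 + (2 * size b + 1) + 1 ≤ _
  omega

theorem pair {f : α → β} {f' : α → γ} (hf : PolyTime f) (hf' : PolyTime f') :
    PolyTime fun a => (f a, f' a) :=
  OraclePolyTime.pair hf hf'

theorem fst : PolyTime fun a : α × β => a.1 := by
  refine ⟨.seq (.pop 0) (.seq swapTrees dropTree), 4, fun n => 21 * n + 30, le_rfl,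
    ((PolyBounded.const 21).mul .id).add (.const _), fun O a => ?_⟩
  obtain ⟨a, b⟩ := a
  beta_reduce
  refine ⟨by rw [size_pair]; dsimp only; omega, fun x s hs => ?_⟩
  have h3 := swapTrees_runs (O := O) (Enc.enc a) (Enc.enc b) x fun i => s (i + 4)
  have h4 := dropTree_runs (O := O) (Enc.enc b) ((Enc.enc a).code ++ x) fun i => s (i + 4)
  rw [← hs.update_eq, ← hs.update_eq] at h3 h4
  have h6 := RunsIn.seq (runs_pop_zero (b := true)) (h3.seq h4)
  have e : code (a, b) ++ x = true :: ((Enc.enc a).code ++ ((Enc.enc b).code ++ x)) := by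
    simp [code, Enc.enc, Tree.code]
  rw [e, size_pair]
  refine h6.mono ?_
  change 1 + (12 * (size a + size b) + 12 + (9 * size b + 5) + 1) + 1 ≤ _
  omega

theorem snd : PolyTime fun a : α × β => a.2 := by
  refine ⟨.seq (.pop 0) dropTree, 4, fun n => 21 * n + 30, le_rfl,
    ((PolyBounded.const 21).mul .id).add (.const _), fun O a => ?_⟩
  obtain ⟨a, b⟩ := a
  beta_reduce
  refine ⟨by rw [size_pair]; dsimp only; omega, fun x s hs => ?_⟩
  have h4 := dropTree_runs (O := O) (Enc.enc a) ((Enc.enc b).code ++ x) fun i => s (i + 4)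
  rw [← hs.update_eq, ← hs.update_eq] at h4
  have h6 := RunsIn.seq (runs_pop_zero (b := true)) h4
  have e : code (a, b) ++ x = true :: ((Enc.enc a).code ++ ((Enc.enc b).code ++ x)) := by
    simp [code, Enc.enc, Tree.code]
  rw [e, size_pair]
  refine h6.mono ?_
  change 1 + (9 * size a + 5) + 1 ≤ _
  omega

/-- Case distinction on the root of the first component. -/
theorem branch {f : α → δ} {f₀ : β → δ} {f₁ : γ → δ} (h₀ : PolyTime f₀) (h₁ : PolyTime f₁)
    (H : ∀ a, (∃ b, code a = true :: false :: code b ∧ f a = f₀ b) ∨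
      ∃ c l, code a = true :: true :: l ∧ code a = code c ∧ f a = f₁ c) : PolyTime f := by
  obtain ⟨P, k, g, hk, hg, h⟩ := h₀
  obtain ⟨P', k', g', hk', hg', h'⟩ := h₁
  -- The first bit belongs to the outer pair, the second is the root of the first component. A leaf
  -- is removed together with the outer bit, which leaves the code of `b`; otherwise the outer bit
  -- is put back, since the code of `a` is also the code of `c`.
  refine ⟨.seq (.pop 0) (.cases 0 .skip (.seq (.pop 0) P) (.seq (.push 0 true) P')), max k k',
    fun n => g n + g' n + 5, by omega, (hg.add hg').add (.const 5), fun O a => ?_⟩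
  rcases H a with ⟨b, hb, e⟩ | ⟨c, l, hl, hc, e⟩
  · have h1 := hg.1 (show size b ≤ size a by simp [size, hb]; omega)
    have h2 := h O b
    beta_reduce at h2 ⊢
    rw [← e] at h2
    refine ⟨by omega, fun x s hs => ?_⟩
    have h3 := RunsIn.seq (runs_pop_zero (O := O) (b := true)) (runs_cases_zero_false
      (P := .skip) (R := .seq (.push 0 true) P')
      (RunsIn.seq (runs_pop_zero (b := false)) (h2.2 x s (hs.mono (by omega)))))
    rw [hb]
    dsimp only [List.cons_append]
    exact h3.mono (by omega)
  · have h2 := h' O c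
    beta_reduce at h2 ⊢
    rw [← e, show size c = size a by simp [size, hc]] at h2
    refine ⟨by omega, fun x s hs => ?_⟩
    have h4 := h2.2 x s (hs.mono (by omega))
    rw [← hc, hl] at h4
    have h3 := RunsIn.seq (runs_pop_zero (O := O) (b := true)) (runs_cases_zero_true
      (P := .skip) (Q := .seq (.pop 0) P)
      (RunsIn.seq (runs_push_zero (b := true)) h4))
    rw [hl]
    exact h3.mono (by omega)

/-- Iteration over a list, if the intermediate values have polynomial size. -/
theorem foldl_of_bound {l : α → List β} {init : α → σ} {f : α × β × σ → σ} (hl : PolyTime l)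
    (hinit : PolyTime init) (hf : PolyTime f)
    (hb : ∃ g, PolyBounded g ∧ ∀ a l₁, l₁ <+: l a →
      size (l₁.foldl (fun c b => f (a, b, c)) (init a)) ≤ g (size a)) :
    PolyTime fun a => (l a).foldl (fun c b => f (a, b, c)) (init a) := by
  have hp : PolyTime fun a => (l a, a, init a) := hl.pair (PolyTime.id.pair hinit)
  have hbody : PolyTime fun x : (β × List β) × α × σ =>
      (x.1.2, x.2.1, f (x.2.1, x.1.1, x.2.2)) :=
    (snd.comp fst).pair ((fst.comp snd).pair (hf.comp
      ((fst.comp snd).pair ((fst.comp fst).pair (snd.comp snd)))))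
  have hlast : PolyTime fun x : List β × α × σ => x.2.2 := snd.comp snd
  obtain ⟨P₁, k₁, g₁, hk₁, hg₁, h₁⟩ := hp
  obtain ⟨P₂, k₂, g₂, hk₂, hg₂, h₂⟩ := hbody
  obtain ⟨P₃, k₃, g₃, hk₃, hg₃, h₃⟩ := hlast
  obtain ⟨g, hg, hb⟩ := hb
  -- Register `k` lies outside the scratch space of the three programs and holds the flag that keeps
  -- the loop going.
  set k := max k₁ (max k₂ k₃) with hk
  -- `B` bounds the size of every triple (rest of the list, parameter, accumulated value) that
  -- occurs in the loop.
  set B : ℕ → ℕ := fun n => g₁ n + n + g n + 2 with hB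
  have hPB : PolyBounded B := ((hg₁.add .id).add hg).add (.const 2)
  set body : Prog := .seq (.pop 0) (.cases 0 .skip (.seq (.push 0 true) (.pop k))
    (.seq (.push 0 true) P₂)) with hbd
  refine ⟨.seq P₁ (.seq (.push k true) (.seq (.loop k body) P₃)), k + 1,
    fun n => g₁ n + (g₁ n * (g₂ (B n) + 10) + 20) + g₃ (B n) + B n, by omega,
    ((hg₁.add ((hg₁.mul ((hg₂.comp hPB).add (.const 10))).add (.const 20))).add
      (hg₃.comp hPB)).add hPB, fun O a => ?_⟩
  refine ⟨?_, fun x s hs => ?_⟩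
  · have := hb a _ (List.prefix_refl _)
    simp only [hB]; omega
  have hk0 : k ≠ 0 := by omega
  have hsize := (h₁ O a).1
  simp only [size_pair] at hsize
  -- Loop invariant: `l₁` has been consumed, `l₂` is still to come, and the last pass removes the
  -- flag.
  have key : ∀ (l₂ l₁ : List β), l₁ ++ l₂ = l a →
      RunsIn O (.loop k body)
        (Function.update (Function.update s k [true]) 0
          (code (l₂, a, l₁.foldl (fun c b => f (a, b, c)) (init a)) ++ x))
        (Function.update s 0
          (code (([] : List β), a, (l a).foldl (fun c b => f (a, b, c)) (init a)) ++ x))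
        (l₂.length * (g₂ (B (size a)) + 10) + 10) := by
    intro l₂
    induction l₂ with
    | nil =>
      intro l₁ e
      rw [List.append_nil] at e
      subst e
      rw [code_pair, code_nil]
      have h3 := RunsIn.seq (runs_pop_zero (O := O) (s := Function.update s k [true]) (b := true))
        (runs_cases_zero_false (P := .skip) (R := .seq (.push 0 true) P₂)
          (x := code (a, (l a).foldl (fun c b => f (a, b, c)) (init a)) ++ x)
          (RunsIn.seq (runs_push_zero (b := true)) (RunsIn.pop (r := k))))
      have e3 : ∀ y, Function.update (Function.update (Function.update s k [true]) 0 y) k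
          (Function.update (Function.update s k [true]) 0 y k).tail = Function.update s 0 y := by
        intro y
        rw [Function.update_of_ne hk0, Function.update_self, List.tail_cons,
          Function.update_comm hk0, Function.update_idem,
          Function.update_comm hk0.symm, ← hs k (by omega) (by omega), Function.update_eq_self]
      rw [e3] at h3
      refine (RunsIn.loop_cons (r := k) (b := true) (l := []) (by simp [hk0]) h3
        (RunsIn.loop_nil (by simp [hk0, hs k (by omega) (by omega)]))).mono (by omega)
    | cons b l₂ ih =>
      intro l₁ e
      have ih' := ih (l₁ ++ [b]) (by simpa using e)
      set c := l₁.foldl (fun c b => f (a, b, c)) (init a) with hc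
      have h5 := h₂ O ((b, l₂), a, c)
      have h6 := h5.2 x (Function.update s k [true]) (by
        intro i hi hik
        rw [Function.update_of_ne (by omega)]
        exact hs i hi (by omega))
      -- The body expects a pair of head and tail; a nonempty list is one already, since the codes
      -- agree.
      have e1 : code (((b, l₂), a, c) : (β × List β) × α × σ) = code ((b :: l₂), a, c) := rfl
      have e2 : code ((b :: l₂), a, c) = true :: true :: (code b ++ code l₂ ++ code (a, c)) := rfl
      rw [e1, e2] at h6
      have h3 := RunsIn.seq (runs_pop_zero (O := O) (s := Function.update s k [true]) (b := true))
        (runs_cases_zero_true (P := .skip) (Q := .seq (.push 0 true) (.pop k))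
          (RunsIn.seq (runs_push_zero (b := true)) h6))
      rw [List.foldl_append, ← hc] at ih'
      have h7 := RunsIn.loop_cons (r := k) (b := true) (l := []) (by simp [hk0]) h3 ih'
      rw [e2]
      refine h7.mono ?_
      have h8 : size (((b, l₂), a, c) : (β × List β) × α × σ) ≤ B (size a) := by
        have i1 : size c ≤ g (size a) := hb a l₁ ⟨_, e⟩
        have i2 := size_append l₁ (b :: l₂)
        have i3 := size_pos l₁
        rw [e, size_cons] at i2
        simp only [size_pair, hB]
        have i4 := hg₁.1
        omega
      have h9 := hg₂.1 h8
      rw [List.length_cons, Nat.add_mul]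
      omega
  have h1 := (h₁ O a).2 x s (hs.mono (by omega))
  have h2 := RunsIn.push (O := O) (r := k) (b := true)
    (s := Function.update s 0 (code (l a, a, init a) ++ x))
  rw [Function.update_of_ne hk0, hs k (by omega) (by omega), Function.update_comm hk0.symm] at h2
  have h3 := h₃ O (([] : List β), a, (l a).foldl (fun c b => f (a, b, c)) (init a))
  have h4 := h3.2 x s (hs.mono (by omega))
  refine ((h1.seq (h2.seq ((key (l a) [] rfl).seq h4))).mono ?_)
  have h5 := hb a _ (List.prefix_refl _)
  have h6 : g₃ (size (([] : List β), a, (l a).foldl (fun c b => f (a, b, c)) (init a))) ≤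
      g₃ (B (size a)) := by
    apply hg₃.1
    simp only [size_pair, size_nil, hB]
    omega
  have h7 : (l a).length ≤ g₁ (size a) := by
    have := length_lt_size (l a)
    omega
  have h8 := Nat.mul_le_mul_right (g₂ (B (size a)) + 10) h7
  beta_reduce at *
  omega

end PolyTime

end

end GK

namespace GK

/-! ### Closure of polynomial time under operations on booleans, options and lists -/

section

variable {α β γ δ σ : Type} [Enc α] [Enc β] [Enc γ] [Enc δ] [Enc σ]

namespace PolyTime

theorem size_bound {f : α → β} (hf : PolyTime f) :
    ∃ g, PolyBounded g ∧ ∀ a, size (f a) ≤ g (size a) := by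
  obtain ⟨P, k, g, -, hg, h⟩ := hf
  exact ⟨g, hg, fun a => (h (fun _ => none) a).1⟩

theorem of_bool {b : α → Bool} {f : Bool → α → β} (hb : PolyTime b) (hf : ∀ c, PolyTime (f c)) :
    PolyTime fun a => f (b a) a := by
  have h : PolyTime fun x : Bool × α => f x.1 x.2 := by
    refine branch (hf false) ((hf true).comp (snd (α := Unit × Unit))) fun a => ?_
    obtain ⟨c, a⟩ := a
    cases c
    · exact .inl ⟨a, rfl, rfl⟩
    -- `true` has the code of the pair `((), ())`.
    · exact .inr ⟨(((), ()), a), _, rfl, rfl, rfl⟩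
  exact h.comp (hb.pair id)

theorem cond {b : α → Bool} {f f' : α → β} (hb : PolyTime b) (hf : PolyTime f)
    (hf' : PolyTime f') : PolyTime fun a => bif b a then f a else f' a :=
  of_bool (f := fun c a => bif c then f a else f' a) hb (by rintro (_ | _); exacts [hf', hf])

/-- Fixing one bit at a time reduces any function of finitely many bits to constants. Tables such as
`letterPhase` are covered in this way without a look at their entries. -/
theorem bool_fun (f : Bool → β) : PolyTime f :=
  of_bool (f := fun c _ => f c) id fun c => const (f c)

theorem bool_fun₂ (f : Bool → Bool → β) : PolyTime fun x : Bool × Bool => f x.1 x.2 :=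
  of_bool (f := fun c (x : Bool × Bool) => f c x.2) fst fun c => (bool_fun (f c)).comp snd

theorem bool_fun₄ (f : Bool × Bool → Bool × Bool → β) :
    PolyTime fun x : (Bool × Bool) × Bool × Bool => f x.1 x.2 :=
  of_bool (f := fun c x => f (c, x.1.2) x.2) (fst.comp fst) fun c =>
    of_bool (f := fun d x => f (c, d) x.2) (snd.comp fst) fun d =>
      (bool_fun₂ fun e e' => f (c, d) (e, e')).comp snd

/-- The function `f` is characterized by two equations instead of a `match`, so the lemma applies to
every definition that satisfies them. -/
theorem list_cases {l : α → List β} {f : α → γ} {f₀ : α → γ} {f₁ : α × β × List β → γ}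
    (hl : PolyTime l) (h₀ : PolyTime f₀) (h₁ : PolyTime f₁) (H₀ : ∀ a, l a = [] → f a = f₀ a)
    (H₁ : ∀ a b t, l a = b :: t → f a = f₁ (a, b, t)) : PolyTime f := by
  have h : PolyTime fun x : List β × α =>
      (match x.1 with
        | [] => f₀ x.2
        | b :: t => f₁ (x.2, b, t) : γ) := by
    refine branch h₀ (h₁.comp (snd.pair fst)) fun a => ?_
    obtain ⟨_ | ⟨b, t⟩, a⟩ := a
    · exact .inl ⟨a, rfl, rfl⟩
    · exact .inr ⟨((b, t), a), _, rfl, rfl, rfl⟩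
  have h' := h.comp (hl.pair id)
  refine h'.of_code_eq fun a => ?_
  dsimp only
  cases e : l a with
  | nil => rw [H₀ a e]
  | cons b t => rw [H₁ a b t e]

theorem option_cases {o : α → Option β} {f : α → γ} {f₀ : α → γ} {f₁ : α × β → γ}
    (ho : PolyTime o) (h₀ : PolyTime f₀) (h₁ : PolyTime f₁) (H₀ : ∀ a, o a = none → f a = f₀ a)
    (H₁ : ∀ a b, o a = some b → f a = f₁ (a, b)) : PolyTime f := by
  have h : PolyTime fun x : Option β × α =>
      (match x.1 with
        | none => f₀ x.2
        | .some b => f₁ (x.2, b) : γ) := by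
    refine branch h₀ (h₁.comp (snd.pair ((fst (β := Unit)).comp fst))) fun a => ?_
    obtain ⟨_ | b, a⟩ := a
    · exact .inl ⟨a, rfl, rfl⟩
    · exact .inr ⟨((b, ()), a), _, rfl, rfl, rfl⟩
  have h' := h.comp (ho.pair id)
  refine h'.of_code_eq fun a => ?_
  dsimp only
  cases e : o a with
  | none => rw [H₀ a e]
  | some b => rw [H₁ a b e]

theorem cons {f : α → β} {f' : α → List β} (hf : PolyTime f) (hf' : PolyTime f') :
    PolyTime fun a => f a :: f' a :=
  (hf.pair hf').of_code_eq fun _ => rfl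

theorem some {f : α → β} (hf : PolyTime f) : PolyTime fun a => some (f a) :=
  (hf.pair (const ())).of_code_eq fun _ => rfl

theorem tail {l : α → List β} (hl : PolyTime l) : PolyTime fun a => (l a).tail :=
  list_cases hl (const []) (snd.comp snd) (fun a h => by simp [h]) fun a b t h => by simp [h]

theorem headD {l : α → List β} (hl : PolyTime l) (b : β) : PolyTime fun a => (l a).headD b :=
  list_cases hl (const b) (fst.comp snd) (fun a h => by simp [h]) fun a b t h => by simp [h]

/-- Iteration over a list, if each step makes the value grow by a polynomial amount. -/
theorem foldl_of_growth {l : α → List β} {init : α → σ} {f : α × β × σ → σ} (hl : PolyTime l)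
    (hinit : PolyTime init) (hf : PolyTime f)
    (hb : ∃ g, PolyBounded g ∧ ∀ a b c, size (f (a, b, c)) ≤ size c + g (size a + size b)) :
    PolyTime fun a => (l a).foldl (fun c b => f (a, b, c)) (init a) := by
  obtain ⟨g, hg, hb⟩ := hb
  obtain ⟨g₁, hg₁, h₁⟩ := hl.size_bound
  obtain ⟨g₂, hg₂, h₂⟩ := hinit.size_bound
  refine foldl_of_bound hl hinit hf ⟨fun n => g₂ n + g₁ n * g (n + g₁ n),
    hg₂.add (hg₁.mul (hg.comp (PolyBounded.id.add hg₁))), fun a l₁ hl₁ => ?_⟩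
  -- The growth per step does not depend on the accumulated value, so the increments add up to at
  -- most the length of the list times a fixed polynomial; a growth depending on the size of `c`
  -- could double it in every step.
  have key : ∀ (l₂ : List β) c, l₂ ⊆ l a → size (l₂.foldl (fun c b => f (a, b, c)) c) ≤
      size c + l₂.length * g (size a + g₁ (size a)) := by
    intro l₂
    induction l₂ with
    | nil => simp
    | cons b l₂ ih =>
      intro c hsub
      have e1 := ih (f (a, b, c)) fun x hx => hsub (by simp [hx])
      have e2 := hb a b c
      have e3 : g (size a + size b) ≤ g (size a + g₁ (size a)) :=
        hg.1 (Nat.add_le_add_left ((size_mem_le (hsub (by simp))).trans (h₁ a)) _)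
      rw [List.foldl_cons, List.length_cons, Nat.add_mul]
      omega
  refine (key l₁ _ hl₁.subset).trans (Nat.add_le_add (h₂ a) (Nat.mul_le_mul_right _ ?_))
  exact hl₁.length_le.trans ((length_lt_size _).le.trans (h₁ a))

theorem reverse {l : α → List β} (hl : PolyTime l) : PolyTime fun a => (l a).reverse := by
  have h := foldl_of_growth (f := fun x : α × β × List β => x.2.1 :: x.2.2) hl (const [])
    ((fst.comp snd).cons (snd.comp snd)) ⟨fun n => n + 1, PolyBounded.id.add (.const 1),
      fun a b c => by simp only [size_cons]; omega⟩
  refine h.of_code_eq fun a => ?_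
  congr 1
  have : ∀ (l acc : List β), l.foldl (fun c b => b :: c) acc = l.reverse ++ acc := by
    intro l
    induction l with
    | nil => simp
    | cons b l ih => intro acc; simp [ih]
  simp [this]

theorem append {l l' : α → List β} (hl : PolyTime l) (hl' : PolyTime l') :
    PolyTime fun a => l a ++ l' a := by
  have h := foldl_of_growth (f := fun x : α × β × List β => x.2.1 :: x.2.2) hl.reverse hl'
    ((fst.comp snd).cons (snd.comp snd)) ⟨fun n => n + 1, PolyBounded.id.add (.const 1),
      fun a b c => by simp only [size_cons]; omega⟩
  refine h.of_code_eq fun a => ?_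
  congr 1
  simp

theorem map {l : α → List β} {f : α × β → γ} (hl : PolyTime l) (hf : PolyTime f) :
    PolyTime fun a => (l a).map fun b => f (a, b) := by
  obtain ⟨g, hg, hgf⟩ := hf.size_bound
  have h := foldl_of_growth (f := fun x : α × β × List γ => f (x.1, x.2.1) :: x.2.2)
    hl.reverse (const []) ((hf.comp (fst.pair (fst.comp snd))).cons (snd.comp snd))
    ⟨fun n => g (n + 1) + 1, (hg.comp (PolyBounded.id.add (.const 1))).add (.const 1),
      fun a b c => by
        have := hgf (a, b)
        rw [size_pair] at this
        rw [size_cons]; beta_reduce; dsimp only; rw [← Nat.add_assoc]; omega⟩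
  refine h.of_code_eq fun a => ?_
  congr 1
  simp

theorem size_tail_le (l : List β) : size l.tail ≤ size l := by
  cases l with
  | nil => exact le_rfl
  | cons b l => rw [size_cons, List.tail_cons]; omega

theorem drop {i : α → List δ} {l : α → List β} (hi : PolyTime i) (hl : PolyTime l) :
    PolyTime fun a => (l a).drop (i a).length := by
  have h := foldl_of_growth (f := fun x : α × δ × List β => x.2.2.tail) hi hl
    (snd.comp snd).tail ⟨fun _ => 0, .const 0, fun a b c => size_tail_le c⟩
  refine h.of_code_eq fun a => ?_
  congr 1
  generalize l a = l'
  generalize i a = i'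
  induction i' generalizing l' with
  | nil => rfl
  | cons b i' ih => simp [← ih]

/-- Move the head of the second list to the first list. -/
def shiftHead (x : List β × List β) : List β × List β :=
  match x.2 with
  | [] => x
  | b :: l => (b :: x.1, l)

theorem shiftHead_polyTime : PolyTime (shiftHead (β := β)) :=
  list_cases snd id (((fst.comp snd).cons (fst.comp fst)).pair (snd.comp snd))
    (fun a h => by simp [shiftHead, h]) fun a b t h => by simp [shiftHead, h]

theorem take {i : α → List δ} {l : α → List β} (hi : PolyTime i) (hl : PolyTime l) :
    PolyTime fun a => (l a).take (i a).length := by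
  have h := foldl_of_growth (f := fun x : α × δ × List β × List β => shiftHead x.2.2)
    hi ((const []).pair hl) (shiftHead_polyTime.comp (snd.comp snd))
    ⟨fun _ => 0, .const 0, fun a b c => by
      obtain ⟨l, _ | ⟨d, l'⟩⟩ := c
      · exact le_rfl
      · simp only [shiftHead, size_pair, size_cons]; omega⟩
  refine (fst.comp h).reverse.of_code_eq fun a => ?_
  congr 1
  have : ∀ (i : List δ) (l acc : List β), (i.foldl (fun c _ => shiftHead c) (acc, l)).1.reverse =
      acc.reverse ++ l.take i.length := by
    intro i
    induction i with
    | nil => simp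
    | cons b i ih =>
      intro l acc
      cases l with
      | nil => simpa [shiftHead] using ih [] acc
      | cons d l =>
        rw [List.foldl_cons, show shiftHead (acc, d :: l) = (d :: acc, l) from rfl, ih]
        simp
  simp [this]

/-- One step of the computation of `List.zip`. -/
def zipStep (b : β) (x : List γ × List (β × γ)) : List γ × List (β × γ) :=
  match x.1 with
  | [] => x
  | c :: l => (l, (b, c) :: x.2)

theorem zip {l : α → List β} {l' : α → List γ} (hl : PolyTime l) (hl' : PolyTime l') :
    PolyTime fun a => (l a).zip (l' a) := by
  have hstep : PolyTime fun x : α × β × List γ × List (β × γ) => zipStep x.2.1 x.2.2 :=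
    list_cases (fst.comp (snd.comp snd)) (snd.comp snd)
      ((snd.comp snd).pair ((((fst.comp snd).comp fst).pair (fst.comp snd)).cons
        (((snd.comp snd).comp snd).comp fst)))
      (fun a h => by simp [zipStep, h]) fun a b t h => by simp [zipStep, h]
  have h := foldl_of_growth hl (hl'.pair (const [])) hstep
    ⟨fun n => n + 3, PolyBounded.id.add (.const 3), fun a b c => by
      obtain ⟨_ | ⟨d, l⟩, l'⟩ := c
      · simp [zipStep]
      · simp only [zipStep, size_pair, size_cons]; omega⟩
  refine (snd.comp h).reverse.of_code_eq fun a => ?_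
  congr 1
  have : ∀ (l : List β) (l' : List γ) acc, (l.foldl (fun c b => zipStep b c) (l', acc)).2.reverse =
      acc.reverse ++ l.zip l' := by
    intro l
    induction l with
    | nil => simp
    | cons b l ih =>
      intro l' acc
      cases l' with
      | nil => simpa [zipStep] using ih [] acc
      | cons d l' =>
        rw [List.foldl_cons, show zipStep b (d :: l', acc) = (l', (b, d) :: acc) from rfl, ih]
        simp
  simp [this]

/-- Apply a function to the entry at a position that is given in unary. -/
theorem modify {i : α → List δ} {l : α → List β} {f : α × β → β} (hi : PolyTime i)
    (hl : PolyTime l) (hf : PolyTime f) :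
    PolyTime fun a => (l a).modify (i a).length fun b => f (a, b) := by
  have h : PolyTime fun a => ((l a).drop (i a).length).modifyHead fun b => f (a, b) :=
    list_cases (drop hi hl) (const [])
      ((hf.comp (fst.pair (fst.comp snd))).cons (snd.comp snd))
      (fun a h => by simp [h]) fun a b t h => by simp [h]
  refine ((take hi hl).append h).of_code_eq fun a => ?_
  congr 1
  rw [List.modify_eq_take_drop]

end PolyTime

end

end GK

namespace GK

/-! ### The tableau algorithm -/

/-- A Pauli product: the exponent of `i` in binary and the letters, where `(x, z)` stands for the
letter `I, X, Y, Z` that has an `X`-part if `x` and a `Z`-part if `z`. -/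
abbrev Row : Type := (Bool × Bool) × List (Bool × Bool)

/-- A list of the images of `X_j` and `Z_j`. -/
abbrev Table : Type := List (Row × Row)

/-- Addition modulo four. -/
def phaseAdd (a b : Bool × Bool) : Bool × Bool :=
  ((a.1 ^^ b.1) ^^ (a.2 && b.2), a.2 ^^ b.2)

/-- The exponent of `i` in the product of two letters. -/
def letterPhase (a b : Bool × Bool) : Bool × Bool :=
  match a, b with
  | (true, false), (true, true) => (false, true)
  | (true, true), (false, true) => (false, true)
  | (false, true), (true, false) => (false, true)
  | (true, true), (true, false) => (true, true)
  | (false, true), (true, true) => (true, true)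
  | (true, false), (false, true) => (true, true)
  | _, _ => (false, false)

def letterMul (a b : Bool × Bool) : Bool × Bool := (a.1 ^^ b.1, a.2 ^^ b.2)

def mulRow (x : Row × Row) : Row :=
  ((x.1.2.zip x.2.2).foldl (fun c b => phaseAdd c (letterPhase b.1 b.2)) (phaseAdd x.1.1 x.2.1),
    (x.1.2.zip x.2.2).map fun b => letterMul b.1 b.2)

/-- Multiplication by `i`. -/
def mulI (r : Row) : Row := (phaseAdd r.1 (false, true), r.2)

/-- Multiply `r` by the image of a letter. -/
def mulImage (l : Bool × Bool) (im : Row × Row) (r : Row) : Row :=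
  bif l.1 then bif l.2 then mulI (mulRow (mulRow (r, im.1), im.2)) else mulRow (r, im.1)
  else bif l.2 then mulRow (r, im.2) else r

/-- The image of a Pauli product under the operation with the given table. -/
def applyTable (x : Table × Row) : Row :=
  (x.2.2.zip x.1).foldl (fun c b => mulImage b.1 b.2 c)
    (x.2.1, x.2.2.map fun _ => (false, false))

def prependI (r : Row) : Row := (r.1, (false, false) :: r.2)

def unitRowsStep (b : (Bool × Bool) × Bool) (c : List (Bool × Bool) × List Row) :
    List (Bool × Bool) × List Row :=
  ((false, false) :: c.1, ((b.2, false), b.1 :: c.1) :: c.2.map prependI)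

/-- The Pauli products that consist of one of the given letters at its position, with the given
signs. The list starts with the letter for the last position. -/
def unitRows (l : List ((Bool × Bool) × Bool)) : List Row :=
  (l.foldl (fun c b => unitRowsStep b c) ([], [])).2

/-- The table of the identity. The length of the list is the number of qubits. -/
def identTable (N : List Bool) : Table :=
  (unitRows (N.map fun _ => ((true, false), false))).zip
    (unitRows (N.map fun _ => ((false, true), false)))

/-! Reading the input -/

/-- The state records whether the terminating `false` has been seen, the number in unary, and the
rest of the word in reversed order. -/
def readUnaryStep (b : Bool) (c : Bool × List Bool × List Bool) : Bool × List Bool × List Bool :=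
  bif c.1 then (true, c.2.1, b :: c.2.2) else bif b then (false, true :: c.2.1, c.2.2)
    else (true, c.2.1, c.2.2)

/-- Read a number in unary from the beginning of a word. -/
def readUnary (w : List Bool) : List Bool × List Bool :=
  ((w.foldl (fun c b => readUnaryStep b c) (false, [], [])).2.1,
    (w.foldl (fun c b => readUnaryStep b c) (false, [], [])).2.2.reverse)

def readPair (w : List Bool) : (Bool × Bool) × List Bool :=
  ((w.headD false, w.tail.headD false), w.tail.tail)

/-- The first list only serves as a counter, and the letters come out in reversed order. The same
holds for `readTable`. -/
def readLetters (x : List Bool × List Bool) : List (Bool × Bool) × List Bool :=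
  x.1.foldl (fun c _ => ((readPair c.2).1 :: c.1, (readPair c.2).2)) ([], x.2)

/-- Read a Pauli product on as many qubits as the first list has entries. -/
def readRow (x : List Bool × List Bool) : Row × List Bool :=
  (((readPair x.2).1, (readLetters (x.1, (readPair x.2).2)).1.reverse),
    (readLetters (x.1, (readPair x.2).2)).2)

def readTable (x : List Bool × List Bool) : Table × List Bool :=
  x.1.foldl (fun c _ => (((readRow (x.1, c.2)).1, (readRow (x.1, (readRow (x.1, c.2)).2)).1) :: c.1,
    (readRow (x.1, (readRow (x.1, c.2)).2)).2)) ([], x.2)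

def hadTable (N i : List Bool) : Table :=
  (identTable N).modify i.length fun r => (r.2, r.1)

/-- Conjugation by `S` sends `X` to `Y = iXZ` and fixes `Z`. -/
def phaseTable (N i : List Bool) : Table :=
  (identTable N).modify i.length fun r => (mulI (mulRow (r.1, r.2)), r.2)

/-- The entry of a table at a position that is given in unary. -/
def entryAt (x : Table × List Bool) : Row × Row :=
  (x.1.drop x.2.length).headD (((false, false), []), ((false, false), []))

/-- Conjugation by CNOT sends `X_c` to `X_c X_t` and `Z_t` to `Z_c Z_t`, and fixes all other
generators. -/
def cnotTable (N c t : List Bool) : Table :=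
  ((identTable N).modify c.length fun r => (mulRow (r.1, (entryAt (identTable N, t)).1), r.2)).modify
    t.length fun r => (r.1, mulRow ((entryAt (identTable N, c)).2, r.2))

/-- Read the description of a gate, with result a table. -/
def readGate (x : List Bool × List Bool) : Table × List Bool :=
  bif (readPair x.2).1.1 then
    bif (readPair x.2).1.2 then
      ((readTable (x.1, (readPair x.2).2)).1.reverse, (readTable (x.1, (readPair x.2).2)).2)
    else
      (cnotTable x.1 (readUnary (readPair x.2).2).1 (readUnary (readUnary (readPair x.2).2).2).1,
        (readUnary (readUnary (readPair x.2).2).2).2)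
  else
    (bif (readPair x.2).1.2 then phaseTable x.1 (readUnary (readPair x.2).2).1
      else hadTable x.1 (readUnary (readPair x.2).2).1, (readUnary (readPair x.2).2).2)

/-- Read and apply the next gate, if there is one. -/
def gateStep (N : List Bool) (c : List Bool × List Row) : List Bool × List Row :=
  bif c.1.headD false then
    ((readGate (N, c.1.tail)).2, c.2.map fun r => applyTable ((readGate (N, c.1.tail)).1, r))
  else c

/-- Apply all gates of a circuit. -/
def applyGates (x : List Bool × List Bool × List Row) : List Row :=
  (x.2.1.foldl (fun c _ => gateStep x.1 c) (x.2.1, x.2.2)).2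

/-! Gaussian elimination -/

def letterAt (x : List Bool × Row) : Bool × Bool := (x.2.2.drop x.1.length).headD (false, false)

def sweepStep (t : Bool → Bool → Bool) (j : List Bool) (r : Row) (c : Option Row × List Row) :
    Option Row × List Row :=
  bif t (letterAt (j, r)).1 (letterAt (j, r)).2 then
    match c.1 with
    | none => (some r, c.2)
    | some q => (some q, mulRow (q, r) :: c.2)
  else (c.1, r :: c.2)

/-- Take a row whose letter at the position `j` satisfies `t` as pivot, if there is one, and
multiply the other such rows by it. -/
def sweep (t : Bool → Bool → Bool) (x : List Bool × List Row) : Option Row × List Row :=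
  x.2.foldl (fun c r => sweepStep t x.1 r c) (none, [])

/-- The equation that a pivot row gives for the measurement result at position `j`. -/
def equation (x : List Bool × Option Row) : Option (Bool × List Bool) :=
  match x.2 with
  | none => none
  | some r => some (r.1.1, (r.2.drop x.1.length).tail.map fun l => l.2)

/-- The state consists of the current column in unary, the rows still in play, and the equations
found so far, the latest one first. The pivot leaves the rows; only its equation is kept. -/
def elimStep (t : Bool → Bool → Bool) (c : List Bool × List Row × List (Option (Bool × List Bool))) :
    List Bool × List Row × List (Option (Bool × List Bool)) :=
  (true :: c.1, (sweep t (c.1, c.2.1)).2, equation (c.1, (sweep t (c.1, c.2.1)).1) :: c.2.2)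

def eliminate (t : Bool → Bool → Bool) (x : List Bool × List Row) :
    List Bool × List Row × List (Option (Bool × List Bool)) :=
  x.1.foldl (fun c _ => elimStep t c) ([], x.2, [])

/-- The sum modulo two of `b` and of the products of corresponding entries. -/
def dotAdd (x : Bool × List Bool × List Bool) : Bool :=
  (x.2.1.zip x.2.2).foldl (fun c b => c ^^ (b.1 && b.2)) x.1

/-- The list `xs` holds the outcomes of the later qubits. A column without pivot is free and takes
the random bit; at a pivot the random bit is discarded. -/
def solveStep (b : Option (Bool × List Bool) × Bool) (xs : List Bool) : List Bool :=
  match b.1 with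
  | none => b.2 :: xs
  | some e => dotAdd (e.1, e.2, xs) :: xs

/-- Solve a triangular system of equations, with the given values of the free variables. -/
def solve (x : List (Option (Bool × List Bool)) × List Bool) : List Bool :=
  (x.1.zip x.2).foldl (fun c b => solveStep b c) []

/-- The measurement results, in reversed order, computed from the description of the circuit and,
for each qubit, starting from the last one, the Pauli operator that stabilizes the initial state,
its sign, and a random bit. -/
def simulate (x : List Bool × List (((Bool × Bool) × Bool) × Bool)) : List Bool :=
  (solve ((eliminate (fun _ z => z) ((readUnary x.1).1,
    (eliminate (fun x _ => x) ((readUnary x.1).1, applyGates ((readUnary x.1).1, (readUnary x.1).2,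
      unitRows (x.2.map fun b => b.1)))).2.1)).2.2, x.2.map fun b => b.2)).reverse

end GK

namespace GK

/-! ### The tableau algorithm takes polynomial time -/

theorem size_pair_bool_le (b : Bool × Bool) : size b ≤ 7 := by
  obtain ⟨b, c⟩ := b
  have := size_bool_le b
  have := size_bool_le c
  rw [size_pair]; omega

theorem size_letters_le (l : List (Bool × Bool)) : size l ≤ 8 * l.length + 1 := by
  have := size_le_of_forall (B := 7) (l := l) fun b _ => size_pair_bool_le b
  omega

theorem size_row_le (r : Row) : size r ≤ 8 * r.2.length + 9 := by
  obtain ⟨p, l⟩ := r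
  have := size_pair_bool_le p
  have := size_letters_le l
  rw [size_pair]; dsimp only; omega

theorem size_rows_le {M : ℕ} {l : List Row} (h : ∀ r ∈ l, r.2.length ≤ M) :
    size l ≤ l.length * (8 * M + 10) + 1 :=
  size_le_of_forall fun r hr => (size_row_le r).trans (by have := h r hr; omega)

theorem length_row_le (r : Row) : r.2.length ≤ size r := by
  obtain ⟨p, l⟩ := r
  have := length_lt_size l
  rw [size_pair]; dsimp only; omega

namespace PolyTime

variable {α : Type} [Enc α]

theorem phaseAdd : PolyTime fun x : (Bool × Bool) × Bool × Bool => phaseAdd x.1 x.2 :=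
  bool_fun₄ _

theorem letterPhase : PolyTime fun x : (Bool × Bool) × Bool × Bool => letterPhase x.1 x.2 :=
  bool_fun₄ _

theorem letterMul : PolyTime fun x : (Bool × Bool) × Bool × Bool => letterMul x.1 x.2 :=
  bool_fun₄ _

theorem zipLetters : PolyTime fun x : Row × Row => x.1.2.zip x.2.2 :=
  zip (snd.comp fst) (snd.comp snd)

attribute [local irreducible] GK.phaseAdd GK.letterPhase in
theorem mulRow_phase : PolyTime fun x : Row × Row => (x.1.2.zip x.2.2).foldl
    (fun c b => GK.phaseAdd c (GK.letterPhase b.1 b.2)) (GK.phaseAdd x.1.1 x.2.1) :=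
  foldl_of_growth
    (f := fun y : (Row × Row) × ((Bool × Bool) × Bool × Bool) × Bool × Bool =>
      GK.phaseAdd y.2.2 (GK.letterPhase y.2.1.1 y.2.1.2)) zipLetters
    (phaseAdd.comp ((fst.comp fst).pair (fst.comp snd)))
    (phaseAdd.comp ((snd.comp snd).pair (letterPhase.comp (fst.comp snd))))
    ⟨fun _ => 7, .const 7, fun _ _ _ => (size_pair_bool_le _).trans (Nat.le_add_left _ _)⟩

theorem mulRow : PolyTime mulRow :=
  mulRow_phase.pair (zipLetters.map (letterMul.comp snd))

theorem mulI : PolyTime mulI :=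
  ((phaseAdd).comp (fst.pair (const (false, true)))).pair snd

theorem mulImage : PolyTime fun x : ((Bool × Bool) × Row × Row) × Row =>
    mulImage x.1.1 x.1.2 x.2 := by
  have hx : PolyTime fun x : ((Bool × Bool) × Row × Row) × Row => GK.mulRow (x.2, x.1.2.1) :=
    mulRow.comp (snd.pair (fst.comp (snd.comp fst)))
  have hz : PolyTime fun x : ((Bool × Bool) × Row × Row) × Row => GK.mulRow (x.2, x.1.2.2) :=
    mulRow.comp (snd.pair (snd.comp (snd.comp fst)))
  exact cond (fst.comp (fst.comp fst))
    (cond (snd.comp (fst.comp fst))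
      (mulI.comp (mulRow.comp (hx.pair (snd.comp (snd.comp fst))))) hx)
    (cond (snd.comp (fst.comp fst)) hz snd)

end PolyTime

/-- Polynomial time is claimed on all inputs, including malformed ones, so sizes are controlled by
inequalities that need no well-formedness. Here `zip` truncates, so a product is never longer than a
factor. -/
theorem mulRow_length_le_right (r r' : Row) : (mulRow (r, r')).2.length ≤ r'.2.length := by
  simp [mulRow]

theorem mulImage_length_le (l : Bool × Bool) (im : Row × Row) (r : Row) :
    (mulImage l im r).2.length ≤ r.2.length := by
  obtain ⟨x, z⟩ := l
  cases x <;> cases z <;> simp [mulImage, mulI, mulRow]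

theorem foldl_mulImage_length_le (l : List ((Bool × Bool) × Row × Row)) (r : Row) :
    (l.foldl (fun c b => mulImage b.1 b.2 c) r).2.length ≤ r.2.length := by
  induction l generalizing r with
  | nil => exact le_rfl
  | cons b l ih => exact (ih _).trans (mulImage_length_le _ _ _)

theorem applyTable_length_le (x : Table × Row) : (applyTable x).2.length ≤ x.2.2.length :=
  (foldl_mulImage_length_le _ _).trans (by simp)

theorem foldl_unitRowsStep_lengths (l : List ((Bool × Bool) × Bool))
    (c : List (Bool × Bool) × List Row) (hc : ∀ r ∈ c.2, r.2.length = c.1.length) :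
    (l.foldl (fun c b => unitRowsStep b c) c).1.length = c.1.length + l.length ∧
    (l.foldl (fun c b => unitRowsStep b c) c).2.length = c.2.length + l.length ∧
    ∀ r ∈ (l.foldl (fun c b => unitRowsStep b c) c).2, r.2.length = c.1.length + l.length := by
  induction l generalizing c with
  | nil => simpa using hc
  | cons b l ih =>
    have := ih (unitRowsStep b c) (by
      intro r hr
      simp only [unitRowsStep, List.mem_cons, List.mem_map] at hr ⊢
      rcases hr with rfl | ⟨r, hr, rfl⟩
      · simp
      · simp [prependI, hc r hr])
    simp only [List.foldl_cons, List.length_cons]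
    simp only [unitRowsStep, List.length_cons, List.length_map] at this ⊢
    refine ⟨by omega, by omega, fun r hr => ?_⟩
    have := this.2.2 r hr
    omega

theorem length_unitRows (l : List ((Bool × Bool) × Bool)) : (unitRows l).length = l.length := by
  simpa [unitRows] using (foldl_unitRowsStep_lengths l ([], []) (by simp)).2.1

namespace PolyTime

variable {α : Type} [Enc α]

theorem applyTable : PolyTime applyTable := by
  refine foldl_of_bound (f := fun y : (Table × Row) × ((Bool × Bool) × Row × Row) × Row =>
      GK.mulImage y.2.1.1 y.2.1.2 y.2.2) (zip (snd.comp snd) fst)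
    ((fst.comp snd).pair ((snd.comp snd).map (const (false, false)))) (mulImage.comp snd)
    ⟨fun n => 8 * n + 9, ((PolyBounded.const 8).mul .id).add (.const 9), fun a l₁ _ => ?_⟩
  refine (size_row_le _).trans ?_
  have h1 := foldl_mulImage_length_le l₁ (a.2.1, a.2.2.map fun _ => (false, false))
  have h2 := length_row_le a.2
  have h3 : size a = size a.1 + size a.2 + 1 := size_pair _ _
  simp only [List.length_map] at h1
  beta_reduce
  dsimp only
  omega

theorem prependI : PolyTime prependI := fst.pair ((const (false, false)).cons snd)

theorem unitRowsStep : PolyTime fun x : ((Bool × Bool) × Bool) × List (Bool × Bool) × List Row =>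
    unitRowsStep x.1 x.2 :=
  ((const (false, false)).cons (fst.comp snd)).pair
    ((((snd.comp fst).pair (const false)).pair ((fst.comp fst).cons (fst.comp snd))).cons
      ((snd.comp snd).map (prependI.comp snd)))

theorem unitRows : PolyTime unitRows := by
  refine snd.comp (foldl_of_bound
    (f := fun y : List ((Bool × Bool) × Bool) × ((Bool × Bool) × Bool) ×
      List (Bool × Bool) × List Row => GK.unitRowsStep y.2.1 y.2.2)
    id (const ([], [])) (unitRowsStep.comp snd)
    ⟨fun n => 8 * n + n * (8 * n + 10) + 3, (((PolyBounded.const 8).mul .id).add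
      (PolyBounded.id.mul (((PolyBounded.const 8).mul .id).add (.const 10)))).add (.const 3),
      fun a l₁ h => ?_⟩)
  obtain ⟨h1, h2, h3⟩ := foldl_unitRowsStep_lengths l₁ ([], []) (by simp)
  simp only [List.length_nil, Nat.zero_add] at h1 h2 h3
  have h4 := size_rows_le fun r hr => (h3 r hr).le
  have h5 := size_letters_le (l₁.foldl (fun c b => GK.unitRowsStep b c) ([], [])).1
  have h6 : l₁.length ≤ size a := h.length_le.trans (length_lt_size _).le
  have h7 : size (l₁.foldl (fun c b => GK.unitRowsStep b c) ([], [])) = _ := size_pair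
    (l₁.foldl (fun c b => GK.unitRowsStep b c) ([], [])).1
    (l₁.foldl (fun c b => GK.unitRowsStep b c) ([], [])).2
  rw [h2] at h4
  rw [h1] at h5
  have h8 : l₁.length * (8 * l₁.length + 10) ≤ size a * (8 * size a + 10) := by gcongr
  beta_reduce
  dsimp only at *
  omega

theorem identTable : PolyTime identTable :=
  zip (unitRows.comp (id.map (const _))) (unitRows.comp (id.map (const _)))

theorem readUnaryStep : PolyTime fun x : Bool × Bool × List Bool × List Bool =>
    readUnaryStep x.1 x.2 := by
  have h1 : PolyTime fun x : Bool × Bool × List Bool × List Bool => x.2.2.1 :=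
    fst.comp (snd.comp snd)
  have h2 : PolyTime fun x : Bool × Bool × List Bool × List Bool => x.2.2.2 :=
    snd.comp (snd.comp snd)
  exact cond (fst.comp snd) ((const true).pair (h1.pair (fst.cons h2)))
    (cond fst ((const false).pair (((const true).cons h1).pair h2))
      ((const true).pair (h1.pair h2)))

theorem readUnary : PolyTime readUnary := by
  have h := foldl_of_growth (f := fun y : List Bool × Bool × Bool × List Bool × List Bool =>
      GK.readUnaryStep y.2.1 y.2.2) id (const (false, [], [])) (readUnaryStep.comp snd)
    ⟨fun n => n + 6, PolyBounded.id.add (.const 6), fun a b c => by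
      obtain ⟨c, l, l'⟩ := c
      have := size_bool_le b
      have := size_bool_le true
      have := size_pos c
      cases c <;> cases b <;> simp only [GK.readUnaryStep, size_pair, size_cons, Bool.cond_true,
        Bool.cond_false] <;> omega⟩
  exact (fst.comp (snd.comp h)).pair (snd.comp (snd.comp h)).reverse

theorem readPair : PolyTime readPair :=
  ((headD id false).pair (headD (tail id) false)).pair (tail (tail id))

end PolyTime

theorem size_readPair_le (w : List Bool) : size (readPair w).2 ≤ size w :=
  (PolyTime.size_tail_le _).trans (PolyTime.size_tail_le _)

theorem foldl_readLetters (l : List Bool) (c : List (Bool × Bool) × List Bool) :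
    size (l.foldl (fun c _ => ((readPair c.2).1 :: c.1, (readPair c.2).2)) c).2 ≤ size c.2 ∧
    (l.foldl (fun c _ => ((readPair c.2).1 :: c.1, (readPair c.2).2)) c).1.length =
      c.1.length + l.length := by
  induction l generalizing c with
  | nil => simp
  | cons b l ih =>
    have := ih ((readPair c.2).1 :: c.1, (readPair c.2).2)
    have h := size_readPair_le c.2
    simp only [List.foldl_cons, List.length_cons] at this ⊢
    omega

theorem size_readRow_le (x : List Bool × List Bool) : size (readRow x).2 ≤ size x.2 :=
  ((foldl_readLetters _ _).1).trans (size_readPair_le _)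

theorem length_readRow (x : List Bool × List Bool) : (readRow x).1.2.length = x.1.length := by
  simpa [readRow, readLetters] using (foldl_readLetters x.1 ([], (readPair x.2).2)).2

namespace PolyTime

variable {α : Type} [Enc α]

theorem readLetters : PolyTime readLetters := by
  have hr : PolyTime fun y : (List Bool × List Bool) × Bool × List (Bool × Bool) × List Bool =>
      GK.readPair y.2.2.2 := readPair.comp (snd.comp (snd.comp snd))
  refine foldl_of_growth (f := fun y : (List Bool × List Bool) × Bool × List (Bool × Bool) ×
      List Bool => ((GK.readPair y.2.2.2).1 :: y.2.2.1, (GK.readPair y.2.2.2).2))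
    fst ((const []).pair snd) (((fst.comp hr).cons (fst.comp (snd.comp snd))).pair (snd.comp hr))
    ⟨fun _ => 8, .const 8, fun a b c => ?_⟩
  obtain ⟨l, w⟩ := c
  have h1 := size_readPair_le w
  have h2 := size_pair_bool_le (GK.readPair w).1
  simp only [size_pair, size_cons]
  omega

theorem readRow : PolyTime readRow := by
  have h1 : PolyTime fun x : List Bool × List Bool => GK.readPair x.2 := readPair.comp snd
  have h2 : PolyTime fun x : List Bool × List Bool => GK.readLetters (x.1, (GK.readPair x.2).2) :=
    readLetters.comp (fst.pair (snd.comp h1))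
  exact ((fst.comp h1).pair (fst.comp h2).reverse).pair (snd.comp h2)

theorem readTable : PolyTime readTable := by
  have h1 : PolyTime fun y : (List Bool × List Bool) × Bool × Table × List Bool =>
      GK.readRow (y.1.1, y.2.2.2) :=
    readRow.comp ((fst.comp fst).pair (snd.comp (snd.comp snd)))
  have h2 : PolyTime fun y : (List Bool × List Bool) × Bool × Table × List Bool =>
      GK.readRow (y.1.1, (GK.readRow (y.1.1, y.2.2.2)).2) :=
    readRow.comp ((fst.comp fst).pair (snd.comp h1))
  refine foldl_of_growth (f := fun y : (List Bool × List Bool) × Bool × Table × List Bool =>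
      (((GK.readRow (y.1.1, y.2.2.2)).1, (GK.readRow (y.1.1, (GK.readRow (y.1.1, y.2.2.2)).2)).1) ::
        y.2.2.1, (GK.readRow (y.1.1, (GK.readRow (y.1.1, y.2.2.2)).2)).2))
    fst ((const []).pair snd)
    ((((fst.comp h1).pair (fst.comp h2)).cons (fst.comp (snd.comp snd))).pair (snd.comp h2))
    ⟨fun n => 16 * n + 30, ((PolyBounded.const 16).mul .id).add (.const 30), fun a b c => ?_⟩
  obtain ⟨T, w⟩ := c
  obtain ⟨N, w'⟩ := a
  have e1 := size_readRow_le (N, w)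
  have e2 := size_readRow_le (N, (GK.readRow (N, w)).2)
  have e3 := size_row_le (GK.readRow (N, w)).1
  have e4 := size_row_le (GK.readRow (N, (GK.readRow (N, w)).2)).1
  rw [length_readRow] at e3 e4
  dsimp only at e1 e2 e3 e4
  have e5 := length_lt_size N
  simp only [size_pair, size_cons]
  omega

theorem hadTable : PolyTime fun x : List Bool × List Bool => hadTable x.1 x.2 :=
  modify snd (identTable.comp fst) ((snd.comp snd).pair (fst.comp snd))

theorem phaseTable : PolyTime fun x : List Bool × List Bool => phaseTable x.1 x.2 :=
  modify snd (identTable.comp fst) ((mulI.comp (mulRow.comp snd)).pair (snd.comp snd))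

theorem entryAt : PolyTime entryAt := headD (drop snd fst) _

theorem cnotTable : PolyTime fun x : List Bool × List Bool × List Bool =>
    cnotTable x.1 x.2.1 x.2.2 := by
  have hi : PolyTime fun x : List Bool × List Bool × List Bool => GK.identTable x.1 :=
    identTable.comp fst
  have hc : PolyTime fun x : List Bool × List Bool × List Bool =>
      (GK.entryAt (GK.identTable x.1, x.2.1)).2 :=
    snd.comp (entryAt.comp (hi.pair (fst.comp snd)))
  have ht : PolyTime fun x : List Bool × List Bool × List Bool =>
      (GK.entryAt (GK.identTable x.1, x.2.2)).1 :=
    fst.comp (entryAt.comp (hi.pair (snd.comp snd)))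
  exact modify (snd.comp snd) (modify (fst.comp snd) hi
    ((mulRow.comp ((fst.comp snd).pair (ht.comp fst))).pair (snd.comp snd)))
    ((fst.comp snd).pair (mulRow.comp ((hc.comp fst).pair (snd.comp snd))))

theorem readGate : PolyTime readGate := by
  have hp : PolyTime fun x : List Bool × List Bool => GK.readPair x.2 := readPair.comp snd
  have hw : PolyTime fun x : List Bool × List Bool => (GK.readPair x.2).2 := snd.comp hp
  have hT : PolyTime fun x : List Bool × List Bool => GK.readTable (x.1, (GK.readPair x.2).2) :=
    readTable.comp (fst.pair hw)
  have hu : PolyTime fun x : List Bool × List Bool => GK.readUnary (GK.readPair x.2).2 :=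
    readUnary.comp hw
  have hv : PolyTime fun x : List Bool × List Bool =>
      GK.readUnary (GK.readUnary (GK.readPair x.2).2).2 := readUnary.comp (snd.comp hu)
  have hi := fst.pair (fst.comp hu)
  exact cond (fst.comp (fst.comp hp))
    (cond (snd.comp (fst.comp hp)) ((fst.comp hT).reverse.pair (snd.comp hT))
      ((cnotTable.comp (fst.pair ((fst.comp hu).pair (fst.comp hv)))).pair (snd.comp hv)))
    ((cond (snd.comp (fst.comp hp)) (phaseTable.comp hi) (hadTable.comp hi)).pair (snd.comp hu))

theorem gateStep : PolyTime fun x : List Bool × List Bool × List Row => gateStep x.1 x.2 := by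
  have h : PolyTime fun x : List Bool × List Bool × List Row =>
      GK.readGate (x.1, x.2.1.tail) := readGate.comp (fst.pair (tail (fst.comp snd)))
  exact cond (headD (fst.comp snd) false)
    ((snd.comp h).pair ((snd.comp snd).map (applyTable.comp ((fst.comp (h.comp fst)).pair snd)))) snd

end PolyTime

end GK

namespace GK

/-! ### Size bounds for the reading of gates and for the elimination -/

theorem size_readUnary_le (w : List Bool) : size (readUnary w).2 ≤ size w := by
  have key : ∀ (w : List Bool) (c : Bool × List Bool × List Bool),
      size (w.foldl (fun c b => readUnaryStep b c) c).2.2 + 1 ≤ size c.2.2 + size w := by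
    intro w
    induction w with
    | nil => intro c; exact le_rfl
    | cons b w ih =>
      rintro ⟨c, l, l'⟩
      refine (ih _).trans ?_
      cases c <;> cases b <;>
        simp only [readUnaryStep, Bool.cond_true, Bool.cond_false, size_cons] <;> omega
  have := key w (false, [], [])
  simp only [readUnary, size_reverse]
  simp only [size_nil] at this
  omega

theorem size_readTable_le (x : List Bool × List Bool) : size (readTable x).2 ≤ size x.2 := by
  obtain ⟨N, w⟩ := x
  unfold readTable
  dsimp only
  have key : ∀ (l : List Bool) (c : Table × List Bool),
      size (l.foldl (fun c _ => (((readRow (N, c.2)).1, (readRow (N, (readRow (N, c.2)).2)).1) :: c.1,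
    (readRow (N, (readRow (N, c.2)).2)).2)) c).2 ≤ size c.2 := by
    intro l
    induction l with
    | nil => intro c; exact le_rfl
    | cons b l ih =>
      intro c
      exact (ih _).trans ((size_readRow_le _).trans (size_readRow_le (N, c.2)))
  exact key _ _

/-- All readers only remove bits. This bounds the unread part of the description during
`applyGates`, however malformed it is. -/
theorem size_readGate_le (x : List Bool × List Bool) : size (readGate x).2 ≤ size x.2 := by
  have h1 := size_readPair_le x.2
  have h2 := size_readTable_le (x.1, (readPair x.2).2)
  have h3 := size_readUnary_le (readPair x.2).2
  have h4 := size_readUnary_le (readUnary (readPair x.2).2).2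
  rw [readGate]
  cases (readPair x.2).1.1 <;> cases (readPair x.2).1.2 <;>
    simp only [Bool.cond_true, Bool.cond_false] <;> dsimp only at * <;> omega

theorem foldl_gateStep_bounds (N : List Bool) {M : ℕ} (l : List Bool) (c : List Bool × List Row)
    (hc : ∀ r ∈ c.2, r.2.length ≤ M) :
    size (l.foldl (fun c _ => gateStep N c) c).1 ≤ size c.1 ∧
    (l.foldl (fun c _ => gateStep N c) c).2.length = c.2.length ∧
    ∀ r ∈ (l.foldl (fun c _ => gateStep N c) c).2, r.2.length ≤ M := by
  induction l generalizing c with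
  | nil => exact ⟨le_rfl, rfl, hc⟩
  | cons b l ih =>
    rw [List.foldl_cons]
    by_cases h : c.1.headD false = true
    · have e : gateStep N c = ((readGate (N, c.1.tail)).2,
          c.2.map fun r => applyTable ((readGate (N, c.1.tail)).1, r)) := by
        rw [gateStep, h]; rfl
      obtain ⟨h1, h2, h3⟩ := ih (gateStep N c) (by
        rw [e]
        intro r hr
        obtain ⟨r', hr', rfl⟩ := List.mem_map.mp hr
        exact (applyTable_length_le _).trans (hc r' hr'))
      refine ⟨h1.trans ?_, h2.trans (by rw [e]; simp), h3⟩
      rw [e]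
      exact (size_readGate_le _).trans (PolyTime.size_tail_le _)
    · have e : gateStep N c = c := by
        rw [gateStep, Bool.eq_false_of_not_eq_true h]; rfl
      rw [e]
      exact ih c hc

theorem foldl_sweepStep_bounds (t : Bool → Bool → Bool) (j : List Bool) {M : ℕ} (l : List Row)
    (c : Option Row × List Row) (hl : ∀ r ∈ l, r.2.length ≤ M) (hc : ∀ r ∈ c.2, r.2.length ≤ M)
    (hp : ∀ r ∈ c.1, r.2.length ≤ M) :
    (l.foldl (fun c r => sweepStep t j r c) c).2.length ≤ c.2.length + l.length ∧
    (∀ r ∈ (l.foldl (fun c r => sweepStep t j r c) c).2, r.2.length ≤ M) ∧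
    ∀ r ∈ (l.foldl (fun c r => sweepStep t j r c) c).1, r.2.length ≤ M := by
  induction l generalizing c with
  | nil => exact ⟨le_rfl, hc, hp⟩
  | cons r l ih =>
    rw [List.foldl_cons]
    have hr := hl r (by simp)
    have key : (sweepStep t j r c).2.length ≤ c.2.length + 1 ∧
        (∀ r' ∈ (sweepStep t j r c).2, r'.2.length ≤ M) ∧
        ∀ r' ∈ (sweepStep t j r c).1, r'.2.length ≤ M := by
      obtain ⟨p, out⟩ := c
      cases h : t (letterAt (j, r)).1 (letterAt (j, r)).2
      · simp only [sweepStep, h, Bool.cond_false]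
        refine ⟨by simp, ?_, hp⟩
        intro r' hr'
        rcases List.mem_cons.mp hr' with rfl | h'
        · exact hr
        · exact hc _ h'
      · cases p with
        | none =>
          simp only [sweepStep, h, Bool.cond_true]
          exact ⟨by simp, hc, fun r' hr' => by
            obtain rfl : r = r' := by simpa using hr'
            exact hr⟩
        | some q =>
          simp only [sweepStep, h, Bool.cond_true]
          refine ⟨by simp, ?_, hp⟩
          intro r' hr'
          rcases List.mem_cons.mp hr' with rfl | h'
          · exact (mulRow_length_le_right _ _).trans hr
          · exact hc _ h'
    obtain ⟨h1, h2, h3⟩ := ih (sweepStep t j r c) (fun r hr => hl r (by simp [hr])) key.2.1 key.2.2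
    refine ⟨?_, h2, h3⟩
    have := key.1
    rw [List.length_cons]; omega

theorem sweep_bounds (t : Bool → Bool → Bool) (j : List Bool) {M : ℕ} {l : List Row}
    (hl : ∀ r ∈ l, r.2.length ≤ M) :
    (sweep t (j, l)).2.length ≤ l.length ∧ (∀ r ∈ (sweep t (j, l)).2, r.2.length ≤ M) ∧
      ∀ r ∈ (sweep t (j, l)).1, r.2.length ≤ M := by
  simpa [sweep] using foldl_sweepStep_bounds t j l (none, []) hl (by simp) (by simp)

theorem size_equation_le {M : ℕ} (x : List Bool × Option Row) (h : ∀ r ∈ x.2, r.2.length ≤ M) :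
    size (equation x) ≤ 4 * M + 7 := by
  obtain ⟨j, _ | r⟩ := x
  · simp [equation, size_none]
  · have h1 := h r rfl
    have h2 := size_bool_le r.1.1
    have h3 := size_le_of_forall (B := 3) (l := (r.2.drop j.length).tail.map fun l => l.2)
      fun b _ => size_bool_le b
    simp only [List.length_map, List.length_tail, List.length_drop] at h3
    simp only [equation, size_some, size_pair]
    omega

/-- The rows grow neither in number nor in length. Each column adds one bit to the column counter,
of size 4 with its list node, and one entry of size at most `4 * M + 8` to the equations, so the
sizes add up instead of multiplying. -/
theorem foldl_elimStep_bounds (t : Bool → Bool → Bool) {M : ℕ} (l : List Bool)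
    (c : List Bool × List Row × List (Option (Bool × List Bool)))
    (hc : ∀ r ∈ c.2.1, r.2.length ≤ M) :
    size (l.foldl (fun c _ => elimStep t c) c).1 = size c.1 + 4 * l.length ∧
    (l.foldl (fun c _ => elimStep t c) c).2.1.length ≤ c.2.1.length ∧
    (∀ r ∈ (l.foldl (fun c _ => elimStep t c) c).2.1, r.2.length ≤ M) ∧
    size (l.foldl (fun c _ => elimStep t c) c).2.2 ≤ size c.2.2 + l.length * (4 * M + 8) := by
  induction l generalizing c with
  | nil => simpa using hc
  | cons b l ih =>
    rw [List.foldl_cons]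
    obtain ⟨e1, e2, e3⟩ := sweep_bounds t c.1 hc
    obtain ⟨h1, h2, h3, h4⟩ := ih (elimStep t c) e2
    have h5 : size (elimStep t c).1 = size c.1 + 4 := by
      simp only [elimStep, size_cons]
      have : size true = 3 := rfl
      omega
    have h6 : size (elimStep t c).2.2 ≤ size c.2.2 + (4 * M + 8) := by
      simp only [elimStep, size_cons]
      have := size_equation_le (c.1, (sweep t (c.1, c.2.1)).1) e3
      omega
    refine ⟨?_, h2.trans e1, h3, ?_⟩
    · rw [List.length_cons]; omega
    · rw [List.length_cons, Nat.add_mul]; omega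

namespace PolyTime

theorem applyGates : PolyTime applyGates := by
  refine snd.comp (foldl_of_bound
    (f := fun y : (List Bool × List Bool × List Row) × Bool × List Bool × List Row =>
      GK.gateStep y.1.1 y.2.2)
    (fst.comp snd) snd (gateStep.comp ((fst.comp fst).pair (snd.comp snd)))
    ⟨fun n => n + n * (8 * n + 10) + 2, (PolyBounded.id.add
      (PolyBounded.id.mul (((PolyBounded.const 8).mul .id).add (.const 10)))).add (.const 2),
      fun a l₁ _ => ?_⟩)
  obtain ⟨N, w, rows⟩ := a
  obtain ⟨h1, h2, h3⟩ := foldl_gateStep_bounds N (M := size rows) l₁ (w, rows) fun r hr =>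
    (length_row_le r).trans (size_mem_le hr)
  have h4 := size_rows_le h3
  rw [h2] at h4
  have h5 : size (l₁.foldl (fun c _ => GK.gateStep N c) (w, rows)) = _ := size_pair
    (l₁.foldl (fun c _ => GK.gateStep N c) (w, rows)).1
    (l₁.foldl (fun c _ => GK.gateStep N c) (w, rows)).2
  have h6 := length_lt_size rows
  have h7 : rows.length * (8 * size rows + 10) ≤
      size (N, w, rows) * (8 * size (N, w, rows) + 10) := by
    gcongr
    · simp only [size_pair]; omega
    · simp only [size_pair]; omega
  have h8 : size w ≤ size (N, w, rows) := by simp only [size_pair]; omega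
  beta_reduce
  dsimp only at *
  omega

theorem letterAt : PolyTime letterAt := headD (drop fst (snd.comp snd)) _

theorem sweepStep (t : Bool → Bool → Bool) :
    PolyTime fun x : (List Bool × Row) × Option Row × List Row =>
      sweepStep t x.1.1 x.1.2 x.2 := by
  have h1 : PolyTime fun x : (List Bool × Row) × Option Row × List Row =>
      (match x.2.1 with
        | none => (.some x.1.2, x.2.2)
        | .some q => (.some q, GK.mulRow (q, x.1.2) :: x.2.2) : Option Row × List Row) :=
    option_cases (fst.comp snd) ((some (snd.comp fst)).pair (snd.comp snd))
      ((some snd).pair ((mulRow.comp (snd.pair ((snd.comp fst).comp fst))).cons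
        ((snd.comp snd).comp fst)))
      (fun a h => by simp only [h]) (fun a b h => by simp only [h])
  have h2 : PolyTime fun x : (List Bool × Row) × Option Row × List Row =>
      t (GK.letterAt x.1).1 (GK.letterAt x.1).2 := (bool_fun₂ t).comp (letterAt.comp fst)
  have h3 : PolyTime fun x : (List Bool × Row) × Option Row × List Row =>
      (x.2.1, x.1.2 :: x.2.2) := (fst.comp snd).pair ((snd.comp fst).cons (snd.comp snd))
  exact cond h2 h1 h3

theorem sweep (t : Bool → Bool → Bool) : PolyTime (sweep t) := by
  have hp : PolyTime fun y : (List Bool × List Row) × Row × Option Row × List Row =>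
      ((y.1.1, y.2.1), y.2.2) := ((fst.comp fst).pair (fst.comp snd)).pair (snd.comp snd)
  have hs := (sweepStep t).comp hp
  refine foldl_of_bound (f := fun y : (List Bool × List Row) × Row × Option Row × List Row =>
      GK.sweepStep t y.1.1 y.2.1 y.2.2) snd (const (none, []))
    hs
    ⟨fun n => n * (8 * n + 10) + 8 * n + 20, ((PolyBounded.id.mul
      (((PolyBounded.const 8).mul .id).add (.const 10))).add ((PolyBounded.const 8).mul .id)).add
      (.const 20), fun a l₁ hl₁ => ?_⟩
  obtain ⟨j, rows⟩ := a
  have h0 : size rows ≤ size (j, rows) := by simp only [size_pair]; omega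
  obtain ⟨h1, h2, h3⟩ := foldl_sweepStep_bounds t j (M := size (j, rows)) l₁ (none, [])
    (fun r hr => (length_row_le r).trans ((size_mem_le (hl₁.subset hr)).trans h0))
    (by simp) (by simp)
  have h4 := size_rows_le h2
  have h5 : size (l₁.foldl (fun c r => GK.sweepStep t j r c) (none, [])) = _ := size_pair
    (l₁.foldl (fun c r => GK.sweepStep t j r c) (none, [])).1
    (l₁.foldl (fun c r => GK.sweepStep t j r c) (none, [])).2
  have h6 : size (l₁.foldl (fun c r => GK.sweepStep t j r c) (none, [])).1 ≤
      8 * size (j, rows) + 11 := by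
    cases e : (l₁.foldl (fun c r => GK.sweepStep t j r c) (none, [])).1 with
    | none => simp [size_none]
    | some r =>
      have e1 := size_row_le r
      have e2 := h3 r (by rw [e]; rfl)
      rw [size_some]; omega
  have h7 : (l₁.foldl (fun c r => GK.sweepStep t j r c) (none, [])).2.length ≤
      size (j, rows) := by
    have e1 := hl₁.length_le
    have e2 := length_lt_size rows
    simp only [List.length_nil] at h1
    dsimp only at e1
    omega
  have h8 := Nat.mul_le_mul_right (8 * size (j, rows) + 10) h7
  beta_reduce
  dsimp only at *
  omega

theorem equation : PolyTime equation :=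
  option_cases snd (const none)
    (some ((fst.comp (fst.comp snd)).pair
      ((tail (drop (fst.comp fst) (snd.comp snd))).map (snd.comp snd))))
    (fun a h => by simp only [GK.equation, h]) (fun a b h => by simp only [GK.equation, h])

theorem elimStep (t : Bool → Bool → Bool) : PolyTime (elimStep t) := by
  have h : PolyTime fun c : List Bool × List Row × List (Option (Bool × List Bool)) =>
      GK.sweep t (c.1, c.2.1) := (sweep t).comp (fst.pair (fst.comp snd))
  exact ((const true).cons fst).pair ((snd.comp h).pair
    ((equation.comp (fst.pair (fst.comp h))).cons (snd.comp snd)))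

theorem eliminate (t : Bool → Bool → Bool) : PolyTime (eliminate t) := by
  refine foldl_of_bound (f := fun y : (List Bool × List Row) × Bool × List Bool × List Row ×
      List (Option (Bool × List Bool)) => GK.elimStep t y.2.2) fst
    ((const []).pair (snd.pair (const []))) ((elimStep t).comp (snd.comp snd))
    ⟨fun n => 4 * n + n * (8 * n + 10) + n * (4 * n + 8) + 5, (((PolyBounded.const 4).mul .id).add
      (PolyBounded.id.mul (((PolyBounded.const 8).mul .id).add (.const 10)))).add
      (PolyBounded.id.mul (((PolyBounded.const 4).mul .id).add (.const 8))) |>.add (.const 5),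
      fun a l₁ hl₁ => ?_⟩
  obtain ⟨N, rows⟩ := a
  have h0 : size rows ≤ size (N, rows) := by simp only [size_pair]; omega
  obtain ⟨h1, h2, h3, h4⟩ := foldl_elimStep_bounds t (M := size (N, rows)) l₁ ([], rows, [])
    (fun r hr => (length_row_le r).trans ((size_mem_le hr).trans h0))
  have h5 := size_rows_le h3
  have h6 : size (l₁.foldl (fun c _ => GK.elimStep t c) ([], rows, [])) =
      size (l₁.foldl (fun c _ => GK.elimStep t c) ([], rows, [])).1 +
      (size (l₁.foldl (fun c _ => GK.elimStep t c) ([], rows, [])).2.1 +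
        size (l₁.foldl (fun c _ => GK.elimStep t c) ([], rows, [])).2.2 + 1) + 1 := by
    rw [← size_pair, ← size_pair]
  have h7 : l₁.length ≤ size (N, rows) := by
    have e1 := hl₁.length_le
    have e2 := length_lt_size N
    simp only [size_pair]
    dsimp only at e1
    omega
  have h8 : (l₁.foldl (fun c _ => GK.elimStep t c) ([], rows, [])).2.1.length ≤ size (N, rows) := by
    have e2 := length_lt_size rows
    dsimp only at h2
    omega
  have h9 := Nat.mul_le_mul_right (8 * size (N, rows) + 10) h8
  have h10 := Nat.mul_le_mul_right (4 * size (N, rows) + 8) h7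
  beta_reduce
  simp only [size_nil] at *
  omega

theorem dotAdd : PolyTime dotAdd := by
  refine foldl_of_growth (f := fun y : (Bool × List Bool × List Bool) × (Bool × Bool) × Bool =>
      y.2.2 ^^ (y.2.1.1 && y.2.1.2)) (zip (fst.comp snd) (snd.comp snd)) fst
    ((bool_fun₂ fun a b => a ^^ b).comp ((snd.comp snd).pair
      ((bool_fun₂ fun a b => a && b).comp (fst.comp snd)))) ⟨fun _ => 3, .const 3, fun a b c => ?_⟩
  exact (size_bool_le _).trans (Nat.le_add_left _ _)

theorem solveStep : PolyTime fun x : (Option (Bool × List Bool) × Bool) × List Bool =>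
    solveStep x.1 x.2 :=
  option_cases (fst.comp fst) ((snd.comp fst).cons snd)
    ((dotAdd.comp ((fst.comp snd).pair ((snd.comp snd).pair (snd.comp fst)))).cons (snd.comp fst))
    (fun a h => by simp only [GK.solveStep, h]) (fun a b h => by simp only [GK.solveStep, h])

theorem solve : PolyTime solve := by
  refine foldl_of_growth (f := fun y : (List (Option (Bool × List Bool)) × List Bool) ×
      (Option (Bool × List Bool) × Bool) × List Bool => GK.solveStep y.2.1 y.2.2)
    (zip fst snd) (const []) (solveStep.comp snd) ⟨fun _ => 4, .const 4, fun a b c => ?_⟩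
  obtain ⟨_ | e, b⟩ := b
  · have := size_bool_le b
    simp only [GK.solveStep, size_cons]; omega
  · have := size_bool_le (GK.dotAdd (e.1, e.2, c))
    simp only [GK.solveStep, size_cons]; omega

theorem simulate : PolyTime simulate := by
  have h1 : PolyTime fun x : List Bool × List (((Bool × Bool) × Bool) × Bool) =>
      GK.readUnary x.1 := readUnary.comp fst
  have h2 : PolyTime fun x : List Bool × List (((Bool × Bool) × Bool) × Bool) =>
      GK.applyGates ((GK.readUnary x.1).1, (GK.readUnary x.1).2,
        GK.unitRows (x.2.map fun b => b.1)) :=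
    applyGates.comp ((fst.comp h1).pair ((snd.comp h1).pair
      (unitRows.comp (snd.map (fst.comp snd)))))
  exact (solve.comp ((snd.comp (snd.comp ((eliminate _).comp ((fst.comp h1).pair
    (fst.comp (snd.comp ((eliminate _).comp ((fst.comp h1).pair h2)))))))).pair
      (snd.map (snd.comp snd)))).reverse

end PolyTime

end GK

namespace GK

/-! ### Tensor products of operators -/

section tensor

variable {n : ℕ}

theorem tensor_apply (A : Fin n → Matrix (Fin 2) (Fin 2) ℂ) (x y : Fin n → Fin 2) :
    tensor A x y = ∏ i, A i (x i) (y i) := rfl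

theorem tensor_mul (A B : Fin n → Matrix (Fin 2) (Fin 2) ℂ) :
    tensor A * tensor B = tensor fun i => A i * B i := by
  ext x z
  simp only [Matrix.mul_apply, tensor_apply, ← Finset.prod_mul_distrib]
  rw [Finset.prod_univ_sum, Fintype.piFinset_univ]

theorem tensor_one : tensor (fun _ : Fin n => 1) = 1 := by
  ext x y
  rw [tensor_apply, Matrix.one_apply]
  split_ifs with h
  · exact Finset.prod_eq_one fun i _ => by rw [h, Matrix.one_apply_eq]
  · obtain ⟨i, hi⟩ := Function.ne_iff.mp h
    exact Finset.prod_eq_zero (Finset.mem_univ i) (by rw [Matrix.one_apply_ne hi])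

theorem tensor_smul (c : Fin n → ℂ) (A : Fin n → Matrix (Fin 2) (Fin 2) ℂ) :
    tensor (fun i => c i • A i) = (∏ i, c i) • tensor A := by
  ext x y
  simp [tensor_apply, Finset.prod_mul_distrib]

theorem tensor_conjTranspose (A : Fin n → Matrix (Fin 2) (Fin 2) ℂ) :
    (tensor A)ᴴ = tensor fun i => (A i)ᴴ := by
  ext x y
  simp [tensor_apply, Matrix.conjTranspose_apply]

theorem onQubit_mul (i : Fin n) (A B : Matrix (Fin 2) (Fin 2) ℂ) :
    onQubit i A * onQubit i B = onQubit i (A * B) := by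
  rw [onQubit, onQubit, onQubit, tensor_mul]
  congr 1
  funext j
  by_cases h : j = i
  · subst h; simp
  · simp [h]

theorem onQubit_one (i : Fin n) : onQubit i 1 = 1 := by
  rw [onQubit, Function.update_eq_self i fun _ => (1 : Matrix (Fin 2) (Fin 2) ℂ), tensor_one]

theorem onQubit_conjTranspose (i : Fin n) (A : Matrix (Fin 2) (Fin 2) ℂ) :
    (onQubit i A)ᴴ = onQubit i Aᴴ := by
  rw [onQubit, onQubit, tensor_conjTranspose]
  congr 1
  funext j
  by_cases h : j = i
  · subst h; simp
  · simp [h]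

theorem onQubit_commute {i j : Fin n} (h : i ≠ j) (A B : Matrix (Fin 2) (Fin 2) ℂ) :
    Commute (onQubit i A) (onQubit j B) := by
  rw [Commute, SemiconjBy, onQubit, onQubit, tensor_mul, tensor_mul]
  congr 1
  funext k
  by_cases h1 : k = i
  · subst h1; simp [h]
  · simp [h1]

/-- An entry depends on `A` through a single factor; the linearity of `onQubit i` follows from this.
-/
theorem onQubit_apply (i : Fin n) (A : Matrix (Fin 2) (Fin 2) ℂ) (x y : Fin n → Fin 2) :
    onQubit i A x y = A (x i) (y i) * ∏ j ∈ Finset.univ.erase i, (1 : Matrix _ _ ℂ) (x j) (y j) := by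
  rw [onQubit, tensor_apply, ← Finset.mul_prod_erase _ _ (Finset.mem_univ i)]
  congr 1
  · simp
  · exact Finset.prod_congr rfl fun j hj => by
      rw [Function.update_of_ne (Finset.ne_of_mem_erase hj)]

theorem onQubit_add (i : Fin n) (A B : Matrix (Fin 2) (Fin 2) ℂ) :
    onQubit i (A + B) = onQubit i A + onQubit i B := by
  ext x y
  simp [onQubit_apply, add_mul]

theorem onQubit_smul (i : Fin n) (c : ℂ) (A : Matrix (Fin 2) (Fin 2) ℂ) :
    onQubit i (c • A) = c • onQubit i A := by
  ext x y
  simp [onQubit_apply, mul_assoc]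

theorem onQubit_zero (i : Fin n) : onQubit i 0 = 0 := by
  simpa using onQubit_smul i 0 0

/-- Writing a tensor product as an ordered product of single-qubit operators reduces its conjugation
to that of the factors. The induction runs over duplicate-free lists of qubits, with the identity at
the absent ones. -/
theorem tensor_eq_prod (A : Fin n → Matrix (Fin 2) (Fin 2) ℂ) :
    tensor A = ((List.finRange n).map fun i => onQubit i (A i)).prod := by
  have key : ∀ L : List (Fin n), L.Nodup → (L.map fun i => onQubit i (A i)).prod =
      tensor fun i => if i ∈ L then A i else 1 := by
    intro L
    induction L with
    | nil => simp [tensor_one]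
    | cons i L ih =>
      intro hL
      rw [List.map_cons, List.prod_cons, ih hL.of_cons, onQubit, tensor_mul]
      congr 1
      funext j
      by_cases h : j = i
      · subst h
        simp [(List.nodup_cons.mp hL).1]
      · simp [h]
  rw [key _ (List.nodup_finRange n)]
  simp

end tensor

/-! ### Rows as operators -/

def letterMatrix (l : Bool × Bool) : Matrix (Fin 2) (Fin 2) ℂ :=
  match l with
  | (false, false) => 1
  | (true, false) => matX
  | (true, true) => matY
  | (false, true) => matZ

def phaseValue (p : Bool × Bool) : ℂ := Complex.I ^ (2 * p.1.toNat + p.2.toNat)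

theorem phaseValue_add (p q : Bool × Bool) :
    phaseValue (phaseAdd p q) = phaseValue p * phaseValue q := by
  obtain ⟨a, b⟩ := p
  obtain ⟨c, d⟩ := q
  cases a <;> cases b <;> cases c <;> cases d <;>
    simp [phaseValue, phaseAdd, pow_succ]

theorem letterMatrix_mul (a b : Bool × Bool) :
    letterMatrix a * letterMatrix b = phaseValue (letterPhase a b) • letterMatrix (letterMul a b) := by
  obtain ⟨a, a'⟩ := a
  obtain ⟨b, b'⟩ := b
  cases a <;> cases a' <;> cases b <;> cases b' <;>
    simp [phaseValue, letterPhase, letterMul, letterMatrix, pow_succ, matX, matY, matZ,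
      Matrix.one_fin_two]

theorem phaseValue_foldl {β : Type} (f : β → Bool × Bool) (l : List β) (p : Bool × Bool) :
    phaseValue (l.foldl (fun c b => phaseAdd c (f b)) p) =
      phaseValue p * (l.map fun b => phaseValue (f b)).prod := by
  induction l generalizing p with
  | nil => simp
  | cons b l ih => simp [ih, phaseValue_add, mul_assoc]

/-- The operator on `n` qubits that a row describes. -/
def rowOp (n : ℕ) (r : Row) : Op n :=
  phaseValue r.1 • tensor fun i => letterMatrix (r.2.getD i (false, false))

theorem exists_ofFn {β : Type} {n : ℕ} {l : List β} (h : l.length = n) :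
    ∃ f : Fin n → β, l = List.ofFn f := by
  subst h
  exact ⟨l.get, (List.ofFn_get l).symm⟩

theorem getD_ofFn {β : Type} {n : ℕ} (f : Fin n → β) (d : β) (i : Fin n) :
    (List.ofFn f).getD i d = f i := by
  simp [List.getD]

theorem zip_ofFn {β γ : Type} {n : ℕ} (f : Fin n → β) (g : Fin n → γ) :
    (List.ofFn f).zip (List.ofFn g) = List.ofFn fun i => (f i, g i) := by
  apply List.ext_getElem <;> simp

variable {n : ℕ}

theorem length_mulRow {r r' : Row} (h : r.2.length = n) (h' : r'.2.length = n) :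
    (mulRow (r, r')).2.length = n := by
  simp [mulRow, h, h']

theorem rowOp_mulRow {r r' : Row} (h : r.2.length = n) (h' : r'.2.length = n) :
    rowOp n (mulRow (r, r')) = rowOp n r * rowOp n r' := by
  obtain ⟨p, l⟩ := r
  obtain ⟨p', l'⟩ := r'
  obtain ⟨f, rfl⟩ := exists_ofFn h
  obtain ⟨f', rfl⟩ := exists_ofFn h'
  simp only [rowOp, mulRow, zip_ofFn, List.map_ofFn, getD_ofFn, Function.comp_def,
    phaseValue_foldl (fun b : (Bool × Bool) × Bool × Bool => letterPhase b.1 b.2),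
    phaseValue_add, smul_mul_assoc, mul_smul_comm, tensor_mul, letterMatrix_mul, tensor_smul,
    smul_smul, List.prod_ofFn]
  congr 1
  ring

theorem rowOp_mulI (r : Row) : rowOp n (mulI r) = Complex.I • rowOp n r := by
  simp only [rowOp, mulI, phaseValue_add, smul_smul]
  rw [show phaseValue (false, true) = Complex.I by simp [phaseValue], mul_comm]

theorem matY_eq : matY = Complex.I • (matX * matZ) := by
  simp [matX, matY, matZ]

theorem onQubit_matY (j : Fin n) :
    onQubit j matY = Complex.I • (onQubit j matX * onQubit j matZ) := by
  rw [onQubit_mul, ← onQubit_smul, matY_eq]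

theorem length_mulImage {l : Bool × Bool} {im : Row × Row} {r : Row} (h : r.2.length = n)
    (h₁ : im.1.2.length = n) (h₂ : im.2.2.length = n) : (mulImage l im r).2.length = n := by
  obtain ⟨x, z⟩ := l
  cases x <;> cases z <;> simp [mulImage, mulI, mulRow, h, h₁, h₂]

/-- The entries of the table are the images of `X_j` and `Z_j` under conjugation by `V`. -/
def TableFor (T : Table) (V : Op n) : Prop :=
  T.length = n ∧ ∀ j : Fin n, ∃ im, T[(j : ℕ)]? = some im ∧ im.1.2.length = n ∧ im.2.2.length = n ∧
    V * onQubit j matX * Vᴴ = rowOp n im.1 ∧ V * onQubit j matZ * Vᴴ = rowOp n im.2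

/-- The images of `X` and `Z` determine that of `Y = iXZ`, because the inner factor `Vᴴ * V` cancels
in the product of two conjugates. -/
theorem rowOp_mulImage {V : Op n} (hV : Vᴴ * V = 1) (j : Fin n) {l : Bool × Bool}
    {im : Row × Row} {r : Row} (h : r.2.length = n) (h₁ : im.1.2.length = n)
    (h₂ : im.2.2.length = n) (hX : V * onQubit j matX * Vᴴ = rowOp n im.1)
    (hZ : V * onQubit j matZ * Vᴴ = rowOp n im.2) :
    rowOp n (mulImage l im r) = rowOp n r * (V * onQubit j (letterMatrix l) * Vᴴ) := by
  obtain ⟨x, z⟩ := l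
  have hV' : V * Vᴴ = 1 := mul_eq_one_comm.mp hV
  cases x <;> cases z
  · simp [mulImage, letterMatrix, onQubit_one, hV']
  · simp [mulImage, letterMatrix, hZ, rowOp_mulRow h h₂]
  · simp [mulImage, letterMatrix, hX, rowOp_mulRow h h₁]
  · have e : V * onQubit j matY * Vᴴ = Complex.I • (rowOp n im.1 * rowOp n im.2) := by
      rw [← hX, ← hZ, onQubit_matY, mul_smul_comm, smul_mul_assoc]
      congr 1
      simp only [Matrix.mul_assoc]
      rw [← Matrix.mul_assoc Vᴴ, hV, Matrix.one_mul]
    simp only [mulImage, letterMatrix, Bool.cond_true, rowOp_mulI, e,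
      rowOp_mulRow (length_mulRow h h₁) h₂, rowOp_mulRow h h₁, mul_smul_comm, Matrix.mul_assoc]

theorem conj_prod {β : Type} {V : Op n} (hV : Vᴴ * V = 1) (f : β → Op n) (L : List β) :
    (L.map fun j => V * f j * Vᴴ).prod = V * (L.map f).prod * Vᴴ := by
  induction L with
  | nil => simpa using (mul_eq_one_comm.mp hV).symm
  | cons j L ih =>
    rw [List.map_cons, List.prod_cons, ih, List.map_cons, List.prod_cons]
    simp only [Matrix.mul_assoc]
    rw [← Matrix.mul_assoc Vᴴ, hV, Matrix.one_mul]

/-- A row is a phase times the product of its letters in the order of the qubits, and conjugation is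
multiplicative. Multiplying the phase by the images of the letters in the same order gives the
conjugate. -/
theorem rowOp_applyTable {V : Op n} (hV : Vᴴ * V = 1) {T : Table} (hT : TableFor T V) {r : Row}
    (hr : r.2.length = n) :
    (applyTable (T, r)).2.length = n ∧ rowOp n (applyTable (T, r)) = V * rowOp n r * Vᴴ := by
  obtain ⟨p, l⟩ := r
  obtain ⟨f, rfl⟩ := exists_ofFn hr
  obtain ⟨hl, hT⟩ := hT
  obtain ⟨T, rfl⟩ := exists_ofFn hl
  have hT' : ∀ j : Fin n, (T j).1.2.length = n ∧ (T j).2.2.length = n ∧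
      V * onQubit j matX * Vᴴ = rowOp n (T j).1 ∧ V * onQubit j matZ * Vᴴ = rowOp n (T j).2 := by
    intro j
    obtain ⟨im, h1, h2⟩ := hT j
    obtain rfl : T j = im := by simpa using h1
    exact h2
  have key : ∀ (L : List (Fin n)) (c : Row), c.2.length = n →
      ((L.map fun i => (f i, T i)).foldl (fun c b => mulImage b.1 b.2 c) c).2.length = n ∧
      rowOp n ((L.map fun i => (f i, T i)).foldl (fun c b => mulImage b.1 b.2 c) c) =
        rowOp n c * (L.map fun j => V * onQubit j (letterMatrix (f j)) * Vᴴ).prod := by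
    intro L
    induction L with
    | nil => intro c hc; simpa using hc
    | cons j L ih =>
      intro c hc
      obtain ⟨h1, h2, h3, h4⟩ := hT' j
      have h5 := ih (mulImage (f j) (T j) c) (length_mulImage hc h1 h2)
      rw [List.map_cons, List.foldl_cons, List.map_cons, List.prod_cons, ← Matrix.mul_assoc,
        ← rowOp_mulImage hV j hc h1 h2 h3 h4]
      exact h5
  have h := key (List.finRange n) (p, (List.ofFn f).map fun _ => (false, false)) (by simp)
  rw [← List.ofFn_eq_map, ← zip_ofFn f T] at h
  refine ⟨h.1, h.2.trans ?_⟩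
  rw [conj_prod hV, ← tensor_eq_prod]
  have e : rowOp n (p, (List.ofFn f).map fun _ => (false, false)) =
      phaseValue p • (1 : Op n) := by
    rw [rowOp, ← tensor_one]
    congr 2
    funext i
    simp [List.getD, letterMatrix]
  rw [e, rowOp]
  simp only [getD_ofFn]
  simp

end GK

namespace GK

/-! ### Correctness of the tables of the gates -/

/-- The rows with one letter each, with the letters in the order of the qubits. -/
def unitRowsRec : List ((Bool × Bool) × Bool) → List Row
  | [] => []
  | b :: q => ((b.2, false), b.1 :: List.replicate q.length (false, false)) ::
      (unitRowsRec q).map prependI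

theorem unitRows_reverse (q : List ((Bool × Bool) × Bool)) :
    unitRows q.reverse = unitRowsRec q := by
  have key : q.reverse.foldl (fun c b => unitRowsStep b c) ([], []) =
      (List.replicate q.length (false, false), unitRowsRec q) := by
    induction q with
    | nil => rfl
    | cons b q ih =>
      rw [List.reverse_cons, List.foldl_append, ih]
      simp [unitRowsStep, unitRowsRec, List.replicate_succ]
  rw [unitRows, key]

theorem length_unitRowsRec (q : List ((Bool × Bool) × Bool)) :
    (unitRowsRec q).length = q.length := by
  rw [← unitRows_reverse, length_unitRows, List.length_reverse]

theorem unitRowsRec_getElem? (q : List ((Bool × Bool) × Bool)) (k : ℕ) (b : (Bool × Bool) × Bool)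
    (hk : q[k]? = some b) :
    ∃ l : List (Bool × Bool), (unitRowsRec q)[k]? = some ((b.2, false), l) ∧ l.length = q.length ∧
      ∀ i, l.getD i (false, false) = if i = k then b.1 else (false, false) := by
  induction q generalizing k with
  | nil => simp at hk
  | cons a q ih =>
    cases k with
    | zero =>
      obtain rfl : a = b := by simpa using hk
      refine ⟨_, rfl, by simp, fun i => ?_⟩
      cases i with
      | zero => simp
      | succ i =>
        simp only [List.getD_cons_succ]
        simp [List.getD, List.getElem?_replicate]
        split_ifs <;> rfl
    | succ k =>
      obtain ⟨l, h1, h2, h3⟩ := ih k (by simpa using hk)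
      refine ⟨(false, false) :: l, by simp [unitRowsRec, h1, prependI], by simp [h2], fun i => ?_⟩
      cases i with
      | zero => simp
      | succ i => simpa using h3 i

variable {n : ℕ}

theorem rowOp_unit (k : Fin n) (b : (Bool × Bool) × Bool) (l : List (Bool × Bool))
    (h : ∀ i : ℕ, l.getD i (false, false) = if i = k then b.1 else (false, false)) :
    rowOp n ((b.2, false), l) = (if b.2 then -1 else 1 : ℂ) • onQubit k (letterMatrix b.1) := by
  rw [rowOp, onQubit]
  congr 1
  · obtain ⟨b, c⟩ := b
    cases c <;> simp [phaseValue]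
  · congr 1
    funext i
    rw [h]
    by_cases hi : i = k
    · subst hi; simp
    · rw [if_neg (fun e => hi (Fin.ext e)), Function.update_of_ne hi]
      rfl

theorem unitRowsRec_replicate (b : (Bool × Bool) × Bool) :
    unitRows ((List.replicate n true).map fun _ => b) = unitRowsRec (List.replicate n b) := by
  rw [← unitRows_reverse]
  simp

theorem tableFor_identTable : TableFor (identTable (List.replicate n true)) (1 : Op n) := by
  refine ⟨by simp [identTable, length_unitRows], fun j => ?_⟩
  obtain ⟨l, h1, h2, h3⟩ := unitRowsRec_getElem? (List.replicate n ((true, false), false)) j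
    ((true, false), false) (by simp)
  obtain ⟨l', h1', h2', h3'⟩ := unitRowsRec_getElem? (List.replicate n ((false, true), false)) j
    ((false, true), false) (by simp)
  refine ⟨(((false, false), l), ((false, false), l')), ?_, by simpa using h2, by simpa using h2',
    ?_, ?_⟩
  · rw [identTable, unitRowsRec_replicate, unitRowsRec_replicate, List.getElem?_zip_eq_some]
    exact ⟨h1, h1'⟩
  · rw [rowOp_unit j ((true, false), false) l h3]
    simp [letterMatrix]
  · rw [rowOp_unit j ((false, true), false) l' h3']
    simp [letterMatrix]

theorem identTable_entry (j : Fin n) : ∃ im : Row × Row,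
    (identTable (List.replicate n true))[(j : ℕ)]? = some im ∧
    im.1.2.length = n ∧ im.2.2.length = n ∧ rowOp n im.1 = onQubit j matX ∧
    rowOp n im.2 = onQubit j matZ := by
  obtain ⟨im, h1, h2, h3, h4, h5⟩ := tableFor_identTable.2 j
  exact ⟨im, h1, h2, h3, by simpa using h4.symm, by simpa using h5.symm⟩

/-! ### Conjugation by the Hadamard gate and the phase gate -/

theorem conj_of_commute {V A : Op n} (hV : Vᴴ * V = 1) (h : Commute V A) : V * A * Vᴴ = A := by
  rw [h.eq, Matrix.mul_assoc, mul_eq_one_comm.mp hV, Matrix.mul_one]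

theorem conj_of_semiconj {V A B : Op n} (hV : Vᴴ * V = 1) (h : V * A = B * V) :
    V * A * Vᴴ = B := by
  rw [h, Matrix.mul_assoc, mul_eq_one_comm.mp hV, Matrix.mul_one]

theorem sqrt_two_sq : ((1 / √2 : ℝ) : ℂ) * ((1 / √2 : ℝ) : ℂ) = 1 / 2 := by
  rw [← Complex.ofReal_mul]
  have : (1 / √2) * (1 / √2) = (1 / 2 : ℝ) := by
    rw [div_mul_div_comm, Real.mul_self_sqrt (by norm_num)]; norm_num
  rw [this]; norm_num

theorem matH_conjTranspose : matHᴴ = matH := by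
  ext i j
  fin_cases i <;> fin_cases j <;> simp [matH]

theorem matH_mul_self : matH * matH = 1 := by
  rw [matH, smul_mul_smul_comm, sqrt_two_sq]
  ext i j
  fin_cases i <;> fin_cases j <;> simp <;> norm_num

theorem matH_mul_matX : matH * matX = matZ * matH := by
  rw [matH, matX, matZ, smul_mul_assoc, mul_smul_comm]
  simp

theorem matH_mul_matZ : matH * matZ = matX * matH := by
  rw [matH, matX, matZ, smul_mul_assoc, mul_smul_comm]
  simp

theorem matS_unitary : matSᴴ * matS = 1 := by
  ext i j
  fin_cases i <;> fin_cases j <;> simp [matS, Matrix.mul_apply, Matrix.conjTranspose_apply]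

theorem matS_mul_matX : matS * matX = matY * matS := by
  ext i j
  fin_cases i <;> fin_cases j <;> simp [matS, matX, matY, Matrix.mul_apply]

theorem matS_mul_matZ : matS * matZ = matZ * matS := by
  ext i j
  fin_cases i <;> fin_cases j <;> simp [matS, matZ, Matrix.mul_apply]

theorem onQubit_unitary (i : Fin n) {A : Matrix (Fin 2) (Fin 2) ℂ} (h : Aᴴ * A = 1) :
    (onQubit i A)ᴴ * onQubit i A = 1 := by
  rw [onQubit_conjTranspose, onQubit_mul, h, onQubit_one]

theorem onQubit_semiconj (i : Fin n) {A B C : Matrix (Fin 2) (Fin 2) ℂ} (h : A * B = C * A) :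
    onQubit i A * onQubit i B = onQubit i C * onQubit i A := by
  rw [onQubit_mul, onQubit_mul, h]

theorem tableFor_hadTable (i : Fin n) :
    (onQubit i matH)ᴴ * onQubit i matH = 1 ∧
    TableFor (hadTable (List.replicate n true) (List.replicate i true)) (onQubit i matH) := by
  have hV := onQubit_unitary i (A := matH) (by rw [matH_conjTranspose, matH_mul_self])
  refine ⟨hV, by simp [hadTable, tableFor_identTable.1], fun j => ?_⟩
  obtain ⟨im, h1, h2, h3, h4, h5⟩ := identTable_entry j
  by_cases h : i = j
  · subst h
    refine ⟨(im.2, im.1), by simp [hadTable, h1], h3, h2, ?_, ?_⟩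
    · rw [h5]; exact conj_of_semiconj hV (onQubit_semiconj i matH_mul_matX)
    · rw [h4]; exact conj_of_semiconj hV (onQubit_semiconj i matH_mul_matZ)
  · refine ⟨im, ?_, h2, h3, ?_, ?_⟩
    · simp [hadTable, h1, Fin.val_inj, h]
    · rw [h4]; exact conj_of_commute hV (onQubit_commute h _ _)
    · rw [h5]; exact conj_of_commute hV (onQubit_commute h _ _)

theorem tableFor_phaseTable (i : Fin n) :
    (onQubit i matS)ᴴ * onQubit i matS = 1 ∧
    TableFor (phaseTable (List.replicate n true) (List.replicate i true)) (onQubit i matS) := by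
  have hV := onQubit_unitary i matS_unitary
  refine ⟨hV, by simp [phaseTable, tableFor_identTable.1], fun j => ?_⟩
  obtain ⟨im, h1, h2, h3, h4, h5⟩ := identTable_entry j
  by_cases h : i = j
  · subst h
    refine ⟨(mulI (mulRow (im.1, im.2)), im.2), by simp [phaseTable, h1],
      length_mulRow h2 h3, h3, ?_, ?_⟩
    · rw [rowOp_mulI, rowOp_mulRow h2 h3, h4, h5, ← onQubit_matY]
      exact conj_of_semiconj hV (onQubit_semiconj i matS_mul_matX)
    · rw [h5]; exact conj_of_semiconj hV (onQubit_semiconj i matS_mul_matZ)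
  · refine ⟨im, ?_, h2, h3, ?_, ?_⟩
    · simp [phaseTable, h1, Fin.val_inj, h]
    · rw [h4]; exact conj_of_commute hV (onQubit_commute h _ _)
    · rw [h5]; exact conj_of_commute hV (onQubit_commute h _ _)

/-! ### The CNOT gate, by ring identities for controlled operations -/

section cnot

/-- Abstract form of the rule for `X_c`: the two projections `p`, `q` of the control are exchanged
by `X`, so moving `X` through `p + q * x` shifts the factor `x` to the other summand, and `x * x =
1` restores the form. -/
theorem controlled_mul_flip {R : Type*} [Ring R] {p q x X : R} (h1 : p * X = X * q)
    (h2 : q * X = X * p) (h3 : p * x = x * p) (h4 : q * x = x * q) (h5 : X * x = x * X)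
    (h6 : x * x = 1) : (p + q * x) * X = X * x * (p + q * x) := by
  have e1 : q * x * X = X * p * x := by rw [mul_assoc, ← h5, ← mul_assoc, h2]
  have e2 : X * x * p = X * p * x := by rw [mul_assoc, ← h3, mul_assoc]
  have e3 : X * x * (q * x) = X * q := by
    rw [h4, mul_assoc, ← mul_assoc x x, h6, one_mul]
  rw [add_mul, mul_add, h1, e1, e2, e3, add_comm]

/-- Abstract form of the rule for `Z_t`: moving `z` past `x` produces a sign on the summand with `q`
only, and this is the sign with which `Z` acts there. -/
theorem controlled_mul_sign {R : Type*} [Ring R] {p q x z Z : R} (h1 : Z * p = p)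
    (h2 : Z * q = -q) (h3 : p * z = z * p) (h4 : q * z = z * q) (h5 : Z * z = z * Z)
    (h6 : x * z = -(z * x)) : (p + q * x) * z = Z * z * (p + q * x) := by
  have e1 : q * x * z = -(z * (q * x)) := by
    rw [mul_assoc, h6, mul_neg, ← mul_assoc, h4, mul_assoc]
  have e2 : Z * z * p = z * p := by rw [h5, mul_assoc, h1]
  have e3 : Z * z * (q * x) = -(z * (q * x)) := by
    rw [h5, mul_assoc, ← mul_assoc Z, h2, neg_mul, mul_neg]
  rw [add_mul, mul_add, h3, e1, e2, e3]

theorem controlled_mul_self {R : Type*} [Ring R] {p q x : R} (h1 : p * p = p) (h2 : q * q = q)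
    (h3 : p * q = 0) (h4 : q * p = 0) (h5 : p + q = 1) (h6 : p * x = x * p) (h7 : q * x = x * q)
    (h8 : x * x = 1) : (p + q * x) * (p + q * x) = 1 := by
  have e1 : q * x * p = 0 := by rw [mul_assoc, ← h6, ← mul_assoc, h4, zero_mul]
  have e2 : q * x * (q * x) = q := by
    rw [mul_assoc, ← mul_assoc x, ← h7, mul_assoc q x x, h8, mul_one, h2]
  rw [add_mul, mul_add, mul_add, h1, ← mul_assoc p, h3, e1, e2, zero_mul, add_zero, zero_add, h5]

variable {c t : Fin n}

theorem matX_mul_self : matX * matX = 1 := by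
  ext i j
  fin_cases i <;> fin_cases j <;> simp [matX, Matrix.mul_apply]

theorem onQubit_matX_mul_self (t : Fin n) : onQubit t matX * onQubit t matX = 1 := by
  rw [onQubit_mul, matX_mul_self, onQubit_one]

theorem cnotOp_unitary (h : c ≠ t) : (cnotOp c t)ᴴ * cnotOp c t = 1 := by
  have hX : matXᴴ = matX := by
    ext i j
    fin_cases i <;> fin_cases j <;> simp [matX, Matrix.conjTranspose_apply]
  have e : (cnotOp c t)ᴴ = cnotOp c t := by
    rw [cnotOp, Matrix.conjTranspose_add, Matrix.conjTranspose_mul, onQubit_conjTranspose,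
      onQubit_conjTranspose, onQubit_conjTranspose, hX, (onQubit_commute h _ _).eq]
    congr 2
    · ext i j
      fin_cases i <;> fin_cases j <;> simp [Matrix.conjTranspose_apply]
    · congr 1
      ext i j
      fin_cases i <;> fin_cases j <;> simp [Matrix.conjTranspose_apply]
  rw [e, cnotOp]
  refine controlled_mul_self ?_ ?_ ?_ ?_ ?_ (onQubit_commute h _ _).eq (onQubit_commute h _ _).eq
    (onQubit_matX_mul_self t)
  · rw [onQubit_mul]; congr 1; ext i j; fin_cases i <;> fin_cases j <;> simp
  · rw [onQubit_mul]; congr 1; ext i j; fin_cases i <;> fin_cases j <;> simp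
  · rw [onQubit_mul, ← onQubit_zero c]; congr 1; ext i j; fin_cases i <;> fin_cases j <;> simp
  · rw [onQubit_mul, ← onQubit_zero c]; congr 1; ext i j; fin_cases i <;> fin_cases j <;> simp
  · rw [← onQubit_add, ← onQubit_one c]; congr 1
    ext i j; fin_cases i <;> fin_cases j <;> simp

theorem cnotOp_mul_matX (h : c ≠ t) :
    cnotOp c t * onQubit c matX = onQubit c matX * onQubit t matX * cnotOp c t := by
  rw [cnotOp]
  refine controlled_mul_flip ?_ ?_
    (onQubit_commute h _ _).eq (onQubit_commute h _ _).eq (onQubit_commute h _ _).eq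
    (onQubit_matX_mul_self t)
  · rw [onQubit_mul, onQubit_mul]; congr 1
    ext i j; fin_cases i <;> fin_cases j <;> simp [matX, Matrix.mul_apply]
  · rw [onQubit_mul, onQubit_mul]; congr 1
    ext i j; fin_cases i <;> fin_cases j <;> simp [matX, Matrix.mul_apply]

theorem cnotOp_mul_matZ (h : c ≠ t) :
    cnotOp c t * onQubit t matZ = onQubit c matZ * onQubit t matZ * cnotOp c t := by
  rw [cnotOp]
  refine controlled_mul_sign ?_ ?_ (onQubit_commute h _ _).eq (onQubit_commute h _ _).eq
    (onQubit_commute h _ _).eq ?_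
  · rw [onQubit_mul]; congr 1
    ext i j; fin_cases i <;> fin_cases j <;> simp [matZ, Matrix.mul_apply]
  · rw [onQubit_mul, ← neg_one_smul ℂ, ← onQubit_smul]; congr 1
    ext i j; fin_cases i <;> fin_cases j <;> simp [matZ, Matrix.mul_apply]
  · rw [onQubit_mul, onQubit_mul, ← neg_one_smul ℂ, ← onQubit_smul]; congr 1
    ext i j; fin_cases i <;> fin_cases j <;> simp [matX, matZ, Matrix.mul_apply]

theorem cnotOp_commute {A : Op n} (h1 : ∀ B, Commute (onQubit c B) A)
    (h2 : Commute (onQubit t matX) A) : Commute (cnotOp c t) A :=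
  (h1 _).add_left ((h1 _).mul_left h2)

theorem tableFor_cnotTable (h : c ≠ t) :
    (cnotOp c t)ᴴ * cnotOp c t = 1 ∧
    TableFor (cnotTable (List.replicate n true) (List.replicate c true) (List.replicate t true))
      (cnotOp c t) := by
  have hV := cnotOp_unitary h
  refine ⟨hV, by simp [cnotTable, tableFor_identTable.1], fun j => ?_⟩
  obtain ⟨im, h1, h2, h3, h4, h5⟩ := identTable_entry j
  obtain ⟨ic, c1, c2, c3, c4, c5⟩ := identTable_entry c
  obtain ⟨it, t1, t2, t3, t4, t5⟩ := identTable_entry t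
  have ec : entryAt (identTable (List.replicate n true), List.replicate c true) = ic := by
    simp [entryAt, List.headD_eq_head?_getD, c1]
  have et : entryAt (identTable (List.replicate n true), List.replicate t true) = it := by
    simp [entryAt, List.headD_eq_head?_getD, t1]
  by_cases hc : c = j
  · subst hc
    obtain rfl : ic = im := by simpa [h1] using c1.symm
    refine ⟨(mulRow (ic.1, it.1), ic.2), ?_, length_mulRow h2 t2, h3, ?_, ?_⟩
    · simp [cnotTable, c1, Fin.val_inj, et, h.symm]
    · rw [rowOp_mulRow h2 t2, h4, t4]
      exact conj_of_semiconj hV (cnotOp_mul_matX h)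
    · rw [h5]
      refine conj_of_commute hV (Commute.add_left (onQubit_semiconj c ?_)
        (Commute.mul_left (onQubit_semiconj c ?_) (onQubit_commute h _ _).symm))
      · ext i j; fin_cases i <;> fin_cases j <;> simp [matZ, Matrix.mul_apply]
      · ext i j; fin_cases i <;> fin_cases j <;> simp [matZ, Matrix.mul_apply]
  · by_cases ht : t = j
    · subst ht
      obtain rfl : it = im := by simpa [h1] using t1.symm
      refine ⟨(it.1, mulRow (ic.2, it.2)), ?_, h2, length_mulRow c3 h3, ?_, ?_⟩
      · simp [cnotTable, t1, Fin.val_inj, ec, h]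
      · rw [h4]
        exact conj_of_commute hV (cnotOp_commute (fun B => onQubit_commute h _ _) (Commute.refl _))
      · rw [rowOp_mulRow c3 h3, h5, c5]
        exact conj_of_semiconj hV (cnotOp_mul_matZ h)
    · refine ⟨im, ?_, h2, h3, ?_, ?_⟩
      · simp [cnotTable, h1, Fin.val_inj, hc, ht]
      · rw [h4]
        exact conj_of_commute hV (cnotOp_commute (fun B => onQubit_commute hc _ _)
          (onQubit_commute ht _ _))
      · rw [h5]
        exact conj_of_commute hV (cnotOp_commute (fun B => onQubit_commute hc _ _)
          (onQubit_commute ht _ _))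

end cnot

end GK

namespace GK

/-! ### Reading the description of a circuit -/

variable {n : ℕ}

theorem readUnary_encodeNat (m : ℕ) (w : List Bool) :
    readUnary (encodeNat m ++ w) = (List.replicate m true, w) := by
  have h1 : ∀ (m : ℕ) (l : List Bool), (List.replicate m true).foldl
      (fun c b => readUnaryStep b c) (false, l, []) = (false, List.replicate m true ++ l, []) := by
    intro m
    induction m with
    | zero => intro l; rfl
    | succ m ih =>
      intro l
      rw [List.replicate_succ, List.foldl_cons]
      change List.foldl _ (false, true :: l, []) _ = _
      rw [ih, ← List.singleton_append, ← List.append_assoc, ← List.replicate_succ',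
        List.replicate_succ]
  have h2 : ∀ (w l l' : List Bool), w.foldl (fun c b => readUnaryStep b c) (true, l, l') =
      (true, l, w.reverse ++ l') := by
    intro w
    induction w with
    | nil => intro l l'; rfl
    | cons b w ih =>
      intro l l'
      rw [List.foldl_cons]
      change List.foldl _ (true, l, b :: l') _ = _
      rw [ih]; simp
  have h3 : (encodeNat m ++ w).foldl (fun c b => readUnaryStep b c) (false, [], []) =
      (true, List.replicate m true, w.reverse) := by
    rw [encodeNat, List.foldl_append, List.foldl_append, h1, List.foldl_cons, List.foldl_nil]
    change List.foldl _ (true, List.replicate m true ++ [], []) _ = _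
    rw [h2]; simp
  rw [readUnary, h3]; simp

def Letter.bits : Letter → Bool × Bool
  | .I => (false, false)
  | .X => (true, false)
  | .Y => (true, true)
  | .Z => (false, true)

def phaseBits : Fin 4 → Bool × Bool
  | 0 => (false, false)
  | 1 => (false, true)
  | 2 => (true, false)
  | 3 => (true, true)

/-- The row of a Pauli product. -/
def Pauli.row (P : Pauli n) : Row := (phaseBits P.phase, List.ofFn fun i => (P.letter i).bits)

theorem Letter.encode_eq (l : Letter) : l.encode = [l.bits.1, l.bits.2] := by
  cases l <;> rfl

theorem encodePhase_eq (p : Fin 4) : encodePhase p = [(phaseBits p).1, (phaseBits p).2] := by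
  fin_cases p <;> rfl

theorem phaseValue_phaseBits (p : Fin 4) : phaseValue (phaseBits p) = Complex.I ^ (p : ℕ) := by
  fin_cases p <;> simp [phaseValue, phaseBits]

theorem letterMatrix_bits (l : Letter) : letterMatrix l.bits = l.toMatrix := by
  cases l <;> rfl

theorem rowOp_row (P : Pauli n) : rowOp n P.row = P.toOp := by
  simp only [rowOp, Pauli.row, getD_ofFn, Pauli.toOp, phaseValue_phaseBits, letterMatrix_bits]

theorem readLetters_flatten (l : List Bool) (L : List Letter) (h : l.length = L.length)
    (w : List Bool) :
    readLetters (l, (L.map Letter.encode).flatten ++ w) = ((L.map Letter.bits).reverse, w) := by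
  have key : ∀ (L : List Letter) (l : List Bool) (out : List (Bool × Bool)), l.length = L.length →
      l.foldl (fun c _ => ((readPair c.2).1 :: c.1, (readPair c.2).2))
        (out, (L.map Letter.encode).flatten ++ w) = ((L.map Letter.bits).reverse ++ out, w) := by
    intro L
    induction L with
    | nil =>
      intro l out hl
      obtain rfl := List.length_eq_zero_iff.mp hl
      rfl
    | cons a L ih =>
      intro l out hl
      cases l with
      | nil => simp at hl
      | cons b l =>
        have := ih l (a.bits :: out) (by simpa using hl)
        simpa [Letter.encode_eq, readPair] using this
  simpa [readLetters] using key L l [] h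

theorem readRow_encode {N : List Bool} (hN : N.length = n) (P : Pauli n) (w : List Bool) :
    readRow (N, P.encode ++ w) = (P.row, w) := by
  have e : P.encode ++ w = (phaseBits P.phase).1 :: (phaseBits P.phase).2 ::
      (((List.ofFn P.letter).map Letter.encode).flatten ++ w) := by
    simp [Pauli.encode, encodePhase_eq, List.map_ofFn, Function.comp_def]
  have h := readLetters_flatten N (List.ofFn P.letter) (by simp [hN]) w
  rw [readRow, e]
  simp only [readPair, List.tail_cons, List.headD_cons]
  rw [h]
  simp [Pauli.row, List.map_ofFn, Function.comp_def]

theorem readTable_encode (imX imZ : Fin n → Pauli n) (w : List Bool) :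
    readTable (List.replicate n true,
      (List.ofFn fun j => (imX j).encode ++ (imZ j).encode).flatten ++ w) =
    ((List.ofFn fun j => ((imX j).row, (imZ j).row)).reverse, w) := by
  have hN : (List.replicate n true).length = n := by simp
  generalize List.replicate n true = N at hN
  have key : ∀ (L : List (Fin n)) (l : List Bool) (out : Table), l.length = L.length →
      l.foldl (fun c _ => (((readRow (N, c.2)).1, (readRow (N, (readRow (N, c.2)).2)).1) :: c.1,
        (readRow (N, (readRow (N, c.2)).2)).2))
        (out, (L.map fun j => (imX j).encode ++ (imZ j).encode).flatten ++ w) =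
      ((L.map fun j => ((imX j).row, (imZ j).row)).reverse ++ out, w) := by
    intro L
    induction L with
    | nil =>
      intro l out hl
      obtain rfl := List.length_eq_zero_iff.mp hl
      rfl
    | cons a L ih =>
      intro l out hl
      cases l with
      | nil => simp at hl
      | cons b l =>
        have := ih l (((imX a).row, (imZ a).row) :: out) (by simpa using hl)
        rw [List.foldl_cons, List.map_cons, List.flatten_cons, List.append_assoc,
          List.append_assoc]
        simp only [readRow_encode hN]
        rw [this]
        simp
  have := key (List.finRange n) N [] (by simp [hN])
  rw [List.append_nil] at this
  simpa only [readTable, List.ofFn_eq_map] using this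

/-- For a gate that is given by a table nothing has to be computed: the listed images are what
`TableFor` asks for, and the unitary itself, known only up to a phase, is never reconstructed. -/
theorem readGate_encode (g : Gate n) {V : Op n} (hg : g.Denotes V) (w : List Bool) :
    Vᴴ * V = 1 ∧ ∃ T, readGate (List.replicate n true, g.encode ++ w) = (T, w) ∧ TableFor T V := by
  cases g with
  | had i =>
    obtain rfl : V = onQubit i matH := hg
    refine ⟨(tableFor_hadTable i).1, _, ?_, (tableFor_hadTable i).2⟩
    simp [readGate, Gate.encode, readPair, readUnary_encodeNat]
  | phase i =>
    obtain rfl : V = onQubit i matS := hg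
    refine ⟨(tableFor_phaseTable i).1, _, ?_, (tableFor_phaseTable i).2⟩
    simp [readGate, Gate.encode, readPair, readUnary_encodeNat]
  | cnot c t h =>
    obtain rfl : V = cnotOp c t := hg
    refine ⟨(tableFor_cnotTable h).1, _, ?_, (tableFor_cnotTable h).2⟩
    simp [readGate, Gate.encode, readPair, readUnary_encodeNat]
  | table imX imZ =>
    obtain ⟨hV, hT⟩ := hg
    refine ⟨Matrix.mem_unitaryGroup_iff'.mp hV.1,
      List.ofFn fun j => ((imX j).row, (imZ j).row), ?_, by simp, fun j => ?_⟩
    · have := readTable_encode imX imZ w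
      simp [readGate, Gate.encode, readPair, this]
    · refine ⟨((imX j).row, (imZ j).row), by simp, by simp [Pauli.row], by simp [Pauli.row], ?_⟩
      rw [rowOp_row, rowOp_row]
      exact hT j

theorem foldl_gateStep_of_head_false (l : List Bool) (N w : List Bool) (rows : List Row) :
    l.foldl (fun c _ => gateStep N c) (false :: w, rows) = (false :: w, rows) := by
  induction l with
  | nil => rfl
  | cons b l ih => exact ih

/-- The rows of `rows'` describe the conjugates by `U` of the operators in `rows`. -/
def ConjugateRows (U : Op n) (rows rows' : List Row) : Prop :=
  List.Forall₂ (fun r r' => r'.2.length = n ∧ rowOp n r' = U * rowOp n r * Uᴴ) rows rows'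

/-- The list `l` is a clock with at least one tick per gate; surplus ticks meet the end marker and
change nothing. -/
theorem foldl_gateStep_encode (C : List (Gate n)) {U : Op n} (hU : CircuitDenotes C U)
    (rows : List Row) (hrows : ∀ r ∈ rows, r.2.length = n) (l : List Bool)
    (hl : C.length ≤ l.length) :
    Uᴴ * U = 1 ∧ ConjugateRows U rows (l.foldl (fun c _ => gateStep (List.replicate n true) c)
      ((C.map fun g => true :: g.encode).flatten ++ [false], rows)).2 := by
  induction C generalizing U rows l with
  | nil =>
    obtain rfl : U = 1 := hU
    refine ⟨by simp, ?_⟩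
    have := foldl_gateStep_of_head_false l (List.replicate n true) [] rows
    simp only [List.map_nil, List.flatten_nil, List.nil_append]
    rw [this]
    simp only [ConjugateRows, Matrix.one_mul, Matrix.conjTranspose_one, Matrix.mul_one]
    exact List.forall₂_same.mpr fun r hr => ⟨hrows r hr, rfl⟩
  | cons g C ih =>
    obtain ⟨V, W, hV, hW, rfl⟩ := hU
    cases l with
    | nil => simp at hl
    | cons b l =>
      obtain ⟨hV1, T, hT, hTV⟩ := readGate_encode g hV
        ((C.map fun g => true :: g.encode).flatten ++ [false])
      have e : gateStep (List.replicate n true)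
          (((g :: C).map fun g => true :: g.encode).flatten ++ [false], rows) =
          ((C.map fun g => true :: g.encode).flatten ++ [false],
            rows.map fun r => applyTable (T, r)) := by
        simp [gateStep, hT]
      obtain ⟨hW1, h2⟩ := ih hW (rows.map fun r => applyTable (T, r)) (by
        intro r hr
        obtain ⟨r', hr', rfl⟩ := List.mem_map.mp hr
        exact (rowOp_applyTable hV1 hTV (hrows r' hr')).1) l (by simpa using hl)
      refine ⟨?_, ?_⟩
      · rw [Matrix.conjTranspose_mul, Matrix.mul_assoc, ← Matrix.mul_assoc Wᴴ, hW1,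
          Matrix.one_mul, hV1]
      · rw [List.foldl_cons, e]
        rw [ConjugateRows, List.forall₂_map_left_iff] at h2
        -- The relation is strengthened by membership in `rows`, which provides the row length
        -- needed for the action of the first gate.
        refine List.Forall₂.imp (fun r r' hr => ?_) (List.forall₂_iff_zip.mpr
          ⟨h2.length_eq, fun {a b} hab => And.intro (List.of_mem_zip hab).1
            ((List.forall₂_iff_zip.mp h2).2 hab)⟩)
        refine ⟨hr.2.1, ?_⟩
        rw [hr.2.2, (rowOp_applyTable hV1 hTV (hrows r hr.1)).2, Matrix.conjTranspose_mul]
        simp only [Matrix.mul_assoc]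

theorem applyGates_encode (C : List (Gate n)) {U : Op n} (hU : CircuitDenotes C U)
    (rows : List Row) (hrows : ∀ r ∈ rows, r.2.length = n) :
    Uᴴ * U = 1 ∧ ConjugateRows U rows (applyGates (List.replicate n true,
      (C.map fun g => true :: g.encode).flatten ++ [false], rows)) := by
  -- The clock is the encoded description itself, which contains at least one bit for each gate.
  refine foldl_gateStep_encode C hU rows hrows _ ?_
  rw [List.length_append, List.length_flatten, List.map_map]
  have : ∀ C : List (Gate n), C.length ≤
      (C.map (List.length ∘ fun g => true :: g.encode)).sum := by
    intro C
    induction C with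
    | nil => simp
    | cons g C ih => simp; omega
  exact (this C).trans (Nat.le_add_right _ _)

end GK

namespace GK

/-! ### Correctness of the elimination -/

variable {n : ℕ}

/-- The product of the projectors `(1 + A) / 2`. -/
noncomputable def projList (rows : List Row) : Op n :=
  (rows.map fun r => (1 / 2 : ℂ) • (1 + rowOp n r)).prod

/-- The rows describe commuting involutions on `n` qubits. -/
def StabRows (n : ℕ) (rows : List Row) : Prop :=
  ∀ r ∈ rows, r.2.length = n ∧ rowOp n r * rowOp n r = 1 ∧
    ∀ r' ∈ rows, Commute (rowOp n r) (rowOp n r')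

theorem StabRows.perm {l l' : List Row} (h : StabRows n l) (hp : l.Perm l') : StabRows n l' :=
  fun r hr => by
    obtain ⟨h1, h2, h3⟩ := h r (hp.mem_iff.mpr hr)
    exact ⟨h1, h2, fun r' hr' => h3 r' (hp.mem_iff.mpr hr')⟩

theorem StabRows.of_cons {r : Row} {l : List Row} (h : StabRows n (r :: l)) : StabRows n l :=
  fun r' hr' => by
    obtain ⟨h1, h2, h3⟩ := h r' (by simp [hr'])
    exact ⟨h1, h2, fun r'' hr'' => h3 r'' (by simp [hr''])⟩

theorem commute_half {A B : Op n} (h : Commute A B) :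
    Commute ((1 / 2 : ℂ) • (1 + A)) ((1 / 2 : ℂ) • (1 + B)) :=
  (((Commute.one_left _).add_left ((Commute.one_right _).add_right h)).smul_left _).smul_right _

theorem projList_perm {l l' : List Row} (h : StabRows n l) (hp : l.Perm l') :
    projList (n := n) l = projList l' := by
  refine (hp.map _).prod_eq' ?_
  rw [List.pairwise_map]
  exact List.pairwise_of_forall_mem_list fun r hr r' hr' => commute_half ((h r hr).2.2 r' hr')

/-- Since `(1 + A) * A = 1 + A`, the operators `A * B` and `B` agree behind the projector of `A`.
This justifies the row operations of the elimination. -/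
theorem half_mul_half {A B : Op n} (h : A * A = 1) :
    (1 / 2 : ℂ) • (1 + A) * ((1 / 2 : ℂ) • (1 + A * B)) =
      (1 / 2 : ℂ) • (1 + A) * ((1 / 2 : ℂ) • (1 + B)) := by
  rw [smul_mul_smul_comm, smul_mul_smul_comm]
  congr 1
  have e : A * (A * B) = B := by rw [← Matrix.mul_assoc, h, Matrix.one_mul]
  simp only [Matrix.add_mul, Matrix.one_mul, Matrix.mul_one, Matrix.mul_add, e]
  abel

/-- One row operation. The product of two commuting involutions is an involution, and it commutes
with everything that both factors commute with. -/
theorem StabRows.mul_second {q r : Row} {l : List Row} (h : StabRows n (q :: r :: l)) :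
    StabRows n (q :: mulRow (q, r) :: l) ∧
      projList (n := n) (q :: mulRow (q, r) :: l) = projList (q :: r :: l) := by
  obtain ⟨q1, q2, q3⟩ := h q (by simp)
  obtain ⟨r1, r2, r3⟩ := h r (by simp)
  have e := rowOp_mulRow q1 r1
  have hc : Commute (rowOp n q) (rowOp n r) := q3 r (by simp)
  have hmul : ∀ s ∈ q :: r :: l, Commute (rowOp n (mulRow (q, r))) (rowOp n s) := fun s hs => by
    rw [e]; exact (q3 s hs).mul_left (r3 s hs)
  have hself : rowOp n (mulRow (q, r)) * rowOp n (mulRow (q, r)) = 1 := by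
    rw [e, hc.symm.mul_mul_mul_comm, q2, r2, Matrix.one_mul]
  have hmem : ∀ s ∈ q :: mulRow (q, r) :: l, s = mulRow (q, r) ∨ s ∈ q :: r :: l := by
    intro s hs
    simp only [List.mem_cons] at hs ⊢
    tauto
  refine ⟨fun s hs => ?_, ?_⟩
  · rcases hmem s hs with rfl | hs
    · refine ⟨length_mulRow q1 r1, hself, fun s' hs' => ?_⟩
      rcases hmem s' hs' with rfl | hs'
      · exact Commute.refl _
      · exact hmul s' hs'
    · obtain ⟨s1, s2, s3⟩ := h s hs
      refine ⟨s1, s2, fun s' hs' => ?_⟩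
      rcases hmem s' hs' with rfl | hs'
      · exact (hmul s hs).symm
      · exact s3 s' hs'
  · simp only [projList, List.map_cons, List.prod_cons]
    rw [← Matrix.mul_assoc, ← Matrix.mul_assoc, e, half_mul_half q2]

/-- The letter of a row at a position. -/
def letterOf (r : Row) (k : ℕ) : Bool × Bool := r.2.getD k (false, false)

theorem letterAt_eq (j : List Bool) (r : Row) : letterAt (j, r) = letterOf r j.length := by
  simp [letterAt, letterOf, List.headD_eq_head?_getD, List.getD]

theorem letterOf_mulRow {q r : Row} (hq : q.2.length = n) (hr : r.2.length = n) (k : ℕ) :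
    letterOf (mulRow (q, r)) k = letterMul (letterOf q k) (letterOf r k) := by
  simp only [letterOf, mulRow, List.getD, List.getElem?_map]
  by_cases hk : k < n
  · have h1 : q.2[k]? = some (q.2[k]'(by omega)) := List.getElem?_eq_getElem _
    have h2 : r.2[k]? = some (r.2[k]'(by omega)) := List.getElem?_eq_getElem _
    have h3 : (q.2.zip r.2)[k]? = some (q.2[k]'(by omega), r.2[k]'(by omega)) :=
      List.getElem?_zip_eq_some.mpr ⟨h1, h2⟩
    rw [h1, h2, h3]
    rfl
  · have h1 : q.2[k]? = none := List.getElem?_eq_none (by omega)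
    have h2 : r.2[k]? = none := List.getElem?_eq_none (by omega)
    have h3 : (q.2.zip r.2)[k]? = none := List.getElem?_eq_none (by simp; omega)
    rw [h1, h2, h3]
    rfl

/-- Tests of letters that are additive. -/
def IsLinear (t : Bool → Bool → Bool) : Prop :=
  ∀ a b : Bool × Bool, t (letterMul a b).1 (letterMul a b).2 = (t a.1 a.2 ^^ t b.1 b.2)

/-- Invariant of a sweep: the pivot, the processed rows and the rows to come together keep the same
product of projectors. By linearity of `t` the product of the pivot and of another row that passes
the test fails it, so the column is cleared. The predicate `Q` carries whatever earlier columns have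
achieved, for either of the two eliminations. -/
theorem foldl_sweepStep_correct {t : Bool → Bool → Bool} (ht : IsLinear t) (j : List Bool)
    {Q : Row → Prop} (hQ : ∀ q r : Row, q.2.length = n → r.2.length = n → Q q → Q r →
      Q (mulRow (q, r))) (l : List Row) (c : Option Row × List Row)
    (h1 : StabRows n (c.1.toList ++ c.2 ++ l)) (h2 : ∀ r ∈ c.1.toList ++ c.2 ++ l, Q r)
    (h3 : ∀ r ∈ c.2, t (letterOf r j.length).1 (letterOf r j.length).2 = false)
    (h4 : ∀ r ∈ c.1, t (letterOf r j.length).1 (letterOf r j.length).2 = true)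
    {c' : Option Row × List Row} (hc' : l.foldl (fun c r => sweepStep t j r c) c = c') :
    StabRows n (c'.1.toList ++ c'.2) ∧ (∀ r ∈ c'.1.toList ++ c'.2, Q r) ∧
    (∀ r ∈ c'.2, t (letterOf r j.length).1 (letterOf r j.length).2 = false) ∧
    (∀ r ∈ c'.1, t (letterOf r j.length).1 (letterOf r j.length).2 = true) ∧
    projList (n := n) (c'.1.toList ++ c'.2) = projList (c.1.toList ++ c.2 ++ l) := by
  induction l generalizing c with
  | nil =>
    subst hc'
    rw [List.append_nil] at *
    exact ⟨h1, h2, h3, h4, rfl⟩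
  | cons r l ih =>
    rw [List.foldl_cons] at hc'
    obtain ⟨p, out⟩ := c
    have hp : (p.toList ++ out ++ r :: l).Perm (p.toList ++ r :: out ++ l) := by
      rw [List.append_assoc, List.append_assoc]
      exact List.Perm.append_left _ List.perm_middle
    cases h : t (letterOf r j.length).1 (letterOf r j.length).2
    · have e : sweepStep t j r (p, out) = (p, r :: out) := by
        rw [sweepStep, letterAt_eq, h]; rfl
      rw [e] at hc'
      have := ih (p, r :: out) (h1.perm hp) (fun s hs => h2 s (hp.mem_iff.mpr hs))
        (by
          intro s hs
          rcases List.mem_cons.mp hs with rfl | hs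
          · exact h
          · exact h3 s hs) h4 hc'
      rwa [projList_perm h1 hp]
    · cases p with
      | none =>
        have e : sweepStep t j r (none, out) = (some r, out) := by
          rw [sweepStep, letterAt_eq, h]; rfl
        rw [e] at hc'
        have := ih (some r, out) (h1.perm hp) (fun s hs => h2 s (hp.mem_iff.mpr hs)) h3
          (by
            intro s hs
            obtain rfl : r = s := by simpa using hs
            exact h) hc'
        rwa [projList_perm h1 hp]
      | some q =>
        have e : sweepStep t j r (some q, out) = (some q, mulRow (q, r) :: out) := by
          rw [sweepStep, letterAt_eq, h]; rfl
        rw [e] at hc'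
        have h5 := h1.perm hp
        obtain ⟨h6, h7⟩ := StabRows.mul_second h5
        have hq := (h5 q (by simp)).1
        have hr := (h5 r (by simp)).1
        have := ih (some q, mulRow (q, r) :: out) h6
          (by
            intro s hs
            have : s = mulRow (q, r) ∨ s ∈ (some q).toList ++ out ++ r :: l := by
              simp only [Option.toList_some, List.cons_append, List.nil_append, List.mem_cons,
                List.mem_append] at hs ⊢
              tauto
            rcases this with rfl | hs
            · exact hQ q r hq hr (h2 q (by simp)) (h2 r (by simp))
            · exact h2 s hs)
          (by
            intro s hs
            rcases List.mem_cons.mp hs with rfl | hs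
            · rw [letterOf_mulRow hq hr, ht, h, h4 q rfl]; rfl
            · exact h3 s hs) h4 hc'
        rw [projList_perm h1 hp]
        exact ⟨this.1, this.2.1, this.2.2.1, this.2.2.2.1, this.2.2.2.2.trans h7⟩

theorem sweep_correct {t : Bool → Bool → Bool} (ht : IsLinear t) (j : List Bool)
    {Q : Row → Prop} (hQ : ∀ q r : Row, q.2.length = n → r.2.length = n → Q q → Q r →
      Q (mulRow (q, r))) {rows : List Row} (h1 : StabRows n rows) (h2 : ∀ r ∈ rows, Q r)
    {c : Option Row × List Row} (hc : sweep t (j, rows) = c) :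
    StabRows n (c.1.toList ++ c.2) ∧ (∀ r ∈ c.1.toList ++ c.2, Q r) ∧
    (∀ r ∈ c.2, t (letterOf r j.length).1 (letterOf r j.length).2 = false) ∧
    (∀ r ∈ c.1, t (letterOf r j.length).1 (letterOf r j.length).2 = true) ∧
    projList (n := n) (c.1.toList ++ c.2) = projList rows :=
  foldl_sweepStep_correct ht j hQ rows (none, []) h1 h2 (by simp) (by simp) hc

/-! The elimination of the `X`-parts -/

theorem rowOp_apply (r : Row) (x y : Fin n → Fin 2) :
    rowOp n r x y = phaseValue r.1 * ∏ i : Fin n, letterMatrix (letterOf r i) (x i) (y i) := rfl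

/-- Operators that do not change the value of the qubit `j`. -/
def Preserves (j : Fin n) (A : Op n) : Prop := ∀ x y, x j ≠ y j → A x y = 0

theorem Preserves.one (j : Fin n) : Preserves j 1 := fun x y h =>
  Matrix.one_apply_ne fun e => h (by rw [e])

theorem Preserves.mul {j : Fin n} {A B : Op n} (hA : Preserves j A) (hB : Preserves j B) :
    Preserves j (A * B) := fun x y h => by
  rw [Matrix.mul_apply]
  refine Finset.sum_eq_zero fun z _ => ?_
  by_cases hz : x j = z j
  · rw [hB z y (by rwa [← hz]), mul_zero]
  · rw [hA x z hz, zero_mul]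

theorem Preserves.half {j : Fin n} {A : Op n} (hA : Preserves j A) :
    Preserves j ((1 / 2 : ℂ) • (1 + A)) := fun x y h => by
  simp [hA x y h, Preserves.one j x y h]

theorem preserves_rowOp {j : Fin n} {r : Row} (h : (letterOf r j).1 = false) :
    Preserves j (rowOp n r) := fun x y hxy => by
  rw [rowOp_apply, Finset.prod_eq_zero (Finset.mem_univ j), mul_zero]
  generalize letterOf r j = l at h ⊢
  obtain ⟨a, b⟩ := l
  obtain rfl : a = false := h
  have : ∀ u v : Fin 2, u ≠ v → letterMatrix (false, b) u v = 0 := by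
    intro u v
    cases b <;> fin_cases u <;> fin_cases v <;> simp [letterMatrix, matZ]
  exact this _ _ hxy

theorem rowOp_apply_eq_zero {j : Fin n} {r : Row} (h : (letterOf r j).1 = true)
    {x y : Fin n → Fin 2} (hxy : x j = y j) : rowOp n r x y = 0 := by
  rw [rowOp_apply, Finset.prod_eq_zero (Finset.mem_univ j), mul_zero]
  generalize letterOf r j = l at h ⊢
  obtain ⟨a, b⟩ := l
  obtain rfl : a = true := h
  rw [hxy]
  generalize y j = u
  cases b <;> fin_cases u <;> simp [letterMatrix, matX, matY]

theorem preserves_projList {j : Fin n} {rows : List Row}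
    (h : ∀ r ∈ rows, (letterOf r j).1 = false) : Preserves j (projList rows) := by
  induction rows with
  | nil => simpa [projList] using Preserves.one j
  | cons r rows ih =>
    rw [projList, List.map_cons, List.prod_cons]
    exact (preserves_rowOp (h r (by simp))).half.mul (ih fun r' hr' => h r' (by simp [hr']))

/-- The pivot flips qubit `j`, while the other projectors preserve it. Hence the pivot times the
rest has zero diagonal, and of `(1 + q)/2` only the factor 1/2 remains. -/
theorem projList_pivot_apply {j : Fin n} {q : Row} {rows : List Row}
    (hq : (letterOf q j).1 = true) (h : ∀ r ∈ rows, (letterOf r j).1 = false)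
    (x : Fin n → Fin 2) : projList (n := n) (q :: rows) x x = 1 / 2 * projList rows x x := by
  have e : (rowOp n q * projList rows : Op n) x x = 0 := by
    rw [Matrix.mul_apply]
    refine Finset.sum_eq_zero fun z _ => ?_
    by_cases hz : x j = z j
    · rw [rowOp_apply_eq_zero hq hz, zero_mul]
    · rw [preserves_projList h z x (Ne.symm hz), mul_zero]
  have e2 : projList (n := n) (q :: rows) = (1 / 2 : ℂ) • (projList rows +
      rowOp n q * projList rows) := by
    rw [projList, List.map_cons, List.prod_cons, smul_mul_assoc, Matrix.add_mul, Matrix.one_mul]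
    rfl
  rw [e2, Matrix.smul_apply, Matrix.add_apply, e, add_zero, smul_eq_mul]

theorem isLinear_fst : IsLinear fun x _ => x := fun _ _ => rfl

theorem isLinear_snd : IsLinear fun _ z => z := fun _ _ => rfl

/-- After the elimination of the `X`-parts, all rows are diagonal, and the diagonal of the product of
the projectors has changed by a constant factor only. -/
theorem foldl_elimStep_fst (l : List Bool) (c : List Bool × List Row × List (Option (Bool × List Bool)))
    (hl : c.1.length + l.length = n) (h1 : StabRows n c.2.1)
    (h2 : ∀ r ∈ c.2.1, ∀ k < c.1.length, (letterOf r k).1 = false) :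
    StabRows n (l.foldl (fun c _ => elimStep (fun x _ => x) c) c).2.1 ∧
    (∀ r ∈ (l.foldl (fun c _ => elimStep (fun x _ => x) c) c).2.1, ∀ k < n,
      (letterOf r k).1 = false) ∧
    ∃ κ : ℂ, ∀ x, projList (n := n) c.2.1 x x =
      κ * projList (l.foldl (fun c _ => elimStep (fun x _ => x) c) c).2.1 x x := by
  induction l generalizing c with
  | nil =>
    refine ⟨h1, fun r hr k hk => h2 r hr k ?_, 1, by simp⟩
    simp at hl
    omega
  | cons b l ih =>
    rw [List.foldl_cons]
    obtain ⟨e1, e2, e3, e4, e5⟩ := sweep_correct isLinear_fst c.1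
      (Q := fun r => ∀ k < c.1.length, (letterOf r k).1 = false)
      (fun q r hq hr h h' k hk => by
        rw [letterOf_mulRow hq hr, letterMul, h k hk, h' k hk]; rfl) h1 h2 rfl
    have hj : c.1.length < n := by simp at hl; omega
    have f1 : ∀ r ∈ (sweep (fun x _ => x) (c.1, c.2.1)).2, ∀ k < c.1.length + 1,
        (letterOf r k).1 = false := by
      intro r hr k hk
      rcases Nat.lt_succ_iff_lt_or_eq.mp hk with hk | rfl
      · exact e2 r (by simp [hr]) k hk
      · exact e3 r hr
    have f2 : StabRows n (sweep (fun x _ => x) (c.1, c.2.1)).2 := by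
      cases e : (sweep (fun x _ => x) (c.1, c.2.1)).1 with
      | none => simpa [e] using e1
      | some q =>
        rw [e] at e1
        exact StabRows.of_cons e1
    obtain ⟨g1, g2, κ, g3⟩ := ih (elimStep (fun x _ => x) c) (by simp [elimStep] at hl ⊢; omega)
      f2 f1
    refine ⟨g1, g2, ?_⟩
    -- The constant collects a factor 1/2 for each pivot; its value is never needed.
    cases e : (sweep (fun x _ => x) (c.1, c.2.1)).1 with
    | none =>
      refine ⟨κ, fun x => ?_⟩
      rw [← g3 x, ← e5, e]
      rfl
    | some q =>
      refine ⟨1 / 2 * κ, fun x => ?_⟩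
      rw [mul_assoc, ← g3 x, ← e5, e]
      exact projList_pivot_apply (j := ⟨c.1.length, hj⟩) (e4 q e) e3 x

end GK

namespace GK

/-! The elimination of the `Z`-parts -/

variable {n : ℕ}

/-- The sign `(-1)ᵇ`. -/
def boolSign (b : Bool) : ℂ := if b then -1 else 1

theorem boolSign_xor (a b : Bool) : boolSign (a ^^ b) = boolSign a * boolSign b := by
  cases a <;> cases b <;> simp [boolSign]

theorem boolSign_dotAdd (l : List (Bool × Bool)) (b : Bool) :
    boolSign (l.foldl (fun c b => c ^^ (b.1 && b.2)) b) =
      boolSign b * (l.map fun b => boolSign (b.1 && b.2)).prod := by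
  induction l generalizing b with
  | nil => simp
  | cons a l ih => rw [List.foldl_cons, ih, boolSign_xor, List.map_cons, List.prod_cons, mul_assoc]

theorem dotAdd_cons (b z x : Bool) (Z X : List Bool) :
    dotAdd (b, z :: Z, x :: X) = dotAdd (b ^^ (z && x), Z, X) := rfl

theorem dotAdd_xor (b c : Bool) (Z X : List Bool) :
    dotAdd (b ^^ c, Z, X) = (c ^^ dotAdd (b, Z, X)) := by
  induction Z generalizing b X with
  | nil => exact Bool.xor_comm b c
  | cons z Z ih =>
    cases X with
    | nil => exact Bool.xor_comm b c
    | cons x X =>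
      rw [dotAdd_cons, dotAdd_cons, ← ih]
      congr 2
      cases b <;> cases c <;> cases z <;> cases x <;> rfl

theorem dotAdd_drop (b : Bool) (k : ℕ) (Z X : List Bool) (h : ∀ i < k, Z.getD i false = false) :
    dotAdd (b, Z, X) = dotAdd (b, Z.drop k, X.drop k) := by
  induction k generalizing Z X with
  | zero => rfl
  | succ k ih =>
    cases Z with
    | nil => simp [dotAdd]
    | cons z Z =>
      cases X with
      | nil => simp [dotAdd]
      | cons x X =>
        obtain rfl : z = false := h 0 (by omega)
        rw [dotAdd_cons, List.drop_succ_cons, List.drop_succ_cons, Bool.false_and, Bool.xor_false]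
        exact ih Z X fun i hi => h (i + 1) (by omega)

/-- A phase `±i` would have square `-1`, so the low bit of the exponent vanishes and the high bit is
the sign. -/
theorem phaseValue_of_sq {p : Bool × Bool} (h : phaseValue p * phaseValue p = 1) :
    phaseValue p = boolSign p.1 := by
  obtain ⟨a, b⟩ := p
  cases b
  · cases a <;> simp [phaseValue, boolSign]
  · exfalso
    have e : ∀ a, phaseValue (a, true) * phaseValue (a, true) = -1 := by
      intro a
      cases a <;> simp [phaseValue, pow_succ]
    rw [e] at h
    norm_num at h

theorem rowOp_diagonal {r : Row} (h1 : r.2.length = n) (h2 : rowOp n r * rowOp n r = 1)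
    (h3 : ∀ k < n, (letterOf r k).1 = false) :
    rowOp n r = Matrix.diagonal fun x =>
      boolSign (dotAdd (r.1.1, r.2.map fun l => l.2, outcomeWord x)) := by
  have hd : ∀ x, rowOp n r x x = phaseValue r.1 * ∏ i : Fin n,
      boolSign ((letterOf r i).2 && decide (x i = 1)) := by
    intro x
    rw [rowOp_apply]
    congr 1
    refine Finset.prod_congr rfl fun i _ => ?_
    have := h3 i i.2
    generalize letterOf r i = l at this
    obtain ⟨a, b⟩ := l
    obtain rfl : a = false := this
    generalize x i = u
    cases b <;> fin_cases u <;> simp [letterMatrix, matZ, boolSign]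
  have ho : ∀ x y, x ≠ y → rowOp n r x y = 0 := by
    intro x y hxy
    obtain ⟨j, hj⟩ := Function.ne_iff.mp hxy
    exact preserves_rowOp (h3 j j.2) x y hj
  have hp : phaseValue r.1 = boolSign r.1.1 := by
    refine phaseValue_of_sq ?_
    -- At the all-zero word every letter contributes 1, so this entry of the square is the square of
    -- the phase alone.
    have e := congrFun (congrFun h2 fun _ => 0) fun _ => 0
    rw [Matrix.mul_apply, Finset.sum_eq_single fun _ => 0, hd, Matrix.one_apply_eq] at e
    · simpa [boolSign] using e
    · intro z _ hz
      rw [ho _ _ hz.symm, zero_mul]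
    · simp
  ext x y
  by_cases hxy : x = y
  · subst hxy
    rw [Matrix.diagonal_apply_eq, hd, hp, dotAdd, boolSign_dotAdd]
    congr 1
    obtain ⟨f, hf⟩ := exists_ofFn h1
    simp only [letterOf, hf, outcomeWord, List.map_ofFn]
    rw [zip_ofFn, List.map_ofFn, List.prod_ofFn]
    refine Finset.prod_congr rfl fun i _ => ?_
    rw [getD_ofFn]
    rfl
  · rw [Matrix.diagonal_apply_ne _ hxy, ho x y hxy]

/-- The projector of a diagonal row is the indicator of one parity condition, and diagonal matrices
multiply entrywise. -/
theorem projList_diagonal_apply {rows : List Row} (h : StabRows n rows)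
    (h3 : ∀ r ∈ rows, ∀ k < n, (letterOf r k).1 = false) (x : Fin n → Fin 2) :
    projList rows x x = (rows.map fun r => (1 / 2 : ℂ) *
      (1 + boolSign (dotAdd (r.1.1, r.2.map fun l => l.2, outcomeWord x)))).prod := by
  suffices hd : projList rows = Matrix.diagonal fun x : Fin n → Fin 2 =>
      (rows.map fun r => (1 / 2 : ℂ) *
        (1 + boolSign (dotAdd (r.1.1, r.2.map fun l => l.2, outcomeWord x)))).prod by
    rw [hd, Matrix.diagonal_apply_eq]
  induction rows with
  | nil => exact Matrix.diagonal_one.symm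
  | cons r rows ih =>
    have e := ih h.of_cons fun r' hr' => h3 r' (by simp [hr'])
    rw [projList] at e
    obtain ⟨r1, r2, _⟩ := h r (by simp)
    rw [projList, List.map_cons, List.prod_cons, e, rowOp_diagonal r1 r2 (h3 r (by simp)),
      ← Matrix.diagonal_one, Matrix.diagonal_add, ← Matrix.diagonal_smul, Matrix.diagonal_mul_diagonal]
    rfl

/-- The word solves the system of equations. -/
def Satisfies : List (Option (Bool × List Bool)) → List Bool → Prop
  | [], [] => True
  | e :: es, y :: Y => (∀ q ∈ e, y = dotAdd (q.1, q.2, Y)) ∧ Satisfies es Y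
  | _, _ => False

theorem half_one_add_boolSign (y d : Bool) :
    (1 / 2 : ℂ) * (1 + boolSign (y ^^ d)) = if y = d then 1 else 0 := by
  cases y <;> cases d <;> norm_num [boolSign]

open Classical in
-- When column `k` is swept, all rows have cleared `Z`-parts before `k`, so the pivot gives an
-- equation that expresses outcome `k` through later ones only, while the remaining rows no longer
-- involve `k`. The collected system is therefore triangular, starting with the equation for the
-- first qubit.
theorem foldl_elimStep_snd (l : List Bool)
    (c : List Bool × List Row × List (Option (Bool × List Bool)))
    (hl : c.1.length + l.length = n) (h1 : StabRows n c.2.1)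
    (h2 : ∀ r ∈ c.2.1, ∀ k < n, (letterOf r k).1 = false)
    (h3 : ∀ r ∈ c.2.1, ∀ k < c.1.length, (letterOf r k).2 = false) :
    ∃ es : List (Option (Bool × List Bool)),
      (l.foldl (fun c _ => elimStep (fun _ z => z) c) c).2.2 = es.reverse ++ c.2.2 ∧
      es.length = l.length ∧
      ∃ κ : ℂ, ∀ x, projList (n := n) c.2.1 x x =
        κ * if Satisfies es ((outcomeWord x).drop c.1.length) then 1 else 0 := by
  have getD_map : ∀ (r : Row) (i : ℕ), (r.2.map fun l => l.2).getD i false = (letterOf r i).2 := by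
    intro r i
    simp only [letterOf, List.getD, List.getElem?_map]
    cases r.2[i]? <;> rfl
  induction l generalizing c with
  | nil =>
    -- The rows left at the end have only identity letters; their projectors are constants that do
    -- not depend on `x` and go into `κ`.
    refine ⟨[], rfl, rfl, (c.2.1.map fun r => (1 / 2 : ℂ) * (1 + boolSign r.1.1)).prod, fun x => ?_⟩
    have hn : c.1.length = n := hl
    rw [projList_diagonal_apply h1 h2, hn, List.drop_of_length_le (by simp [outcomeWord]), Satisfies,
      if_pos trivial, mul_one]
    congr 1
    refine List.map_congr_left fun r hr => ?_
    rw [dotAdd_drop _ n, List.drop_of_length_le (by simp [(h1 r hr).1])]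
    · rfl
    · intro i hi
      rw [getD_map]
      exact h3 r hr i (by omega)
  | cons b l ih =>
    rw [List.foldl_cons]
    obtain ⟨e1, e2, e3, e4, e5⟩ := sweep_correct isLinear_snd c.1
      (Q := fun r => (∀ k < n, (letterOf r k).1 = false) ∧
        ∀ k < c.1.length, (letterOf r k).2 = false)
      (fun q r hq hr h h' => by
        refine ⟨fun k hk => ?_, fun k hk => ?_⟩
        · rw [letterOf_mulRow hq hr, letterMul, h.1 k hk, h'.1 k hk]; rfl
        · rw [letterOf_mulRow hq hr, letterMul, h.2 k hk, h'.2 k hk]; rfl)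
      h1 (fun r hr => ⟨h2 r hr, h3 r hr⟩) rfl
    have hj : c.1.length < n := by simp at hl; omega
    have f1 : ∀ r ∈ (sweep (fun _ z => z) (c.1, c.2.1)).2, ∀ k < c.1.length + 1,
        (letterOf r k).2 = false := by
      intro r hr k hk
      rcases Nat.lt_succ_iff_lt_or_eq.mp hk with hk | rfl
      · exact (e2 r (by simp [hr])).2 k hk
      · exact e3 r hr
    have f2 : StabRows n (sweep (fun _ z => z) (c.1, c.2.1)).2 := by
      cases e : (sweep (fun _ z => z) (c.1, c.2.1)).1 with
      | none => simpa [e] using e1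
      | some q =>
        rw [e] at e1
        exact StabRows.of_cons e1
    obtain ⟨es, g1, g2, κ, g3⟩ := ih (elimStep (fun _ z => z) c)
      (by simp [elimStep] at hl ⊢; omega) f2 (fun r hr => (e2 r (by simp [elimStep] at hr; simp [hr])).1) f1
    refine ⟨equation (c.1, (sweep (fun _ z => z) (c.1, c.2.1)).1) :: es, ?_, by simp [g2], κ,
      fun x => ?_⟩
    · rw [g1]
      simp [elimStep]
    · have hx : (outcomeWord x).drop c.1.length =
          decide (x ⟨c.1.length, hj⟩ = 1) :: (outcomeWord x).drop (c.1.length + 1) := by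
        rw [List.drop_eq_getElem_cons (by simpa [outcomeWord] using hj)]
        simp [outcomeWord]
      have g4 : projList (n := n) (sweep (fun _ z => z) (c.1, c.2.1)).2 x x = κ *
          if Satisfies es ((outcomeWord x).drop (c.1.length + 1)) then 1 else 0 := g3 x
      rw [hx, ← e5]
      cases e : (sweep (fun _ z => z) (c.1, c.2.1)).1 with
      | none =>
        simp only [equation, Satisfies]
        simpa using g4
      | some q =>
        rw [e] at e1 e2 e4
        have hq : (letterOf q c.1.length).2 = true := e4 q rfl
        obtain ⟨q1, q2, _⟩ := e1 q (by simp)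
        -- From the pivot column on, the `Z`-parts are the 1 of the pivot followed by the
        -- coefficients of its equation; the earlier ones vanish.
        have hz : (q.2.map fun l => l.2).drop c.1.length =
            true :: ((q.2.drop c.1.length).tail.map fun l => l.2) := by
          rw [← hq, ← getD_map, List.drop_eq_getElem_cons (by simp [q1, hj]),
            List.getD_eq_getElem _ _ (by simp [q1, hj])]
          simp [List.map_drop]
        have g5 := projList_diagonal_apply (rows := q :: (sweep (fun _ z => z) (c.1, c.2.1)).2) e1
          (fun r hr => (e2 r hr).1) x
        rw [List.map_cons, List.prod_cons, ← projList_diagonal_apply f2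
          (fun r hr => (e2 r (by simp [hr])).1), dotAdd_drop _ c.1.length, hz, hx, dotAdd_cons,
          dotAdd_xor, Bool.true_and, half_one_add_boolSign] at g5
        · refine g5.trans ?_
          rw [g4]
          simp only [equation, Satisfies, Option.mem_def, Option.some.injEq, forall_eq', ite_and]
          split_ifs <;> ring
        · intro i hi
          rw [getD_map]
          exact (e2 q (by simp)).2 i hi

open Classical in
/-- The number of solutions found by back substitution from the free bits. -/
theorem exists_card_solve (es : List (Option (Bool × List Bool))) :
    ∃ K : ℕ, ∀ Y : List Bool, Y.length = es.length →
      (∑ c : Fin es.length → Bool,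
        if (es.zip (List.ofFn c)).foldr solveStep [] = Y then 1 else 0) =
        if Satisfies es Y then K else 0 := by
  induction es with
  | nil =>
    refine ⟨1, fun Y hY => ?_⟩
    obtain rfl := List.eq_nil_of_length_eq_zero hY
    simp [Satisfies]
  | cons e es ih =>
    obtain ⟨K, hK⟩ := ih
    -- At a pivot the outcome is forced and both values of the random bit lead to it, which doubles
    -- the number of preimages. In a free column the random bit is the outcome itself.
    refine ⟨if e.isSome then 2 * K else K, fun Y hY => ?_⟩
    cases Y with
    | nil => simp at hY
    | cons y Y =>
      have h := hK Y (by simpa using hY)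
      have hs : ∀ F : (Fin (es.length + 1) → Bool) → ℕ, ∑ c, F c =
          ∑ b : Bool, ∑ c : Fin es.length → Bool, F (Fin.cons b c) := by
        intro F
        rw [← Fintype.sum_prod_type', ← (Fin.consEquiv fun _ => Bool).sum_comp]
        rfl
      rw [List.length_cons, hs]
      simp only [List.ofFn_cons, List.zip_cons_cons, List.foldr_cons]
      cases e with
      | none =>
        simp only [solveStep, List.cons.injEq, Satisfies]
        cases y <;> simp [h, -Finset.sum_boole]
      | some q =>
        simp only [solveStep, List.cons.injEq, Satisfies]
        have : ∀ c : Fin es.length → Bool,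
            (dotAdd (q.1, q.2, (es.zip (List.ofFn c)).foldr solveStep []) = y ∧
              (es.zip (List.ofFn c)).foldr solveStep [] = Y) ↔
            (dotAdd (q.1, q.2, Y) = y ∧ (es.zip (List.ofFn c)).foldr solveStep [] = Y) := by
          intro c
          constructor
          · rintro ⟨h1, h2⟩
            exact ⟨h2 ▸ h1, h2⟩
          · rintro ⟨h1, h2⟩
            exact ⟨h2.symm ▸ h1, h2⟩
        simp only [this]
        by_cases hy : dotAdd (q.1, q.2, Y) = y
        · simp [hy, h, two_mul, -Finset.sum_boole]
        · have : y ≠ dotAdd (q.1, q.2, Y) := fun h => hy h.symm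
          simp [hy, this]

end GK

namespace GK

/-! ### Correctness of the simulation -/

variable {n : ℕ}

/-- The letter and the sign of the Pauli operator that stabilizes the state. -/
def BasisState.stab : BasisState → (Bool × Bool) × Bool
  | .plus => ((true, false), false)
  | .minus => ((true, false), true)
  | .plusI => ((true, true), false)
  | .minusI => ((true, true), true)
  | .zero => ((false, true), false)
  | .one => ((false, true), true)

/-- Each basis state is the eigenvector with eigenvalue 1 of a signed Pauli operator, so its density
is the corresponding spectral projector. -/
theorem BasisState.density_eq (a : BasisState) : a.density =
    (1 / 2 : ℂ) • (1 + (if a.stab.2 then -1 else 1 : ℂ) • letterMatrix a.stab.1) := by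
  have h := sqrt_two_sq
  have hs : (starRingEnd ℂ) ((1 / √2 : ℝ) : ℂ) = ((1 / √2 : ℝ) : ℂ) := Complex.conj_ofReal _
  ext i j
  rw [density, Matrix.vecMulVec_apply]
  cases a <;> simp only [ket] <;> generalize ((1 / √2 : ℝ) : ℂ) = r at * <;>
    fin_cases i <;> fin_cases j <;>
    simp [stab, letterMatrix, matX, matY, matZ, hs] <;>
    first
      | linear_combination h
      | linear_combination -h
      | linear_combination Complex.I * h
      | linear_combination -Complex.I * h
      | linear_combination r * r * Complex.I_mul_I + h
      | linear_combination -r * r * Complex.I_mul_I + h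
      | norm_num

theorem BasisState.trace_density (a : BasisState) : a.density.trace = 1 := by
  rw [a.density_eq]
  cases a <;> simp [Matrix.trace, stab, letterMatrix, matX, matY, matZ] <;> norm_num

theorem exists_unit_of_mem {q : Fin n → (Bool × Bool) × Bool} {r : Row}
    (hr : r ∈ unitRowsRec (List.ofFn q)) : r.2.length = n ∧ ∃ k : Fin n,
      rowOp n r = (if (q k).2 then -1 else 1 : ℂ) • onQubit k (letterMatrix (q k).1) := by
  obtain ⟨k, hk⟩ := List.mem_iff_getElem?.mp hr
  have hkn : k < n := by
    have := (List.getElem?_eq_some_iff.mp hk).1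
    simpa [length_unitRowsRec] using this
  obtain ⟨l, h1, h2, h3⟩ := unitRowsRec_getElem? (List.ofFn q) k (q ⟨k, hkn⟩) (by simp [hkn])
  obtain rfl : r = (((q ⟨k, hkn⟩).2, false), l) := by
    rw [hk] at h1
    exact Option.some.inj h1
  exact ⟨by simpa using h2, ⟨k, hkn⟩, rowOp_unit ⟨k, hkn⟩ _ l h3⟩

theorem letterMatrix_mul_self (l : Bool × Bool) : letterMatrix l * letterMatrix l = 1 := by
  obtain ⟨a, b⟩ := l
  cases a <;> cases b <;> ext i j <;> fin_cases i <;> fin_cases j <;>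
    simp [letterMatrix, matX, matY, matZ]

theorem stabRows_unitRowsRec (q : Fin n → (Bool × Bool) × Bool) :
    StabRows n (unitRowsRec (List.ofFn q)) := by
  intro r hr
  obtain ⟨h1, k, h2⟩ := exists_unit_of_mem hr
  refine ⟨h1, ?_, fun r' hr' => ?_⟩
  · rw [h2, smul_mul_smul_comm, onQubit_mul, letterMatrix_mul_self, onQubit_one]
    split_ifs <;> simp
  · obtain ⟨-, k', h2'⟩ := exists_unit_of_mem hr'
    by_cases hk : k = k'
    · subst hk
      rw [h2, h2']
    · rw [h2, h2']
      exact ((onQubit_commute hk _ _).smul_left _).smul_right _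

/-- The link between states and tableaux: the factors are the single-qubit projectors, in the order
in which `tensor_eq_prod` multiplies them. -/
theorem projList_unitRowsRec (a : Fin n → BasisState) :
    projList (unitRowsRec (List.ofFn fun i => (a i).stab)) = tensor fun i => (a i).density := by
  rw [tensor_eq_prod, projList]
  congr 1
  refine List.ext_getElem? fun k => ?_
  by_cases hk : k < n
  · obtain ⟨l, h1, h2, h3⟩ := unitRowsRec_getElem? (List.ofFn fun i => (a i).stab) k
      (a ⟨k, hk⟩).stab (by simp [hk])
    rw [List.getElem?_map, List.getElem?_map, h1, List.getElem?_eq_getElem (by simpa using hk)]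
    simp only [Option.map_some, List.getElem_finRange]
    rw [rowOp_unit ⟨k, hk⟩ _ l h3, BasisState.density_eq, onQubit_smul, onQubit_add, onQubit_smul,
      onQubit_one]
    rfl
  · rw [List.getElem?_eq_none (by simpa [length_unitRowsRec] using hk),
      List.getElem?_eq_none (by simpa using hk)]

theorem ConjugateRows.exists_of_mem {U : Op n} {rows rows' : List Row}
    (h : ConjugateRows U rows rows') {r' : Row} (hr' : r' ∈ rows') :
    r'.2.length = n ∧ ∃ r ∈ rows, rowOp n r' = U * rowOp n r * Uᴴ := by
  induction h with
  | nil => simp at hr'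
  | cons h1 h2 ih =>
    rcases List.mem_cons.mp hr' with rfl | hr'
    · exact ⟨h1.1, _, by simp, h1.2⟩
    · obtain ⟨h3, r, h4, h5⟩ := ih hr'
      exact ⟨h3, r, by simp [h4], h5⟩

theorem conj_mul_conj {U : Op n} (hU : Uᴴ * U = 1) (A B : Op n) :
    U * A * Uᴴ * (U * B * Uᴴ) = U * (A * B) * Uᴴ := by
  simp only [Matrix.mul_assoc]
  rw [← Matrix.mul_assoc Uᴴ U, hU, Matrix.one_mul]

theorem ConjugateRows.stabRows {U : Op n} (hU : Uᴴ * U = 1) {rows rows' : List Row}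
    (h : ConjugateRows U rows rows') (h1 : StabRows n rows) : StabRows n rows' := by
  intro r' hr'
  obtain ⟨h2, r, h3, h4⟩ := h.exists_of_mem hr'
  refine ⟨h2, ?_, fun s' hs' => ?_⟩
  · rw [h4, conj_mul_conj hU, (h1 r h3).2.1, Matrix.mul_one]
    exact mul_eq_one_comm.mp hU
  · obtain ⟨-, s, h5, h6⟩ := h.exists_of_mem hs'
    rw [h4, h6, Commute, SemiconjBy, conj_mul_conj hU, conj_mul_conj hU, ((h1 r h3).2.2 s h5).eq]

theorem ConjugateRows.projList {U : Op n} (hU : Uᴴ * U = 1) {rows rows' : List Row}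
    (h : ConjugateRows U rows rows') : projList rows' = U * projList rows * Uᴴ := by
  have e : U * Uᴴ = 1 := mul_eq_one_comm.mp hU
  induction h with
  | nil => simp [GK.projList, e]
  | @cons r r' l l' h1 h2 ih =>
    have h3 : (1 / 2 : ℂ) • (1 + rowOp n r') = U * ((1 / 2 : ℂ) • (1 + rowOp n r)) * Uᴴ := by
      rw [h1.2, mul_smul_comm, smul_mul_assoc, Matrix.mul_add, Matrix.add_mul, Matrix.mul_one, e]
    simp only [GK.projList, List.map_cons, List.prod_cons] at ih ⊢
    rw [ih, h3, conj_mul_conj hU]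

theorem length_foldr_solveStep (es : List (Option (Bool × List Bool))) (c : List Bool)
    (h : c.length = es.length) : ((es.zip c).foldr solveStep []).length = es.length := by
  induction es generalizing c with
  | nil => rfl
  | cons e es ih =>
    cases c with
    | nil => simp at h
    | cons b c =>
      have := ih c (by simpa using h)
      cases e <;> simpa [solveStep] using this

open Classical in
theorem sum_outcomeWord {Y : List Bool} (h : Y.length = n) :
    (∑ x : Fin n → Fin 2, if Y = outcomeWord x then (1 : ℂ) else 0) = 1 := by
  obtain ⟨f, rfl⟩ := exists_ofFn h
  rw [Finset.sum_eq_single fun i => if f i then 1 else 0]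
  · rw [if_pos]
    rw [outcomeWord]
    congr 1
    funext i
    cases f i <;> simp
  · intro x _ hx
    rw [if_neg]
    intro e
    refine hx (funext fun i => ?_)
    have := congrFun (List.ofFn_injective e) i
    rw [this]
    generalize x i = u
    fin_cases u <;> simp
  · simp

open Classical in
/-- For every product of basis states, the measurement result is distributed as the result of the
simulation with uniformly distributed random bits. -/
theorem simulate_correct (C : List (Gate n)) {U : Op n} (hU : CircuitDenotes C U)
    (a : Fin n → BasisState) (x : Fin n → Fin 2) :
    (U * (tensor fun i => (a i).density) * Uᴴ) x x = (1 / 2 : ℂ) ^ n *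
      ∑ c : Fin n → Bool, if simulate (encodeCircuit C,
        (List.ofFn fun i => ((a i).stab, c i)).reverse) = (outcomeWord x).reverse then 1 else 0 := by
  set rows := unitRowsRec (List.ofFn fun i => (a i).stab) with hrows
  have hstab : StabRows n rows := stabRows_unitRowsRec _
  obtain ⟨hU1, hrows'⟩ := applyGates_encode C hU rows fun r hr => (hstab r hr).1
  set rows' := applyGates (List.replicate n true,
    (C.map fun g => true :: g.encode).flatten ++ [false], rows) with hr'
  have hstab' := hrows'.stabRows hU1 hstab
  have hproj := hrows'.projList hU1
  rw [projList_unitRowsRec] at hproj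
  obtain ⟨f1, f2, κ₁, f3⟩ := foldl_elimStep_fst (n := n) (List.replicate n true) ([], rows', [])
    (by simp) hstab' (by simp)
  set rows'' := ((List.replicate n true).foldl (fun c _ => elimStep (fun x _ => x) c)
    ([], rows', [])).2.1
  obtain ⟨es, g1, g2, κ₂, g3⟩ := foldl_elimStep_snd (n := n) (List.replicate n true)
    ([], rows'', []) (by simp) f1 f2 (by simp)
  rw [List.length_replicate] at g2
  -- The number of qubits becomes the length of the system, so that the count of solutions applies
  -- without casts.
  subst g2
  obtain ⟨K, hK⟩ := exists_card_solve es
  have hsim : ∀ (c : Fin es.length → Bool) (Y : List Bool), simulate (encodeCircuit C,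
      (List.ofFn fun i => ((a i).stab, c i)).reverse) = Y.reverse ↔
      (es.zip (List.ofFn c)).foldr solveStep [] = Y := by
    intro c Y
    have e1 : readUnary (encodeCircuit C) = (List.replicate es.length true,
        (C.map fun g => true :: g.encode).flatten ++ [false]) := by
      rw [encodeCircuit, List.append_assoc, readUnary_encodeNat]
    have e2 : unitRows ((List.ofFn fun i => ((a i).stab, c i)).reverse.map fun b => b.1) = rows := by
      rw [List.map_reverse, List.map_ofFn, unitRows_reverse]
      rfl
    have e3 : ((List.ofFn fun i => ((a i).stab, c i)).reverse.map fun b => b.2) =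
        (List.ofFn c).reverse := by
      rw [List.map_reverse, List.map_ofFn]
      rfl
    rw [simulate, e1, e2, e3]
    simp only [eliminate]
    -- The equations and the random bits both come in reversed order, so the left fold of `solve` is
    -- the right fold over `es`.
    rw [← hr', g1, List.reverse_inj, solve, List.append_nil, List.zip_eq_zipWith,
      ← List.reverse_zipWith (by simp), List.foldl_reverse, ← List.zip_eq_zipWith]
  simp only [hsim]
  -- Both the Born probabilities and the numbers of favourable bit strings are constant multiples of
  -- the indicator of the same system.
  have hf : ∀ x, (U * (tensor fun i => (a i).density) * Uᴴ) x x =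
      κ₁ * κ₂ * if Satisfies es (outcomeWord x) then 1 else 0 := by
    intro x
    rw [← hproj, mul_assoc]
    exact (f3 x).trans (congrArg _ (g3 x))
  have hN : ∀ x : Fin es.length → Fin 2, (∑ c : Fin es.length → Bool,
      if (es.zip (List.ofFn c)).foldr solveStep [] = outcomeWord x then (1 : ℂ) else 0) =
      K * if Satisfies es (outcomeWord x) then 1 else 0 := by
    intro x
    have := congrArg (Nat.cast (R := ℂ)) (hK (outcomeWord x) (by simp [outcomeWord]))
    push_cast at this
    rw [this]
    split_ifs <;> simp
  have hf1 : ∑ x, (U * (tensor fun i => (a i).density) * Uᴴ) x x = 1 := by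
    change Matrix.trace _ = 1
    rw [Matrix.trace_mul_cycle, hU1, Matrix.one_mul, Matrix.trace]
    simp only [Matrix.diag_apply, tensor_apply]
    have := Finset.prod_univ_sum (fun _ : Fin es.length => (Finset.univ : Finset (Fin 2)))
      fun i b => (a i).density b b
    rw [Fintype.piFinset_univ] at this
    rw [← this]
    exact Finset.prod_eq_one fun i _ => (a i).trace_density
  have hN1 : ∑ x : Fin es.length → Fin 2, (∑ c : Fin es.length → Bool,
      if (es.zip (List.ofFn c)).foldr solveStep [] = outcomeWord x then (1 : ℂ) else 0) =
      2 ^ es.length := by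
    rw [Finset.sum_comm]
    have : ∀ c : Fin es.length → Bool, (∑ x : Fin es.length → Fin 2,
        if (es.zip (List.ofFn c)).foldr solveStep [] = outcomeWord x then (1 : ℂ) else 0) = 1 :=
      fun c => sum_outcomeWord (length_foldr_solveStep es _ (by simp))
    simp [this]
  rw [hf x, hN x]
  simp only [hf, hN, ← Finset.mul_sum] at hf1 hN1
  -- With `σ` the number of solutions, the totals give `κ₁ * κ₂ * σ = 1` and `K * σ = 2 ^ n`. The
  -- first equation shows `σ ≠ 0`, and dividing by `σ` identifies the two constants.
  generalize (∑ x : Fin es.length → Fin 2,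
    if Satisfies es (outcomeWord x) then (1 : ℂ) else 0) = σ at hf1 hN1
  have hσ : σ ≠ 0 := by
    rintro rfl
    simp at hf1
  have : κ₁ * κ₂ = (1 / 2 : ℂ) ^ es.length * K := by
    have h2 : (1 / 2 : ℂ) ^ es.length * 2 ^ es.length = 1 := by
      rw [← mul_pow]; norm_num
    refine mul_right_cancel₀ hσ ?_
    rw [hf1, mul_assoc, hN1, h2]
  rw [this]
  ring

theorem outcomeProb_eq (U ρ : Op n) (x : Fin n → Fin 2) :
    outcomeProb U ρ x = (U * ρ * Uᴴ) x x := by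
  simp [outcomeProb, Matrix.trace_single_mul]

/-- By multilinearity of the tensor product, the mixed input is the average of the pure products
over independent draws. -/
theorem productState_eq (p : Fin n → BasisState → ℝ) :
    productState p = ∑ a : Fin n → BasisState,
      ((∏ i, p i (a i) : ℝ) : ℂ) • tensor fun i => (a i).density := by
  ext x y
  rw [productState, tensor_apply, Matrix.sum_apply]
  have := Finset.prod_univ_sum (fun _ : Fin n => (Finset.univ : Finset BasisState))
    fun i a => (p i a : ℂ) * a.density (x i) (y i)
  rw [Fintype.piFinset_univ] at this
  simp only [Matrix.sum_apply, Matrix.smul_apply, smul_eq_mul, tensor_apply]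
  rw [this]
  refine Finset.sum_congr rfl fun a _ => ?_
  rw [Finset.prod_mul_distrib]
  push_cast
  rfl

open Classical in
/-- The Born probabilities are the probabilities of the results of the simulation when the initial
states and the random bits are drawn independently. -/
theorem outcomeProb_productState (C : List (Gate n)) {U : Op n} (hU : CircuitDenotes C U)
    (p : Fin n → BasisState → ℝ) (x : Fin n → Fin 2) :
    outcomeProb U (productState p) x =
      ((∑ f : Fin n → BasisState × Bool, (∏ i, p i (f i).1 / 2) *
        if simulate (encodeCircuit C, (List.ofFn fun i => ((f i).1.stab, (f i).2)).reverse) =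
          (outcomeWord x).reverse then 1 else 0 : ℝ) : ℂ) := by
  rw [outcomeProb_eq, productState_eq, Finset.mul_sum, Finset.sum_mul, Matrix.sum_apply,
    ← (Equiv.arrowProdEquivProdArrow (Fin n) (fun _ => BasisState)
      fun _ => Bool).symm.sum_comp, Fintype.sum_prod_type]
  push_cast
  refine Finset.sum_congr rfl fun a _ => ?_
  rw [mul_smul_comm, smul_mul_assoc, Matrix.smul_apply, simulate_correct C hU, smul_eq_mul,
    Finset.mul_sum, Finset.mul_sum]
  refine Finset.sum_congr rfl fun c _ => ?_
  simp only [Equiv.arrowProdEquivProdArrow_symm_apply, Finset.prod_div_distrib, Finset.prod_const,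
    Finset.card_univ, Fintype.card_fin]
  split_ifs <;> simp [div_eq_mul_inv]

/-- The expectation of `F` after independent draws with the given weights have been put in front
of a list. -/
def expect {A : Type} [Fintype A] : List (A → ℝ) → (List A → ℝ) → List A → ℝ
  | [], F, acc => F acc
  | p :: ps, F, acc => ∑ a, p a * expect ps F (a :: acc)

theorem expect_ofFn {A : Type} [Fintype A] (p : Fin n → A → ℝ) (F : List A → ℝ) (acc : List A) :
    expect (List.ofFn p) F acc =
      ∑ f : Fin n → A, (∏ i, p i (f i)) * F ((List.ofFn f).reverse ++ acc) := by
  induction n generalizing acc with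
  | zero => simp [expect]
  | succ n ih =>
    rw [List.ofFn_succ, expect, ← (Fin.consEquiv fun _ => A).sum_comp, Fintype.sum_prod_type]
    refine Finset.sum_congr rfl fun a _ => ?_
    rw [ih, Finset.mul_sum]
    refine Finset.sum_congr rfl fun f _ => ?_
    simp [Fin.consEquiv, Fin.prod_univ_succ, mul_assoc]

end GK

namespace GK

/-! ### Words and lists of bits -/

/-- Remove a list of bits from register `0` and push its entries on register `1`. The flag in
register `2` is removed at the end of the list. -/
def readListLoop : Prog :=
  .loop 2 (.cases 0 .skip (.seq (.pop 0) (.pop 2))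
    (.seq (.pop 0) (.cases 0 .skip (.seq (.pop 0) (.push 1 false))
      (.seq (.pop 0) (.seq (.pop 0) (.seq (.pop 0) (.push 1 true)))))))

def readList : Prog := .seq (.push 2 true) readListLoop

theorem readListLoop_runs {O : Oracle} (l x b d : List Bool) (s : Regs) :
    RunsIn O readListLoop (regs (code l ++ x) b [true] d s) (regs x (l.reverse ++ b) [] d s)
      (12 * l.length + 6) := by
  induction l generalizing b with
  | nil =>
    have h1 : RunsIn O (.seq (.pop 0) (.pop 2)) (regs (false :: x) b [true] d s)
        (regs x b [] d s) 3 := by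
      simpa using RunsIn.seq (O := O) (RunsIn.pop (s := regs (false :: x) b [true] d s) (r := 0))
        (RunsIn.pop (r := 2))
    exact (RunsIn.loop_cons (by rfl) (.cases_false (by rfl) h1) (.loop_nil (by rfl))).mono (by simp)
  | cons c l ih =>
    have h1 : RunsIn O (.cases 0 .skip (.seq (.pop 0) (.push 1 false))
        (.seq (.pop 0) (.seq (.pop 0) (.seq (.pop 0) (.push 1 true)))))
        (regs (code c ++ (code l ++ x)) b [true] d s)
        (regs (code l ++ x) (c :: b) [true] d s) 8 := by
      cases c
      · refine RunsIn.mono (.cases_false (l := code l ++ x) (by rfl) ?_) (show 3 + 1 ≤ 8 by omega)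
        simpa [code_false] using RunsIn.seq (O := O)
          (RunsIn.pop (s := regs (code false ++ (code l ++ x)) b [true] d s) (r := 0))
          (RunsIn.push (r := 1) (b := false))
      · refine RunsIn.mono (.cases_true (l := false :: false :: (code l ++ x)) (by rfl) ?_)
          (show 7 + 1 ≤ 8 by omega)
        simpa [code_true] using RunsIn.seq (O := O)
          (RunsIn.pop (s := regs (code true ++ (code l ++ x)) b [true] d s) (r := 0))
          (RunsIn.seq (RunsIn.pop (r := 0)) (RunsIn.seq (RunsIn.pop (r := 0))
            (RunsIn.push (r := 1) (b := true))))
    have h2 : RunsIn O (.pop 0) (regs (code (c :: l) ++ x) b [true] d s)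
        (regs (code c ++ (code l ++ x)) b [true] d s) 1 := by
      simpa [code_cons] using RunsIn.pop (O := O) (s := regs (code (c :: l) ++ x) b [true] d s)
        (r := 0)
    have h3 := RunsIn.loop_cons (O := O) (r := 2) (s := regs (code (c :: l) ++ x) b [true] d s)
      (by rfl) (.cases_true (P := .skip) (Q := .seq (.pop 0) (.pop 2)) (by rfl) (h2.seq h1))
      (ih (c :: b))
    rw [List.reverse_cons, List.append_assoc]
    exact h3.mono (by simp; omega)

theorem readList_runs {O : Oracle} (l x b d : List Bool) (s : Regs) :
    RunsIn O readList (regs (code l ++ x) b [] d s) (regs x (l.reverse ++ b) [] d s)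
      (12 * l.length + 8) := by
  have h := RunsIn.push (O := O) (s := regs (code l ++ x) b [] d s) (r := 2) (b := true)
  simp only [update_regs_two, regs_two] at h
  exact (h.seq (readListLoop_runs l x b d s)).mono (by omega)

/-- Replace the word in register `1`, in reversed order, by a list on register `0`. -/
def writeList : Prog :=
  .loop 1 (.cases 1 .skip (.seq (.pop 1) (pushWord (true :: code false)))
    (.seq (.pop 1) (pushWord (true :: code true))))

theorem writeList_runs {O : Oracle} (l l' c d : List Bool) (s : Regs) :
    RunsIn O writeList (regs (code l') l c d s) (regs (code (l.reverse ++ l')) [] c d s)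
      (13 * l.length + 1) := by
  induction l generalizing l' with
  | nil => exact .loop_nil (by rfl)
  | cons b l ih =>
    have h1 : RunsIn O (.seq (.pop 1) (pushWord (true :: code b))) (regs (code l') (b :: l) c d s)
        (regs (code (b :: l')) l c d s) 11 := by
      have := RunsIn.seq (O := O) (RunsIn.pop (s := regs (code l') (b :: l) c d s) (r := 1))
        (pushWord_runs (true :: code b) _)
      simp only [update_regs_one, update_regs_zero, regs_zero, regs_one] at this
      refine RunsIn.mono (T' := 11) (by simpa [code_cons] using this) ?_
      cases b <;> simp [code_false, code_true]
    have h2 : RunsIn O (.cases 1 .skip (.seq (.pop 1) (pushWord (true :: code false)))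
        (.seq (.pop 1) (pushWord (true :: code true)))) (regs (code l') (b :: l) c d s)
        (regs (code (b :: l')) l c d s) 12 := by
      cases b
      · exact .cases_false (by rfl) h1
      · exact .cases_true (by rfl) h1
    rw [List.reverse_cons, List.append_assoc]
    exact (RunsIn.loop_cons (by rfl) h2 (ih (b :: l'))).mono (by simp; omega)

/-- Replace the word in register `0` by the corresponding list. -/
def wordToList : Prog := .seq (moveAll 0 1) (.seq (.push 0 false) writeList)

theorem wordToList_runs {O : Oracle} (w d : List Bool) (s : Regs) :
    RunsIn O wordToList (regs w [] [] d s) (regs (code w) [] [] d s) (18 * w.length + 5) := by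
  have h1 := moveAll_runs (O := O) (x := 0) (y := 1) (by decide) w (regs w [] [] d s) rfl
  have h2 := RunsIn.push (O := O) (s := regs [] w.reverse [] d s) (r := 0) (b := false)
  have h3 := writeList_runs (O := O) w.reverse [] [] d s
  simp only [update_regs_zero, update_regs_one, regs_zero, regs_one, List.append_nil,
    List.reverse_reverse, List.length_reverse] at h1 h2 h3
  exact (h1.seq (h2.seq h3)).mono (by omega)

/-- Replace a list on register `0` by the answer of the oracle. -/
def ask : Prog :=
  .seq readList (.seq (moveAll 1 2) (.seq (.query 2 3) (.seq (clear 2)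
    (.cases 3 (pushWord (code (none : Option Bool)))
      (.seq (.pop 3) (pushWord (code (some false))))
      (.seq (.pop 3) (pushWord (code (some true))))))))

theorem ask_runs {O : Oracle} (l x : List Bool) (s : Regs) :
    RunsIn O ask (regs (code l ++ x) [] [] [] s) (regs (code (O l) ++ x) [] [] [] s)
      (19 * l.length + 40) := by
  have h1 := readList_runs (O := O) l x [] [] s
  rw [List.append_nil] at h1
  have h2 := moveAll_runs (O := O) (x := 1) (y := 2) (by decide) l.reverse
    (regs x (l.reverse ++ []) [] [] s) (by simp)
  have h3 := RunsIn.query (O := O) (s := regs x [] l [] s) (a := 2) (r := 3)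
  have h4 := clear_runs (O := O) (x := 2) l (regs x [] l (O l).toList s) rfl
  simp only [update_regs_one, update_regs_two, update_regs_three, regs_two, List.append_nil,
    List.reverse_reverse, List.length_reverse] at h2 h3 h4
  have h5 : RunsIn O (.cases 3 (pushWord (code (none : Option Bool)))
      (.seq (.pop 3) (pushWord (code (some false))))
      (.seq (.pop 3) (pushWord (code (some true))))) (regs x [] [] (O l).toList s)
      (regs (code (O l) ++ x) [] [] [] s) 16 := by
    have h6 : ∀ b, RunsIn O (.seq (.pop 3) (pushWord (code (some b)))) (regs x [] [] [b] s)
        (regs (code (some b) ++ x) [] [] [] s) 15 := by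
      intro b
      have := RunsIn.seq (O := O) (RunsIn.pop (s := regs x [] [] [b] s) (r := 3))
        (pushWord_runs (code (some b)) _)
      simp only [update_regs_three, update_regs_zero, regs_zero, regs_three] at this
      refine this.mono ?_
      cases b <;> simp [code_some, code_false, code_true]
    rcases O l with _ | _ | _
    · refine RunsIn.mono (.cases_nil (by rfl) ?_) (show 3 + 1 ≤ 16 by omega)
      simpa [code_none] using pushWord_runs (O := O) (code (none : Option Bool)) (regs x [] [] [] s)
    · exact .cases_false (by rfl) (h6 false)
    · exact .cases_true (by rfl) (h6 true)
  exact (h1.seq (h2.seq (h3.seq (h4.seq h5)))).mono (by omega)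

theorem OraclePolyTime.ask : OraclePolyTime fun (O : Oracle) (l : List Bool) => O l := by
  refine ⟨GK.ask, 4, fun n => 19 * n + 40, le_rfl, ((PolyBounded.const 19).mul .id).add (.const 40),
    fun O l => ⟨?_, fun x s hs => ?_⟩⟩
  · have : size (O l) ≤ 5 := by
      rcases O l with _ | b
      · exact Nat.le_of_ble_eq_true rfl
      · rw [size_some]
        have := size_bool_le b
        omega
    beta_reduce
    omega
  · have h := ask_runs (O := O) l x fun i => s (i + 4)
    rw [← hs.update_eq, ← hs.update_eq] at h
    have := length_lt_size l
    exact h.mono (by beta_reduce; omega)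

/-! ### The random process -/

/-- The states of the process that draws the initial states of the qubits: a list whose length is
the number of qubits that are left; the description of the circuit; the number of the current qubit;
the results so far; the number of binary digits that have been used for the current qubit; and
a position among the paths that are still undecided at this depth. -/
abbrev State : Type :=
  List Bool × ((List Bool × List Bool) × List (((Bool × Bool) × Bool) × Bool)) ×
    (List Bool × List Bool)

def stateList : List BasisState := [.plus, .minus, .plusI, .minusI, .zero, .one]

def queryWord (i j : List Bool) (a : BasisState) : List Bool :=
  i ++ false :: (encodeNat a.index ++ (j ++ [false]))

/-- The states among `l` whose probability has the digit `1` at the position `j`. -/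
def digits (O : Oracle) (i j : List Bool) (l : List BasisState) : List BasisState :=
  l.filter fun a => O (queryWord i j a) == some true

/-- One step of the process, where the first component lists the possible results at the current
depth. -/
def advanceWith (x : List ((Bool × Bool) × Bool) × Bool × State) : State :=
  match x.2.2.1 with
  | [] => x.2.2
  | r :: rem =>
    match x.1.drop x.2.2.2.2.2.length with
    | a :: _ => (rem, ((x.2.2.2.1.1.1, true :: x.2.2.2.1.1.2), (a, x.2.1) :: x.2.2.2.1.2), ([], []))
    | [] => (r :: rem, x.2.2.2.1, (true :: x.2.2.2.2.1,
        bif x.2.1 then true :: (x.2.2.2.2.2.drop x.1.length ++ x.2.2.2.2.2.drop x.1.length)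
        else x.2.2.2.2.2.drop x.1.length ++ x.2.2.2.2.2.drop x.1.length))

/-- One step of the process: the binary digits at the current depth decide which of the paths
end here, and with which result; the other paths branch according to the coin. -/
def advance (O : Oracle) (x : Bool × State) : State :=
  advanceWith ((digits O x.2.2.1.1.2 x.2.2.2.1 stateList).map BasisState.stab, x)

theorem PolyTime.advanceWith : PolyTime advanceWith := by
  have hsel : PolyTime fun x : List ((Bool × Bool) × Bool) × Bool × State => x.2.2.2.2.2 :=
    (PolyTime.snd.comp PolyTime.snd).comp (PolyTime.snd.comp (PolyTime.snd.comp PolyTime.snd))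
  have hj : PolyTime fun x : List ((Bool × Bool) × Bool) × Bool × State => x.2.2.2.2.1 :=
    (PolyTime.fst.comp PolyTime.snd).comp (PolyTime.snd.comp (PolyTime.snd.comp PolyTime.snd))
  have hb : PolyTime fun x : List ((Bool × Bool) × Bool) × Bool × State => x.2.1 :=
    PolyTime.fst.comp .snd
  have henv : PolyTime fun x : List ((Bool × Bool) × Bool) × Bool × State => x.2.2.2.1 :=
    (PolyTime.fst.comp PolyTime.snd).comp (PolyTime.snd.comp PolyTime.snd)
  have hrem : PolyTime fun x : List ((Bool × Bool) × Bool) × Bool × State => x.2.2.1 :=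
    PolyTime.fst.comp (PolyTime.snd.comp PolyTime.snd)
  have hd : PolyTime fun x : List ((Bool × Bool) × Bool) × Bool × State =>
      x.2.2.2.2.2.drop x.1.length := PolyTime.drop .fst hsel
  have h1 : PolyTime fun x : List ((Bool × Bool) × Bool) × Bool × State =>
      ((x.2.2.1, x.2.2.2.1, (true :: x.2.2.2.2.1,
        bif x.2.1 then true :: (x.2.2.2.2.2.drop x.1.length ++ x.2.2.2.2.2.drop x.1.length)
        else x.2.2.2.2.2.drop x.1.length ++ x.2.2.2.2.2.drop x.1.length)) : State) :=
    hrem.pair (henv.pair ((PolyTime.cons (.const true) hj).pair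
      (hb.cond (.cons (.const true) (hd.append hd)) (hd.append hd))))
  have h2 : PolyTime fun y : (List ((Bool × Bool) × Bool) × Bool × State) × ((Bool × Bool) × Bool) ×
      List ((Bool × Bool) × Bool) =>
      ((y.1.2.2.1.tail, ((y.1.2.2.2.1.1.1, true :: y.1.2.2.2.1.1.2),
        (y.2.1, y.1.2.1) :: y.1.2.2.2.1.2), ([], [])) : State) := by
    have hw := (PolyTime.fst.comp PolyTime.fst).comp (henv.comp PolyTime.fst
      (α := (List ((Bool × Bool) × Bool) × Bool × State) × ((Bool × Bool) × Bool) ×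
      List ((Bool × Bool) × Bool)))
    have hi := (PolyTime.snd.comp PolyTime.fst).comp (henv.comp PolyTime.fst
      (α := (List ((Bool × Bool) × Bool) × Bool × State) × ((Bool × Bool) × Bool) ×
      List ((Bool × Bool) × Bool)))
    have hacc := PolyTime.snd.comp (henv.comp PolyTime.fst
      (α := (List ((Bool × Bool) × Bool) × Bool × State) × ((Bool × Bool) × Bool) ×
      List ((Bool × Bool) × Bool)))
    exact (hrem.tail.comp .fst).pair (((hw.pair (.cons (.const true) hi)).pair
      (.cons ((PolyTime.fst.comp .snd).pair (hb.comp .fst)) hacc)).pair (.const ([], [])))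
  have h3 : PolyTime fun x : List ((Bool × Bool) × Bool) × Bool × State =>
      ((match x.1.drop x.2.2.2.2.2.length with
      | a :: _ => (x.2.2.1.tail, ((x.2.2.2.1.1.1, true :: x.2.2.2.1.1.2),
          (a, x.2.1) :: x.2.2.2.1.2), ([], []))
      | [] => (x.2.2.1, x.2.2.2.1, (true :: x.2.2.2.2.1,
        bif x.2.1 then true :: (x.2.2.2.2.2.drop x.1.length ++ x.2.2.2.2.2.drop x.1.length)
        else x.2.2.2.2.2.drop x.1.length ++ x.2.2.2.2.2.drop x.1.length))) : State) := by
    refine PolyTime.list_cases (hsel.drop .fst) h1 h2 (fun x hx => ?_) (fun x a t hx => ?_)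
    · rw [hx]
    · rw [hx]
  refine PolyTime.list_cases hrem (PolyTime.snd.comp .snd) (h3.comp .fst) (fun x hx => ?_)
    (fun x r t hx => ?_)
  · rw [GK.advanceWith, hx]
  · rw [GK.advanceWith, hx]
    rfl

/-- The list of states is a constant of the program, so the program may be composed by induction on
it, with one oracle query per state. -/
theorem OraclePolyTime.digits (l : List BasisState) :
    OraclePolyTime fun (O : Oracle) (x : List Bool × List Bool) =>
      (GK.digits O x.1 x.2 l).map BasisState.stab := by
  induction l with
  | nil => exact PolyTime.const []
  | cons a l ih =>
    have h1 : PolyTime fun x : List Bool × List Bool => queryWord x.1 x.2 a :=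
      PolyTime.fst.append (.cons (.const false) ((PolyTime.const (encodeNat a.index)).append
        (PolyTime.snd.append (.const [false]))))
    have h2 : PolyTime fun x : Option Bool × List ((Bool × Bool) × Bool) =>
        bif x.1 == some true then a.stab :: x.2 else x.2 := by
      refine PolyTime.cond ?_ (.cons (.const _) .snd) .snd
      refine PolyTime.option_cases (o := fun x => x.1) (f₀ := fun _ => false) (f₁ := fun x => x.2)
        .fst (.const false) .snd ?_ ?_
      · rintro ⟨_ | b, l⟩ h
        · rfl
        · cases h
      · rintro ⟨_ | b, l⟩ c h
        · cases h
        · cases h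
          cases b <;> rfl
    have h3 := OraclePolyTime.comp h2 ((OraclePolyTime.ask.comp h1).pair ih)
    refine (congrArg OraclePolyTime ?_).mp h3
    funext O x
    simp only [GK.digits, List.filter_cons]
    cases O (queryWord x.1 x.2 a) == some true <;> rfl

theorem OraclePolyTime.advance : OraclePolyTime advance := by
  have h1 : PolyTime fun x : Bool × State => (x.2.2.1.1.2, x.2.2.2.1) :=
    ((PolyTime.snd.comp (PolyTime.fst.comp PolyTime.fst)).comp (PolyTime.snd.comp PolyTime.snd)).pair
      ((PolyTime.fst.comp PolyTime.snd).comp (PolyTime.snd.comp PolyTime.snd))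
  have h2 := (OraclePolyTime.comp (OraclePolyTime.digits stateList) h1).pair PolyTime.id
  have h3 := OraclePolyTime.comp PolyTime.advanceWith h2
  exact h3

end GK

namespace GK

/-! ### The program -/

/-- The initial state of the process. -/
def initialState (w : List Bool) : State := ((readUnary w).1, ((w, []), []), ([], []))

/-- The measurement results, in reversed order. -/
def result (σ : State) : List Bool := simulate (σ.2.1.1.1, σ.2.1.2)

/-- The state of the process after `T` steps. -/
def evolve (O : Oracle) : ℕ → State → (ℕ → Bool) → State
  | 0, σ, _ => σ
  | T + 1, σ, ω => evolve O T (advance O (ω 0, σ)) fun j => ω (j + 1)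

theorem evolve_of_finished {O : Oracle} (T : ℕ) {σ : State} (ω : ℕ → Bool) (h : σ.1 = []) :
    evolve O T σ ω = σ := by
  induction T generalizing ω with
  | zero => rfl
  | succ T ih =>
    have e : advance O (ω 0, σ) = σ := by rw [advance, advanceWith, h]
    rw [evolve, e, ih]

theorem PolyTime.initialState : PolyTime initialState :=
  (PolyTime.fst.comp PolyTime.readUnary).pair
    (((PolyTime.id.pair (.const [])).pair (.const [])).pair (.const ([], [])))

theorem PolyTime.result : PolyTime result :=
  PolyTime.simulate.comp (((PolyTime.fst.comp PolyTime.fst).comp (PolyTime.fst.comp PolyTime.snd)).pair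
    ((PolyTime.snd.comp PolyTime.fst).comp PolyTime.snd))

/-- Push a flag on the register `F`, unless the process has finished. -/
def testFinished (F : ℕ) : Prog :=
  .seq (.pop 0) (.cases 0 .skip (.push 0 true) (.seq (.push 0 true) (.push F true)))

/-- Toss a coin and add the result to the value on register `0`. -/
def toss : Prog :=
  .seq (.flip 0) (.cases 0 .skip (.push 0 true) (.seq (.pop 0) (pushWord [true, true, false, false])))

/-- The registers during the main loop, with the flag in register `F`. -/
def mainRegs (F : ℕ) (σ : State) : Regs :=
  Function.update (Function.update (fun _ => []) F (if σ.1 = [] then [] else [true])) 0 (code σ)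

theorem testFinished_runs {O : Oracle} {F : ℕ} (hF : F ≠ 0) (σ : State) :
    RunsIn O (testFinished F) (Function.update (fun _ => []) 0 (code σ)) (mainRegs F σ) 6 := by
  obtain ⟨_ | ⟨r, rem⟩, c⟩ := σ
  · have h := RunsIn.seq (O := O) (runs_pop_zero (s := fun _ => []) (b := true)
      (x := false :: code c)) (runs_cases_zero_false (P := .skip)
        (R := .seq (.push 0 true) (.push F true)) (runs_push_zero (b := true)))
    have e : mainRegs F (([], c) : State) =
        Function.update (fun _ => []) 0 (true :: false :: code c) := by
      simp only [mainRegs, if_true]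
      congr 1
      exact Function.update_eq_self F _
    rw [e]
    exact h.mono (by omega)
  · have h := RunsIn.seq (O := O) (runs_pop_zero (s := fun _ => []) (b := true)
      (x := true :: (code r ++ code rem ++ code c))) (runs_cases_zero_true (P := .skip)
        (Q := .push 0 true) (RunsIn.seq (runs_push_zero (b := true)) (RunsIn.push (r := F) (b := true))))
    have e : mainRegs F ((r :: rem, c) : State) =
        Function.update (Function.update (fun _ => []) 0
          (true :: true :: (code r ++ code rem ++ code c))) F [true] := by
      simp only [mainRegs]
      rw [Function.update_comm hF]
      simp [code_pair, code_cons]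
    rw [e]
    rw [Function.update_of_ne hF] at h
    exact h.mono (by omega)

/-- `RunsIn` leaves the coin sequence untouched, so the consumption of one coin is stated explicitly
here. The result is the code of the pair of the coin and the value below it. -/
theorem toss_runs {O : Oracle} (x : List Bool) (s : Regs) (K : List Prog) (ω : ℕ → Bool) :
    ∃ t ≤ 15, (step O)^[t] ⟨toss :: K, Function.update s 0 x, ω⟩ =
      ⟨K, Function.update s 0 (true :: (code (ω 0) ++ x)), fun j => ω (j + 1)⟩ := by
  have h : RunsIn O (.cases 0 .skip (.push 0 true)
      (.seq (.pop 0) (pushWord [true, true, false, false]))) (Function.update s 0 (ω 0 :: x))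
      (Function.update s 0 (true :: (code (ω 0) ++ x))) 13 := by
    cases ω 0
    · exact (runs_cases_zero_false (runs_push_zero (b := true))).mono (by omega)
    · have h1 := pushWord_runs (O := O) [true, true, false, false] (Function.update s 0 x)
      simp only [Function.update_self, Function.update_idem] at h1
      exact (runs_cases_zero_true (P := .skip) (Q := .push 0 true)
        ((runs_pop_zero (b := true)).seq h1)).mono (by simp)
  obtain ⟨t, ht, h⟩ := h
  refine ⟨t + 1 + 1, by omega, ?_⟩
  rw [Function.iterate_succ_apply, Function.iterate_succ_apply]
  simp only [toss, step, Function.update_self, Function.update_idem]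
  exact h K _

/-- The body of the main loop. -/
def loopBody (F : ℕ) (P : Prog) : Prog :=
  .seq (.pop F) (.seq toss (.seq P (testFinished F)))

/-- The lower bound `1 ≤ t` will show that the machine cannot be ahead of the process, that is,
cannot halt before the process has finished. -/
theorem loopBody_runs {O : Oracle} {F : ℕ} {P : Prog} {g : ℕ → ℕ} (hF : F ≠ 0)
    (hP : Computes P F g advance) {σ : State} (hσ : σ.1 ≠ []) (K : List Prog) (ω : ℕ → Bool) :
    ∃ t ≤ g (size (ω 0, σ)) + 30, 1 ≤ t ∧
      (step O)^[t] ⟨.loop F (loopBody F P) :: K, mainRegs F σ, ω⟩ =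
        ⟨.loop F (loopBody F P) :: K, mainRegs F (advance O (ω 0, σ)), fun j => ω (j + 1)⟩ := by
  have hflag : mainRegs F σ F = [true] := by
    rw [mainRegs, Function.update_of_ne hF, Function.update_self, if_neg hσ]
  have hpop : Function.update (mainRegs F σ) F [] = Function.update (fun _ => []) 0 (code σ) := by
    rw [mainRegs, Function.update_comm hF.symm, Function.update_idem]
    exact congrArg (fun s : Regs => Function.update s 0 (code σ)) (Function.update_eq_self F _)
  obtain ⟨t₁, ht₁, h₁⟩ := toss_runs (O := O) (code σ) (fun _ => [])
    (.seq P (testFinished F) :: .loop F (loopBody F P) :: K) ω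
  have h₂ := (hP O (ω 0, σ)).2 [] (fun _ => []) fun _ _ _ => rfl
  rw [List.append_nil, List.append_nil] at h₂
  obtain ⟨t₃, ht₃, h₃⟩ := h₂.seq (testFinished_runs hF _)
  refine ⟨t₃ + (t₁ + 1 + 1 + 1 + 1), by omega, by omega, ?_⟩
  rw [Function.iterate_add_apply]
  simp only [Function.iterate_succ_apply]
  have e : step O (step O (step O (step O ⟨.loop F (loopBody F P) :: K, mainRegs F σ, ω⟩))) =
      ⟨toss :: .seq P (testFinished F) :: .loop F (loopBody F P) :: K,
        Function.update (fun _ => []) 0 (code σ), ω⟩ := by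
    simp only [step, hflag, loopBody, List.tail_cons, hpop]
  rw [e, h₁]
  exact h₃ _ _

/-- A finished process stays as it is and costs the machine no further pass of the loop. Hence the
lower bound on the number of steps is only claimed for unfinished processes. -/
theorem loop_evolve {O : Oracle} {F : ℕ} {P : Prog} {g : ℕ → ℕ} (hF : F ≠ 0) (hg : Monotone g)
    (hP : Computes P F g advance) (S T : ℕ) (σ : State) (ω : ℕ → Bool)
    (hS : ∀ t ≤ T, size (evolve O t σ ω) ≤ S) (K : List Prog) :
    ∃ t ω', t ≤ T * (g (S + 4) + 30) ∧
      (step O)^[t] ⟨.loop F (loopBody F P) :: K, mainRegs F σ, ω⟩ =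
        ⟨.loop F (loopBody F P) :: K, mainRegs F (evolve O T σ ω), ω'⟩ ∧
      ((evolve O T σ ω).1 ≠ [] → T ≤ t) := by
  induction T generalizing σ ω with
  | zero => exact ⟨0, ω, by simp, rfl, by simp⟩
  | succ T ih =>
    by_cases hσ : σ.1 = []
    · rw [evolve_of_finished _ _ hσ]
      exact ⟨0, ω, by simp, rfl, fun h => absurd hσ h⟩
    · obtain ⟨t₁, h1, h2, h3⟩ := loopBody_runs hF hP hσ K ω
      obtain ⟨t₂, ω', h4, h5, h6⟩ := ih (advance O (ω 0, σ)) (fun j => ω (j + 1))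
        fun t ht => hS (t + 1) (by omega)
      refine ⟨t₂ + t₁, ω', ?_, ?_, fun h => ?_⟩
      · have := hg (show size (ω 0, σ) ≤ S + 4 by
          have := hS 0 (by omega)
          have := size_bool_le (ω 0)
          rw [size_pair]
          simp only [evolve] at *
          omega)
        rw [Nat.succ_mul]
        omega
      · rw [Function.iterate_add_apply, h3, h5]
        rfl
      · have := h6 h
        omega

/-- The program. -/
def mainProg (F : ℕ) (P₀ P P₁ : Prog) : Prog :=
  .seq (.seq wordToList (.seq P₀ (testFinished F)))
    (.seq (.loop F (loopBody F P)) (.seq P₁ readList))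

theorem iterate_step_of_finished {O : Oracle} (t : ℕ) {c : Config} (h : c.todo = []) :
    (step O)^[t] c = c := by
  obtain ⟨todo, s, ω⟩ := c
  obtain rfl : todo = [] := h
  exact Function.iterate_fixed rfl t

theorem run_of_finished {M : Prog} {O : Oracle} {w : List Bool} {ω : ℕ → Bool} {t t' : ℕ}
    (h : (run M O w ω t).todo = []) (ht : t ≤ t') : run M O w ω t' = run M O w ω t := by
  obtain ⟨d, rfl⟩ := Nat.exists_eq_add_of_le' ht
  rw [run, Function.iterate_add_apply]
  exact iterate_step_of_finished d h

/-- There is a program that carries out the process and writes the results. -/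
theorem exists_program : ∃ (M : Prog) (G : ℕ → ℕ), PolyBounded G ∧
    ∀ (O : Oracle) (w : List Bool) (ω : ℕ → Bool) (T : ℕ),
      (∀ S, (∀ t ≤ T, size (evolve O t (initialState w) ω) ≤ S) →
        (evolve O T (initialState w) ω).1 = [] →
        (run M O w ω (G (w.length + T + S))).todo = [] ∧
        (run M O w ω (G (w.length + T + S))).reg 1 =
          (result (evolve O T (initialState w) ω)).reverse) ∧
      ((evolve O T (initialState w) ω).1 ≠ [] → (run M O w ω T).todo ≠ []) := by
  obtain ⟨P₀, k₀, g₀, hk₀, hg₀, h₀⟩ := PolyTime.initialState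
  obtain ⟨P, k, g, hk, hg, h⟩ := OraclePolyTime.advance
  obtain ⟨P₁, k₁, g₁, hk₁, hg₁, h₁⟩ := PolyTime.result
  -- The flag register lies beyond the scratch registers of the three programs.
  set F := k₀ + k + k₁ with hFdef
  have hF : F ≠ 0 := by omega
  have hP : Computes P F g advance := fun O a =>
    ⟨(h O a).1, fun x s hs => (h O a).2 x s (hs.mono (by omega))⟩
  have e0 : ∀ x, regs x [] [] [] (fun _ => []) = Function.update (fun _ => []) 0 x := by
    intro x
    funext i
    rcases i with _ | _ | _ | _ | i <;> rfl
  have hstart : ∀ (O : Oracle) (w : List Bool), RunsIn O (.seq wordToList (.seq P₀ (testFinished F)))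
      (Function.update (fun _ => []) 0 w) (mainRegs F (initialState w))
      (18 * w.length + g₀ (4 * w.length + 1) + 13) := by
    intro O w
    have e1 := wordToList_runs (O := O) w [] fun _ => []
    simp only [e0] at e1
    have e2 := (h₀ O w).2 [] (fun _ => []) fun _ _ _ => rfl
    rw [List.append_nil, List.append_nil] at e2
    refine (e1.seq (e2.seq (testFinished_runs hF _))).mono ?_
    have : size w ≤ 4 * w.length + 1 := by
      have := size_le_of_forall (l := w) (B := 3) fun b _ => size_bool_le b
      linarith
    have := hg₀.1 this
    omega
  have hpre : ∀ (O : Oracle) (w : List Bool) (ω : ℕ → Bool),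
      ∃ t ≤ 18 * w.length + g₀ (4 * w.length + 1) + 15,
        (step O)^[t] ⟨[mainProg F P₀ P P₁], Function.update (fun _ => []) 0 w, ω⟩ =
          ⟨[.loop F (loopBody F P), .seq P₁ readList], mainRegs F (initialState w), ω⟩ := by
    intro O w ω
    obtain ⟨t, ht, e⟩ := hstart O w
    refine ⟨1 + (t + 1), by omega, ?_⟩
    rw [Function.iterate_add_apply, Function.iterate_succ_apply, mainProg]
    exact congrArg (step O) (e _ ω)
  -- The summands account for conversion of the input and the initial state, for at most `T` passes
  -- of the loop on states of size at most `S`, and for computing and writing the result; by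
  -- monotonicity one argument `m = w.length + T + S` serves them all.
  refine ⟨mainProg F P₀ P P₁, fun m => 18 * m + g₀ (4 * m + 1) + m * (g (m + 4) + 30) +
    13 * g₁ m + 100, ?_, fun O w ω T => ⟨fun S hS hfin => ?_, fun hfin => ?_⟩⟩
  · exact (((((PolyBounded.const 18).mul .id).add (hg₀.comp (((PolyBounded.const 4).mul .id).add
      (.const 1)))).add (PolyBounded.id.mul ((hg.comp (PolyBounded.id.add (.const 4))).add
      (.const 30)))).add ((PolyBounded.const 13).mul hg₁)).add (.const 100)
  · obtain ⟨t₁, ht₁, e₁⟩ := hpre O w ω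
    obtain ⟨t₂, ω', ht₂, e₂, -⟩ := loop_evolve hF hg.1 hP S T (initialState w) ω hS
      [.seq P₁ readList]
    have hsize := h₁ O (evolve O T (initialState w) ω)
    have hS' := hg₁.1 (hS T le_rfl)
    set σ := evolve O T (initialState w) ω
    have e₃ := hsize.2 [] (fun _ => []) fun _ _ _ => rfl
    have e₄ := readList_runs (O := O) (result σ) [] [] [] fun _ => []
    simp only [List.append_nil, e0] at e₃ e₄
    obtain ⟨t₃, ht₃, e₅⟩ := e₃.seq e₄
    have hlen := length_lt_size (result σ)
    have ht : t₃ + 1 + t₂ + t₁ ≤ 18 * (w.length + T + S) + g₀ (4 * (w.length + T + S) + 1) +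
        (w.length + T + S) * (g (w.length + T + S + 4) + 30) + 13 * g₁ (w.length + T + S) + 100 := by
      have a1 := hg₀.1 (show 4 * w.length + 1 ≤ 4 * (w.length + T + S) + 1 by omega)
      have a2 := hg₁.1 (show S ≤ w.length + T + S by omega)
      have a3 := Nat.mul_le_mul (show T ≤ w.length + T + S by omega)
        (Nat.add_le_add_right (hg.1 (show S + 4 ≤ w.length + T + S + 4 by omega)) 30)
      have a4 : size (result σ) ≤ _ := hsize.1
      omega
    have e₆ : run (mainProg F P₀ P P₁) O w ω (t₃ + 1 + t₂ + t₁) =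
        ⟨[], regs [] (result σ).reverse [] [] fun _ => [], ω'⟩ := by
      have hexit : step O ⟨[.loop F (loopBody F P), .seq P₁ readList], mainRegs F σ, ω'⟩ =
          ⟨[.seq P₁ readList], Function.update (fun _ => []) 0 (code σ), ω'⟩ := by
        have : mainRegs F σ = Function.update (fun _ => []) 0 (code σ) := by
          rw [mainRegs, if_pos hfin]
          exact congrArg (fun s : Regs => Function.update s 0 (code σ)) (Function.update_eq_self F _)
        rw [this]
        simp only [step, Function.update_of_ne hF]
      rw [run, Function.iterate_add_apply, e₁, Function.iterate_add_apply, e₂,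
        Function.iterate_succ_apply, hexit]
      exact e₅ [] ω'
    rw [run_of_finished (by rw [e₆]) ht, e₆]
    exact ⟨rfl, rfl⟩
  · obtain ⟨t₁, ht₁, e₁⟩ := hpre O w ω
    -- Only the lower bound on the time matters here, so any bound on the sizes will do, for
    -- instance their sum.
    obtain ⟨t₂, ω', -, e₂, ht₂⟩ := loop_evolve hF hg.1 hP
      (∑ t ∈ Finset.range (T + 1), size (evolve O t (initialState w) ω)) T (initialState w) ω
      (fun t ht => Finset.single_le_sum (f := fun t => size (evolve O t (initialState w) ω))
        (fun _ _ => Nat.zero_le _) (Finset.mem_range.mpr (by omega))) [.seq P₁ readList]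
    intro hT
    -- Had the machine halted by time `T`, it would be frozen from then on; but at the later time
    -- `t₂ + t₁` the loop is still to be executed.
    have := run_of_finished hT (show T ≤ t₂ + t₁ by have := ht₂ hfin; omega)
    rw [← this, run, Function.iterate_add_apply, e₁, e₂] at hT
    simp at hT

end GK

namespace GK

/-! ### Coin tosses -/

open MeasureTheory

instance : IsProbabilityMeasure fairCoins := by
  unfold fairCoins
  infer_instance

theorem coin_singleton (b : Bool) : (PMF.uniformOfFintype Bool).toMeasure {b} = 1 / 2 := by
  rw [PMF.toMeasure_apply_singleton _ _ (MeasurableSet.singleton b)]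
  simp

theorem measurable_shift : Measurable fun (ω : ℕ → Bool) j => ω (j + 1) :=
  measurable_pi_lambda _ fun j => measurable_pi_apply (j + 1)

theorem measurableSet_head (b : Bool) : MeasurableSet {ω : ℕ → Bool | ω 0 = b} :=
  (measurable_pi_apply (X := fun _ : ℕ => Bool) 0) (MeasurableSet.singleton b)

/-- Given the first toss, the remaining tosses are again independent and fair. By uniqueness of the
infinite product it suffices to compare both measures on boxes with finitely many constraints. -/
theorem fairCoins_shift (b : Bool) :
    (2 : ENNReal) • (fairCoins.restrict {ω | ω 0 = b}).map (fun ω j => ω (j + 1)) = fairCoins := by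
  refine Measure.eq_infinitePi _ fun s t ht => ?_
  have hm : MeasurableSet (Set.pi (s : Set ℕ) t) :=
    MeasurableSet.pi s.countable_toSet fun i _ => ht i
  rw [Measure.smul_apply, Measure.map_apply measurable_shift hm,
    Measure.restrict_apply (measurable_shift hm)]
  -- The preimage is again a box: the constraints move up by one, and `{b}` is added at index 0.
  have e : ((fun (ω : ℕ → Bool) j => ω (j + 1)) ⁻¹' Set.pi (s : Set ℕ) t) ∩ {ω | ω 0 = b} =
      Set.pi ((insert 0 (s.map ⟨Nat.succ, Nat.succ_injective⟩) : Finset ℕ) : Set ℕ)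
        fun i => Nat.casesOn (motive := fun _ => Set Bool) i {b} t := by
    ext ω
    simp [Set.mem_pi, and_comm]
  rw [e, fairCoins, Measure.infinitePi_pi]
  · rw [Finset.prod_insert (by simp), Finset.prod_map]
    change 2 * ((PMF.uniformOfFintype Bool).toMeasure {b} * ∏ i ∈ s, _) = _
    rw [coin_singleton, ← mul_assoc, one_div, ENNReal.mul_inv_cancel (by simp) (by simp), one_mul]
    rfl
  · intro i _
    cases i with
    | zero => exact MeasurableSet.singleton b
    | succ i => exact ht i

/-- Condition on the first coin. -/
theorem fairCoins_cons {R : Bool → Set (ℕ → Bool)} (hR : ∀ b, MeasurableSet (R b)) :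
    fairCoins.real {ω | (fun j => ω (j + 1)) ∈ R (ω 0)} =
      (fairCoins.real (R true) + fairCoins.real (R false)) / 2 := by
  have h : ∀ b, fairCoins.real ({ω | (fun j => ω (j + 1)) ∈ R b} ∩ {ω | ω 0 = b}) =
      fairCoins.real (R b) / 2 := by
    intro b
    have := congrArg (fun μ : Measure (ℕ → Bool) => μ.real (R b)) (fairCoins_shift b)
    simp only [Measure.real, Measure.smul_apply, Measure.map_apply measurable_shift (hR b),
      Measure.restrict_apply (measurable_shift (hR b)), smul_eq_mul, ENNReal.toReal_mul] at this ⊢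
    rw [← this]
    simp
    rfl
  have hd : {ω : ℕ → Bool | (fun j => ω (j + 1)) ∈ R (ω 0)} =
      ({ω | (fun j => ω (j + 1)) ∈ R true} ∩ {ω | ω 0 = true}) ∪
        ({ω | (fun j => ω (j + 1)) ∈ R false} ∩ {ω | ω 0 = false}) := by
    ext ω
    simp only [Set.mem_ofPred_eq, Set.mem_union, Set.mem_inter_iff]
    cases ω 0 <;> simp
  rw [hd, measureReal_union, h, h, add_div]
  · rw [Set.disjoint_left]
    rintro ω ⟨-, h1⟩ ⟨-, h2⟩
    simp_all
  · exact (measurable_shift (hR false)).inter (measurableSet_head false)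

theorem measurableSet_cons {R : Bool → Set (ℕ → Bool)} (hR : ∀ b, MeasurableSet (R b)) :
    MeasurableSet {ω : ℕ → Bool | (fun j => ω (j + 1)) ∈ R (ω 0)} := by
  have hd : {ω : ℕ → Bool | (fun j => ω (j + 1)) ∈ R (ω 0)} =
      ⋃ b, ({ω | (fun j => ω (j + 1)) ∈ R b} ∩ {ω | ω 0 = b}) := by
    ext ω
    simp
  rw [hd]
  exact MeasurableSet.iUnion fun b => (measurable_shift (hR b)).inter (measurableSet_head b)

/-- The state after `T` steps depends on `T` coins only; splitting off one coin at a time makes the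
event measurable for an arbitrary predicate `Q`. -/
theorem measurableSet_evolve (O : Oracle) (T : ℕ) (σ : State) (Q : State → Prop) :
    MeasurableSet {ω | Q (evolve O T σ ω)} := by
  induction T generalizing σ with
  | zero => exact MeasurableSet.const (Q σ)
  | succ T ih =>
    exact measurableSet_cons (R := fun b => {ω | Q (evolve O T (advance O (b, σ)) ω)})
      fun b => ih _

/-- The probability that the process has not finished after `T` steps. -/
noncomputable def delay (O : Oracle) (T : ℕ) (σ : State) : ℝ :=
  fairCoins.real {ω | (evolve O T σ ω).1 ≠ []}

theorem delay_le_one (O : Oracle) (T : ℕ) (σ : State) : delay O T σ ≤ 1 := measureReal_le_one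

theorem delay_of_finished (O : Oracle) (T : ℕ) {σ : State} (h : σ.1 = []) : delay O T σ = 0 := by
  simp [delay, evolve_of_finished T _ h, h]

theorem delay_succ (O : Oracle) (T : ℕ) (σ : State) :
    delay O (T + 1) σ = (delay O T (advance O (true, σ)) + delay O T (advance O (false, σ))) / 2 :=
  fairCoins_cons (R := fun b => {ω | (evolve O T (advance O (b, σ)) ω).1 ≠ []})
    fun _ => measurableSet_evolve O T _ fun σ => σ.1 ≠ []

/-- The probability that the process finishes with the result `y`. -/
noncomputable def hitProb (O : Oracle) (y : List Bool) (σ : State) : ℝ :=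
  fairCoins.real {ω | ∃ T, (evolve O T σ ω).1 = [] ∧ result (evolve O T σ ω) = y}

theorem hitProb_nonneg (O : Oracle) (y : List Bool) (σ : State) : 0 ≤ hitProb O y σ :=
  measureReal_nonneg

theorem hitProb_le_one (O : Oracle) (y : List Bool) (σ : State) : hitProb O y σ ≤ 1 :=
  measureReal_le_one

open Classical in
theorem hitProb_of_finished (O : Oracle) (y : List Bool) {σ : State} (h : σ.1 = []) :
    hitProb O y σ = if result σ = y then 1 else 0 := by
  simp only [hitProb, evolve_of_finished _ _ h, h, true_and, exists_const]
  split_ifs with hy <;> simp [hy]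

/-- An unfinished state does not count at time 0, so the event concerns the state after the first
step, and one conditions on the first coin. -/
theorem hitProb_eq (O : Oracle) (y : List Bool) {σ : State} (h : σ.1 ≠ []) :
    hitProb O y σ =
      (hitProb O y (advance O (true, σ)) + hitProb O y (advance O (false, σ))) / 2 := by
  have hm : ∀ σ, MeasurableSet {ω | ∃ T, (evolve O T σ ω).1 = [] ∧ result (evolve O T σ ω) = y} := by
    intro σ
    rw [Set.ofPred_exists]
    exact MeasurableSet.iUnion fun T => measurableSet_evolve O T σ fun σ => σ.1 = [] ∧ result σ = y
  rw [hitProb, hitProb, hitProb, ← fairCoins_cons (R := fun b => {ω | ∃ T,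
    (evolve O T (advance O (b, σ)) ω).1 = [] ∧ result (evolve O T (advance O (b, σ)) ω) = y})
    fun b => hm _]
  congr 1
  ext ω
  constructor
  · rintro ⟨T, h1, h2⟩
    cases T with
    | zero => exact absurd h1 h
    | succ T => exact ⟨T, h1, h2⟩
  · rintro ⟨T, h1, h2⟩
    exact ⟨T + 1, h1, h2⟩

end GK

namespace GK

/-! ### Drawing from binary digits -/

/-- The number of undecided paths at depth `j`, if `N k` paths end at depth `k`. -/
def nodes (N : ℕ → ℕ) : ℕ → ℕ
  | 0 => 1
  | j + 1 => 2 * (nodes N j - N j)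

/-- Kraft equality at every depth: a node at depth `j` carries weight 1 after rescaling by `2 ^ j`,
and this weight is exhausted by the leaves at depth `j` or below. Removing the leaves at depth `j`
and doubling gives the next depth. -/
theorem hasSum_nodes {N : ℕ → ℕ} (hN : HasSum (fun j => (N j : ℝ) * (1 / 2) ^ j) 1)
    (j : ℕ) : HasSum (fun k => (N (k + j) : ℝ) * (1 / 2) ^ k) (nodes N j) := by
  induction j with
  | zero => simpa [nodes] using hN
  | succ j ih =>
    -- The recursion of `nodes` uses truncated subtraction; this inequality shows that nothing is
    -- truncated.
    have h0 : (N j : ℝ) ≤ nodes N j := by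
      have := le_hasSum ih 0 fun k _ => by positivity
      simpa using this
    have h1 := (hasSum_nat_add_iff' 1).mpr ih
    have h2 := h1.mul_left 2
    have e : ((nodes N (j + 1) : ℕ) : ℝ) = 2 * ((nodes N j : ℝ) - N j) := by
      rw [nodes, Nat.cast_mul, Nat.cast_sub (by exact_mod_cast h0)]
      norm_num
    rw [e]
    refine (congrArg₂ HasSum ?_ ?_).mp h2
    · funext k
      rw [show k + 1 + j = k + (j + 1) by ring, pow_succ]
      ring
    · simp

theorem le_nodes {N : ℕ → ℕ} (hN : HasSum (fun j => (N j : ℝ) * (1 / 2) ^ j) 1)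
    (j : ℕ) : N j ≤ nodes N j := by
  have := le_hasSum (hasSum_nodes hN j) 0 fun k _ => by positivity
  have h : (N j : ℝ) ≤ nodes N j := by simpa using this
  exact_mod_cast h

/-- The number of nodes is the rescaled weight of the leaves to come, which is dominated by the
geometric series with sum `2 * B`. -/
theorem nodes_le {N : ℕ → ℕ} (hN : HasSum (fun j => (N j : ℝ) * (1 / 2) ^ j) 1)
    {B : ℕ} (hB : ∀ j, N j ≤ B) (j : ℕ) : nodes N j ≤ 2 * B := by
  have h1 := hasSum_geometric_two.mul_left (B : ℝ)
  have h2 := hasSum_le (fun k => mul_le_mul_of_nonneg_right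
    (Nat.cast_le (α := ℝ).mpr (hB (k + j))) (by positivity)) (hasSum_nodes hN j) h1
  have h3 : (nodes N j : ℝ) ≤ ((2 * B : ℕ) : ℝ) := by push_cast; linarith
  exact_mod_cast h3

/-- Without leaves at depth `L` or below there is no weight to share, hence no node. -/
theorem nodes_eq_zero {N : ℕ → ℕ} (hN : HasSum (fun j => (N j : ℝ) * (1 / 2) ^ j) 1)
    {L j : ℕ} (hL : ∀ k, L ≤ k → N k = 0) (hj : L ≤ j) : nodes N j = 0 := by
  have h := hasSum_nodes hN j
  have e : (fun k => (N (k + j) : ℝ) * (1 / 2) ^ k) = fun _ => 0 := by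
    funext k
    rw [hL (k + j) (by omega)]
    simp
  rw [e] at h
  exact_mod_cast h.unique hasSum_zero

theorem sum_range_two_mul (h : ℕ → ℝ) (m : ℕ) :
    ∑ d ∈ Finset.range m, (h (2 * d) + h (2 * d + 1)) = ∑ e ∈ Finset.range (2 * m), h e := by
  induction m with
  | zero => simp
  | succ m ih =>
    rw [Finset.sum_range_succ, ih, show 2 * (m + 1) = 2 * m + 1 + 1 by ring, Finset.sum_range_succ,
      Finset.sum_range_succ, add_assoc]

/-- The nodes of a level are numbered with the leaves first. The inner node in position `d` after
them has the children `2 * d` and `2 * d + 1`, so the children exactly fill the next level. -/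
theorem sum_nodes {N : ℕ → ℕ} (hN : HasSum (fun j => (N j : ℝ) * (1 / 2) ^ j) 1) (j : ℕ)
    (f h : ℕ → ℝ)
    (hf : ∀ d, N j + d < nodes N j → f (N j + d) = (h (2 * d) + h (2 * d + 1)) / 2) :
    ∑ e ∈ Finset.range (nodes N j), f e =
      ∑ e ∈ Finset.range (N j), f e + (∑ e ∈ Finset.range (nodes N (j + 1)), h e) / 2 := by
  obtain ⟨m, hm⟩ := Nat.exists_eq_add_of_le (le_nodes hN j)
  have e : nodes N (j + 1) = 2 * m := by rw [nodes, hm]; simp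
  rw [e, hm, Finset.sum_range_add, ← sum_range_two_mul, Finset.sum_div]
  congr 1
  refine Finset.sum_congr rfl fun d hd => hf d ?_
  rw [hm]
  exact Nat.add_lt_add_left (Finset.mem_range.mp hd) _

/-- The value at the root of a quantity that is an average over the branches at the undecided
paths. -/
theorem hasSum_of_average {N : ℕ → ℕ} (hN : HasSum (fun j => (N j : ℝ) * (1 / 2) ^ j) 1) {B : ℕ}
    (hB : ∀ j, N j ≤ B) {v : ℕ → ℕ → ℝ} (h0 : ∀ j e, 0 ≤ v j e) (h1 : ∀ j e, v j e ≤ 1)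
    (hv : ∀ j d, N j + d < nodes N j →
      v j (N j + d) = (v (j + 1) (2 * d) + v (j + 1) (2 * d + 1)) / 2) :
    HasSum (fun j => (∑ e ∈ Finset.range (N j), v j e) * (1 / 2) ^ j) (v 0 0) := by
  -- The first `J` levels are unrolled. The contribution of the nodes still open at depth `J` is at
  -- most `2 * B / 2 ^ J` and disappears in the limit.
  have hpart : ∀ J, v 0 0 = ∑ j ∈ Finset.range J, (∑ e ∈ Finset.range (N j), v j e) * (1 / 2) ^ j +
      (∑ e ∈ Finset.range (nodes N J), v J e) * (1 / 2) ^ J := by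
    intro J
    induction J with
    | zero => simp [nodes]
    | succ J ih =>
      rw [ih, sum_nodes hN J _ _ (hv J), Finset.sum_range_succ, pow_succ]
      ring
  rw [hasSum_iff_tendsto_nat_of_nonneg fun j => mul_nonneg (Finset.sum_nonneg fun e _ => h0 j e)
    (by positivity)]
  have hrest : Filter.Tendsto (fun J => (∑ e ∈ Finset.range (nodes N J), v J e) * (1 / 2) ^ J)
      Filter.atTop (nhds 0) := by
    have ht : Filter.Tendsto (fun J : ℕ => ((2 * B : ℕ) : ℝ) * (1 / 2) ^ J) Filter.atTop (nhds 0) := by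
      have := (tendsto_pow_atTop_nhds_zero_of_lt_one (r := (1 / 2 : ℝ)) (by norm_num)
        (by norm_num)).const_mul ((2 * B : ℕ) : ℝ)
      rwa [mul_zero] at this
    refine squeeze_zero (fun J => mul_nonneg (Finset.sum_nonneg fun e _ => h0 J e) (by positivity))
      (fun J => mul_le_mul_of_nonneg_right ?_ (by positivity)) ht
    calc ∑ e ∈ Finset.range (nodes N J), v J e ≤ ∑ e ∈ Finset.range (nodes N J), 1 :=
          Finset.sum_le_sum fun e _ => h1 J e
      _ = nodes N J := by simp
      _ ≤ ((2 * B : ℕ) : ℝ) := Nat.cast_le.mpr (nodes_le hN hB J)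
  have := (tendsto_const_nhds (x := v 0 0)).sub hrest
  rw [sub_zero] at this
  refine this.congr fun J => ?_
  have := hpart J
  linarith

/-! The states of the process -/

/-- The state with the given remaining length, circuit, qubit, results, depth and position. -/
def mkState (rem w : List Bool) (i : ℕ) (acc : List (((Bool × Bool) × Bool) × Bool)) (j e : ℕ) :
    State :=
  (rem, ((w, List.replicate i true), acc), (List.replicate j true, List.replicate e true))

/-- The states whose probability has the digit `1` at position `j`. -/
def digitList (O : Oracle) (i j : ℕ) : List BasisState :=
  digits O (List.replicate i true) (List.replicate j true) stateList

/-- At a leaf the coin is not needed for branching. It is recorded together with the drawn state and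
serves as the random bit for the measurement. -/
theorem advance_mkState_of_lt {O : Oracle} {r : Bool} {rem w : List Bool} {i : ℕ}
    {acc : List (((Bool × Bool) × Bool) × Bool)} {j e : ℕ} (b : Bool)
    (h : e < (digitList O i j).length) :
    advance O (b, mkState (r :: rem) w i acc j e) =
      mkState rem w (i + 1) (((digitList O i j)[e].stab, b) :: acc) 0 0 := by
  have hd : ((digitList O i j).map BasisState.stab).drop e =
      (digitList O i j)[e].stab :: ((digitList O i j).map BasisState.stab).drop (e + 1) := by
    rw [List.drop_eq_getElem_cons (by simpa using h), List.getElem_map]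
  have h2 : advanceWith ((digitList O i j).map BasisState.stab, b, mkState (r :: rem) w i acc j e) =
      mkState rem w (i + 1) (((digitList O i j)[e].stab, b) :: acc) 0 0 := by
    simp only [advanceWith, mkState, List.length_replicate, hd]
    rfl
  exact h2

/-- At an inner node the coin selects one of the two children in the numbering of `sum_nodes`. -/
theorem advance_mkState_of_le {O : Oracle} {r : Bool} {rem w : List Bool} {i : ℕ}
    {acc : List (((Bool × Bool) × Bool) × Bool)} {j d : ℕ} (b : Bool) :
    advance O (b, mkState (r :: rem) w i acc j ((digitList O i j).length + d)) =
      mkState (r :: rem) w i acc (j + 1) (2 * d + b.toNat) := by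
  have hd : ((digitList O i j).map BasisState.stab).drop ((digitList O i j).length + d) = [] := by
    rw [List.drop_of_length_le (by simp)]
  have h2 : advanceWith ((digitList O i j).map BasisState.stab, b,
      mkState (r :: rem) w i acc j ((digitList O i j).length + d)) =
      mkState (r :: rem) w i acc (j + 1) (2 * d + b.toNat) := by
    simp only [advanceWith, mkState, List.length_replicate, hd, List.length_map]
    cases b <;> simp [List.replicate_succ, two_mul]
  exact h2

theorem queryWord_replicate {n : ℕ} (i : Fin n) (j : ℕ) (a : BasisState) :
    queryWord (List.replicate i true) (List.replicate j true) a = address i a j := by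
  simp [queryWord, address, encodeNat]

theorem sum_stateList (g : BasisState → ℝ) : (stateList.map g).sum = ∑ a, g a := by
  rw [show (Finset.univ : Finset BasisState) = stateList.toFinset by rfl,
    List.sum_toFinset _ (by decide)]

theorem sum_digitList {n : ℕ} (O : Oracle) (i : Fin n) (j : ℕ) (g : BasisState → ℝ) :
    ((digitList O i j).map g).sum = ∑ a, if O (address i a j) = some true then g a else 0 := by
  have h : ∀ l : List BasisState, ((digits O (List.replicate i true) (List.replicate j true) l).map
      g).sum = (l.map fun a => if O (address i a j) = some true then g a else 0).sum := by
    intro l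
    induction l with
    | nil => rfl
    | cons a l ih =>
      simp only [digits, List.filter_cons, queryWord_replicate, List.map_cons, List.sum_cons,
        beq_iff_eq] at ih ⊢
      split_ifs <;> simp [ih]
  rw [digitList, h, sum_stateList]

theorem length_digitList_le (O : Oracle) (i j : ℕ) : (digitList O i j).length ≤ 6 :=
  List.length_filter_le _ _

/-- Here the probabilities enter: the leaves labelled `a` have the total weight given by the binary
expansion, that is `p i a`, so a weighted sum over all leaves is an expectation. -/
theorem hasSum_digitList {n : ℕ} {O : Oracle} {p : Fin n → BasisState → ℝ} (hO : Represents O p)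
    (i : Fin n) (g : BasisState → ℝ) :
    HasSum (fun j => ((digitList O i j).map g).sum * (1 / 2) ^ j) (∑ a, p i a * g a) := by
  have h := hasSum_sum (s := Finset.univ) fun (a : BasisState) _ => ((hO i a).2).mul_right (g a)
  refine (congrArg (HasSum · _) ?_).mp h
  funext j
  rw [sum_digitList, Finset.sum_mul]
  refine Finset.sum_congr rfl fun a _ => ?_
  split_ifs <;> ring

theorem hasSum_length_digitList {n : ℕ} {O : Oracle} {p : Fin n → BasisState → ℝ}
    (hO : Represents O p) (hp : ∀ i, ∑ a, p i a = 1) (i : Fin n) :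
    HasSum (fun j => ((digitList O i j).length : ℝ) * (1 / 2) ^ j) 1 := by
  have := hasSum_digitList hO i fun _ => 1
  simpa [hp i] using this

end GK

namespace GK

/-! ### The law of the result -/

variable {n : ℕ} {O : Oracle} {p : Fin n → BasisState → ℝ}

/-- The results of the process for draws of initial states and coins. -/
def drawn (l : List (BasisState × Bool)) : List (((Bool × Bool) × Bool) × Bool) :=
  l.map fun a => (a.1.stab, a.2)

theorem sum_range_getElem {v : ℕ → ℝ} {l : List BasisState} {g : BasisState → ℝ}
    (h : ∀ e (he : e < l.length), v e = g l[e]) :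
    ∑ e ∈ Finset.range l.length, v e = (l.map g).sum := by
  rw [Finset.sum_range, ← List.ofFn_getElem_eq_map, List.sum_ofFn]
  exact Finset.sum_congr rfl fun e _ => h e e.2

open Classical in
-- Along the walk for one qubit the probability of the final result is the average over the two
-- children of a node. So its value at the root is the weighted sum of the values at the leaves, and
-- this is the expectation over the draw of that qubit; the induction is over the qubits that are
-- left.
theorem hitProb_mkState (hO : Represents O p) (hp : ∀ i, ∑ a, p i a = 1) (w y rem : List Bool)
    (i : ℕ) (hi : rem.length + i = n) (l : List (BasisState × Bool)) :
    hitProb O y (mkState rem w i (drawn l) 0 0) =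
      expect ((List.ofFn fun i (a : BasisState × Bool) => p i a.1 / 2).drop i)
        (fun l => if simulate (w, drawn l) = y then 1 else 0) l := by
  induction rem generalizing i l with
  | nil =>
    rw [hitProb_of_finished _ _ rfl, List.drop_of_length_le (by simp at hi ⊢; omega)]
    rfl
  | cons r rem ih =>
    have hin : i < n := by simp at hi; omega
    have hN := hasSum_length_digitList hO hp ⟨i, hin⟩
    -- The value at a leaf labelled `a`, averaged over the coin that becomes the random bit of this
    -- qubit.
    let g : BasisState → ℝ := fun a =>
      (hitProb O y (mkState rem w (i + 1) (drawn ((a, true) :: l)) 0 0) +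
        hitProb O y (mkState rem w (i + 1) (drawn ((a, false) :: l)) 0 0)) / 2
    have h1 := hasSum_of_average hN (fun j => length_digitList_le O i j)
      (v := fun j e => hitProb O y (mkState (r :: rem) w i (drawn l) j e))
      (fun j e => hitProb_nonneg _ _ _) (fun j e => hitProb_le_one _ _ _)
      (fun j d _ => by
        have := hitProb_eq O y (σ := mkState (r :: rem) w i (drawn l) j
          ((digitList O i j).length + d)) (by simp [mkState])
        rw [advance_mkState_of_le, advance_mkState_of_le, add_comm (hitProb _ _ _)] at this
        exact this)
    have h2 : ∀ j, ∑ e ∈ Finset.range (digitList O i j).length,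
        hitProb O y (mkState (r :: rem) w i (drawn l) j e) = ((digitList O i j).map g).sum := by
      intro j
      refine sum_range_getElem fun e he => ?_
      rw [hitProb_eq O y (by simp [mkState]), advance_mkState_of_lt _ he,
        advance_mkState_of_lt _ he]
      rfl
    simp only [h2] at h1
    rw [h1.unique (hasSum_digitList hO ⟨i, hin⟩ g), List.drop_eq_getElem_cons (by simpa using hin),
      expect, Fintype.sum_prod_type]
    refine Finset.sum_congr rfl fun a _ => ?_
    have e := ih (i + 1) (by simp at hi; omega)
    rw [Fintype.sum_bool, ← e, ← e]
    simp only [g, List.getElem_ofFn]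
    ring

/-- Let `S T j` be the total delay over all nodes at depth `j`, and let `r` be the number of later
qubits. The at most six leaves and the halving of inner nodes give `S (T + 1) j ≤ 6 * 24 ^ r * (3 /
4) ^ T + S T (j + 1) / 2`. A bound `c * (3 / 4) ^ T` is reproduced when `6 * 24 ^ r + c / 2 = 3 / 4
* c`, that is for `c = 24 ^ (r + 1)`. -/
theorem delay_mkState (hO : Represents O p) (hp : ∀ i, ∑ a, p i a = 1) (w rem : List Bool)
    (i : ℕ) (hi : rem.length + i = n) (acc : List (((Bool × Bool) × Bool) × Bool)) (T : ℕ) :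
    delay O T (mkState rem w i acc 0 0) ≤ 24 ^ rem.length * (3 / 4) ^ T := by
  induction rem generalizing i acc T with
  | nil =>
    rw [delay_of_finished _ _ rfl]
    positivity
  | cons r rem ih =>
    have hin : i < n := by simp at hi; omega
    have hN := hasSum_length_digitList hO hp ⟨i, hin⟩
    -- The whole level is estimated at once, since the recursion relates sums over levels; the root
    -- is the only node at depth 0.
    have key : ∀ T j, ∑ e ∈ Finset.range (nodes (fun j => (digitList O i j).length) j),
        delay O T (mkState (r :: rem) w i acc j e) ≤ 24 ^ (rem.length + 1) * (3 / 4) ^ T := by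
      intro T
      induction T with
      | zero =>
        intro j
        calc _ ≤ ∑ e ∈ Finset.range (nodes (fun j => (digitList O i j).length) j), (1 : ℝ) :=
              Finset.sum_le_sum fun e _ => delay_le_one _ _ _
          _ = nodes (fun j => (digitList O i j).length) j := by simp
          _ ≤ ((2 * 6 : ℕ) : ℝ) := Nat.cast_le.mpr (nodes_le hN (length_digitList_le O i) j)
          _ ≤ 24 ^ (rem.length + 1) * (3 / 4) ^ 0 := by
            have : (1 : ℝ) ≤ 24 ^ rem.length := one_le_pow₀ (by norm_num)
            rw [pow_succ]
            norm_num
            linarith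
      | succ T ihT =>
        intro j
        rw [sum_nodes hN j _ (fun e => delay O T (mkState (r :: rem) w i acc (j + 1) e))
          fun d _ => by
            have := delay_succ O T (mkState (r :: rem) w i acc j ((digitList O i j).length + d))
            rw [advance_mkState_of_le, advance_mkState_of_le, add_comm (delay _ _ _)] at this
            exact this]
        have h1 := ihT (j + 1)
        have h2 : ∑ e ∈ Finset.range (digitList O i j).length,
            delay O (T + 1) (mkState (r :: rem) w i acc j e) ≤
            6 * (24 ^ rem.length * (3 / 4) ^ T) := by
          calc _ ≤ ∑ e ∈ Finset.range (digitList O i j).length, 24 ^ rem.length * (3 / 4 : ℝ) ^ T := by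
                refine Finset.sum_le_sum fun e he => ?_
                have he := Finset.mem_range.mp he
                rw [delay_succ, advance_mkState_of_lt _ he, advance_mkState_of_lt _ he]
                have a1 := ih (i + 1) (by simp at hi; omega)
                  (((digitList O i j)[e].stab, true) :: acc) T
                have a2 := ih (i + 1) (by simp at hi; omega)
                  (((digitList O i j)[e].stab, false) :: acc) T
                linarith
            _ = (digitList O i j).length * (24 ^ rem.length * (3 / 4 : ℝ) ^ T) := by simp
            _ ≤ _ := mul_le_mul_of_nonneg_right (by exact_mod_cast length_digitList_le O i j)
              (by positivity)
        rw [pow_succ (24 : ℝ)] at h1 ⊢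
        rw [pow_succ (3 / 4 : ℝ)]
        linarith
    simpa [nodes] using key T 0

/-! ### Reachable states -/

/-- What is known about the states that are reached after `T` steps. -/
def Reachable (O : Oracle) (n : ℕ) (w : List Bool) (T : ℕ) (σ : State) : Prop :=
  ∃ rem i acc j e, σ = mkState rem w i acc j e ∧ rem.length + i = n ∧ acc.length = i ∧ j ≤ T ∧
    e ≤ 12 ∧ (i < n → e < nodes (fun j => (digitList O i j).length) j) ∧
    ∀ L, (∀ i j, i < n → L ≤ j → nodes (fun j => (digitList O i j).length) j = 0) →
      i < n → T ≤ i * L + j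

/-- For the time bound: if no node lies at depth `L` or below, a qubit is finished from a depth `j <
L` and has used `j + 1 ≤ L` tosses, so the bound `i * L + j` becomes `(i + 1) * L`. -/
theorem Reachable.advance (hO : Represents O p) (hp : ∀ i, ∑ a, p i a = 1) {w : List Bool} {T : ℕ}
    {σ : State} (h : Reachable O n w T σ) (b : Bool) :
    Reachable O n w (T + 1) (advance O (b, σ)) := by
  obtain ⟨rem, i, acc, j, e, rfl, h1, h2, h3, h4, h5, h6⟩ := h
  cases rem with
  | nil =>
    have hadv : GK.advance O (b, mkState [] w i acc j e) = mkState [] w i acc j e := rfl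
    rw [hadv]
    exact ⟨[], i, acc, j, e, rfl, h1, h2, by omega, h4, h5, fun L _ hi => by simp at h1; omega⟩
  | cons r rem =>
    have hin : i < n := by simp at h1; omega
    have hN := hasSum_length_digitList hO hp ⟨i, hin⟩
    have h7 := h5 hin
    by_cases he : e < (digitList O i j).length
    · rw [advance_mkState_of_lt b he]
      refine ⟨rem, i + 1, _, 0, 0, rfl, by simp at h1; omega, by simp [h2], by omega, by omega,
        fun _ => by simp [nodes], fun L hL hi => ?_⟩
      have h8 := h6 L hL hin
      -- The current position is a node of its level, so the level is not empty.
      have h9 : j < L := by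
        by_contra hj
        have := hL i j hin (by omega)
        omega
      rw [Nat.succ_mul]
      omega
    · obtain ⟨d, rfl⟩ := Nat.exists_eq_add_of_le (Nat.le_of_not_lt he)
      rw [advance_mkState_of_le]
      have h8 : 2 * d + b.toNat < nodes (fun j => (digitList O i j).length) (j + 1) := by
        have := Bool.toNat_le b
        rw [nodes]
        omega
      have h9 := nodes_le hN (length_digitList_le O i) (j + 1)
      refine ⟨r :: rem, i, acc, j + 1, _, rfl, h1, h2, by omega, ?_, fun _ => h8,
        fun L hL hi => ?_⟩
      · exact (h8.le.trans h9)
      · have := h6 L hL hi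
        omega

theorem Reachable.evolve (hO : Represents O p) (hp : ∀ i, ∑ a, p i a = 1) {w : List Bool} {T : ℕ}
    {σ : State} (h : Reachable O n w T σ) (t : ℕ) (ω : ℕ → Bool) :
    Reachable O n w (T + t) (evolve O t σ ω) := by
  induction t generalizing T σ ω with
  | zero => exact h
  | succ t ih =>
    have := ih (h.advance hO hp (ω 0)) fun j => ω (j + 1)
    rwa [show T + 1 + t = T + (t + 1) by ring] at this

theorem size_bits_le (l : List Bool) : size l ≤ 4 * l.length + 1 := by
  have := size_le_of_forall (l := l) (B := 3) fun b _ => size_bool_le b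
  linarith

theorem Reachable.size_le {w : List Bool} {T : ℕ} {σ : State} (h : Reachable O n w T σ) :
    size σ ≤ 4 * w.length + 20 * n + 4 * T + 60 := by
  obtain ⟨rem, i, acc, j, e, rfl, h1, h2, h3, h4, -, -⟩ := h
  have a1 := size_bits_le rem
  have a2 := size_bits_le w
  have a3 := size_bits_le (List.replicate i true)
  have a4 := size_bits_le (List.replicate j true)
  have a5 := size_bits_le (List.replicate e true)
  have a6 := size_le_of_forall (l := acc) (B := 15) fun x _ => by
    have b1 := size_bool_le x.1.1.1
    have b2 := size_bool_le x.1.1.2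
    have b3 := size_bool_le x.1.2
    have b4 := size_bool_le x.2
    have e : size x = size x.1.1.1 + size x.1.1.2 + 1 + size x.1.2 + 1 + size x.2 + 1 := by
      rw [← size_pair, ← size_pair, ← size_pair]
    omega
  simp only [mkState, size_pair, List.length_replicate] at *
  omega

theorem initialState_encodeCircuit (C : List (Gate n)) :
    initialState (encodeCircuit C) = mkState (List.replicate n true) (encodeCircuit C) 0 [] 0 0 := by
  rw [initialState, show (readUnary (encodeCircuit C)).1 = List.replicate n true by
    rw [encodeCircuit, List.append_assoc, readUnary_encodeNat]]
  rfl

theorem reachable_initialState (O : Oracle) (C : List (Gate n)) :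
    Reachable O n (encodeCircuit C) 0 (initialState (encodeCircuit C)) :=
  ⟨List.replicate n true, 0, [], 0, 0, initialState_encodeCircuit C, by simp, rfl, le_rfl,
    by omega, fun _ => by simp [nodes], fun _ _ _ => by omega⟩

theorem digitList_eq_nil (hO : Represents O p) {L : ℕ}
    (hL : ∀ (i : Fin n) (a : BasisState), O (address i a L) = none) (i : Fin n) {j : ℕ}
    (hj : L ≤ j) : digitList O i j = [] := by
  have h : ∀ a, O (address i a j) = none := fun a => by
    induction j, hj using Nat.le_induction with
    | base => exact hL i a
    | succ j _ ih => exact (hO i a).1 j ih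
  refine List.filter_eq_nil_iff.mpr fun a _ => ?_
  simp [queryWord_replicate, h]

/-- An unfinished qubit `i < n` after `n * L` steps would give `n * L ≤ i * L + j` with `j < L`,
which is impossible. -/
theorem evolve_finished (hO : Represents O p) (hp : ∀ i, ∑ a, p i a = 1) (C : List (Gate n)) {L : ℕ}
    (hL : ∀ (i : Fin n) (a : BasisState), O (address i a L) = none) (ω : ℕ → Bool) :
    (evolve O (n * L) (initialState (encodeCircuit C)) ω).1 = [] := by
  have hnodes : ∀ i j, i < n → L ≤ j → nodes (fun j => (digitList O i j).length) j = 0 :=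
    fun i j hi hj => nodes_eq_zero (hasSum_length_digitList hO hp ⟨i, hi⟩)
      (fun k hk => by rw [digitList_eq_nil hO hL ⟨i, hi⟩ hk]; rfl) hj
  obtain ⟨rem, i, acc, j, e, h0, h1, h2, h3, h4, h5, h6⟩ :=
    (reachable_initialState O C).evolve hO hp (n * L) ω
  rw [h0]
  cases rem with
  | nil => rfl
  | cons r rem =>
    exfalso
    have hin : i < n := by simp at h1; omega
    have h7 := h6 L hnodes hin
    have h8 : j < L := by
      by_contra hj
      have := hnodes i j hin (by omega)
      have := h5 hin
      omega
    have h9 := Nat.mul_le_mul_right L (show i + 1 ≤ n from hin)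
    rw [Nat.succ_mul] at h9
    omega

theorem le_length_encodeCircuit (C : List (Gate n)) : n ≤ (encodeCircuit C).length := by
  simp [encodeCircuit, encodeNat]

end GK

/-! ### The main theorem -/

theorem mainTheorem2 :
    ∃ (M : GK.Prog) (q : Polynomial ℕ),
      ∀ (n : ℕ) (C : List (GK.Gate n)) (U : GK.Op n) (_ : GK.CircuitDenotes C U)
        (p : Fin n → GK.BasisState → ℝ) (_ : ∀ i a, 0 ≤ p i a) (_ : ∀ i, ∑ a, p i a = 1)
        (O : List Bool → Option Bool) (_ : GK.Represents O p),
        -- the output is distributed exactly as the measurement outcome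
        (∀ x : Fin n → Fin 2,
          ((GK.fairCoins.real
              {ω | GK.Outputs M O (GK.encodeCircuit C) ω (GK.outcomeWord x)} : ℝ) : ℂ)
            = GK.outcomeProb U (GK.productState p) x) ∧
        -- polynomial running time, up to a failure probability that can be chosen as `2⁻ᵏ`
        (∀ k : ℕ,
          GK.fairCoins.real
              {ω | ¬ GK.HaltsWithin M O (GK.encodeCircuit C) ω
                (q.eval ((GK.encodeCircuit C).length + k))}
            ≤ (1 / 2) ^ k) ∧
        -- polynomial running time in the worst case if the probabilities have finitely many digits
        (∀ L : ℕ, (∀ (i : Fin n) (a : GK.BasisState), O (GK.address i a L) = none) →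
          ∀ ω, GK.HaltsWithin M O (GK.encodeCircuit C) ω
            (q.eval ((GK.encodeCircuit C).length + L))) := by
  obtain ⟨M, G, hG, hM⟩ := GK.exists_program
  -- With `m = w.length + k` and at most `15 * m + m * m` steps of the process, the argument of `G`
  -- (input length, steps and size bound together) is at most `5 * (m * m) + 200 * m + 60`.
  obtain ⟨q, hq⟩ := (hG.comp ((((GK.PolyBounded.const 5).mul
    (GK.PolyBounded.id.mul .id)).add ((GK.PolyBounded.const 200).mul .id)).add (.const 60))).2
  refine ⟨M, q, fun n C U hU p _ hsum O hO => ?_⟩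
  set w := GK.encodeCircuit C
  have hn : n ≤ w.length := GK.le_length_encodeCircuit C
  have hsize : ∀ ω T t, t ≤ T → GK.size (GK.evolve O t (GK.initialState w) ω) ≤
      4 * w.length + 20 * n + 4 * T + 60 := fun ω T t ht => by
    have h : GK.size (GK.evolve O t (GK.initialState w) ω) ≤
        4 * w.length + 20 * n + 4 * (0 + t) + 60 :=
      ((GK.reachable_initialState O C).evolve hO hsum t ω).size_le
    exact h.trans (by omega)
  -- The linear term will cover `T = 3 * (5 * n + k)`, and the quadratic one `T = n * L`; one
  -- polynomial thus serves both time bounds.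
  have hhalt : ∀ ω k T, T ≤ 15 * (w.length + k) + (w.length + k) * (w.length + k) →
      (GK.evolve O T (GK.initialState w) ω).1 = [] →
      GK.HaltsWithin M O w ω (q.eval (w.length + k)) := fun ω k T hT h => by
    have h1 := ((hM O w ω T).1 _ (hsize ω T) h).1
    have h2 := hG.1 (show w.length + T + (4 * w.length + 20 * n + 4 * T + 60) ≤
      5 * ((w.length + k) * (w.length + k)) + 200 * (w.length + k) + 60 by omega)
    rw [GK.HaltsWithin, GK.run_of_finished h1 (h2.trans (hq _)), h1]
  refine ⟨fun x => ?_, fun k => ?_, fun L hL ω => ?_⟩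
  · have hout : {ω | GK.Outputs M O w ω (GK.outcomeWord x)} =
        {ω | ∃ T, (GK.evolve O T (GK.initialState w) ω).1 = [] ∧
          GK.result (GK.evolve O T (GK.initialState w) ω) = (GK.outcomeWord x).reverse} := by
      ext ω
      constructor
      · rintro ⟨t, h1, h2⟩
        have hfin : (GK.evolve O t (GK.initialState w) ω).1 = [] := by
          by_contra h
          exact (hM O w ω t).2 h h1
        obtain ⟨h3, h4⟩ := (hM O w ω t).1 _ (hsize ω t) hfin
        refine ⟨t, hfin, ?_⟩
        rw [← List.reverse_eq_iff, ← h4, ← h2]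
        rcases le_total t (G (w.length + t + (4 * w.length + 20 * n + 4 * t + 60))) with h | h
        · rw [GK.run_of_finished h1 h]
        · rw [GK.run_of_finished h3 h]
      · rintro ⟨T, h1, h2⟩
        obtain ⟨h3, h4⟩ := (hM O w ω T).1 _ (hsize ω T) h1
        exact ⟨_, h3, by rw [h4, h2, List.reverse_reverse]⟩
    rw [hout, GK.outcomeProb_productState C hU]
    congr 1
    have h := GK.hitProb_mkState hO hsum w (GK.outcomeWord x).reverse (List.replicate n true) 0
      (by simp) []
    rw [List.drop_zero, GK.expect_ofFn] at h
    rw [GK.initialState_encodeCircuit]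
    refine h.trans ?_
    simp [GK.drawn, List.map_reverse, List.map_ofFn, Function.comp_def]
    rfl
  -- Three steps gain a factor `(3 / 4) ^ 3 ≤ 1 / 2`, and `24 ≤ 2 ^ 5`: the first `15 * n` steps
  -- compensate `24 ^ n`, and the remaining `3 * k` give `2⁻ᵏ`.
  · have h := GK.delay_mkState hO hsum w (List.replicate n true) 0 (by simp) [] (3 * (5 * n + k))
    have hsub : {ω | ¬ GK.HaltsWithin M O w ω (q.eval (w.length + k))} ⊆
        {ω | (GK.evolve O (3 * (5 * n + k)) (GK.initialState w) ω).1 ≠ []} := by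
      intro ω h1 h2
      exact h1 (hhalt ω k _ (by nlinarith) h2)
    refine (MeasureTheory.measureReal_mono hsub).trans ?_
    rw [GK.initialState_encodeCircuit]
    refine h.trans ?_
    rw [List.length_replicate]
    calc (24 : ℝ) ^ n * (3 / 4) ^ (3 * (5 * n + k)) ≤ 32 ^ n * (1 / 2) ^ (5 * n + k) := by
          rw [pow_mul]
          gcongr <;> norm_num
      _ = (32 * (1 / 2) ^ 5) ^ n * (1 / 2) ^ k := by
          rw [pow_add, mul_pow, pow_mul]
          ring
      _ = (1 / 2) ^ k := by norm_num
  · exact hhalt ω L (n * L) (by nlinarith) (GK.evolve_finished hO hsum C hL ω)
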